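/- Let $\mathcal O$ be a symmetric operad in simplicial sets and $\mathcal W\subset\mathcal O(1)$ a simplicial submonoid of its unary operations. Let $\mathcal C_{\mathcal O}$ be the simplicially enriched category with objects the natural numbers and $$\mathcal C_{\mathcal O}(a,b)=\coprod_{k_1+\dots+k_a=b}\big(\mathcal O(k_1)\times\dots\times\mathcal O(k_a)\big)\times_{\Sigma_{k_1}\times\dots\times\Sigma_{k_a}}\Sigma_b ,$$ composition being given by the operad structure, and let $\mathcal C_{\mathcal W_+}\subset\mathcal C_{\mathcal O}$ be the subcategory belonging to the suboperad $\mathcal W_+$ with $\mathcal W_+(1)=\mathcal W$ and $\mathcal W_+(n)=\emptyset$ for $n\neq 1$. *Hammocks.* $L^H_{\mathcal C_{\mathcal W_+}}\mathcal C_{\mathcal O}$ is the Dwyer–Kan hammock localization. It has objects $\mathbb N$, and its $(k,\ell)$-bisimplices from $a$ to $b$ are the hammocks of height $\ell$ (with $\ell+1$ rows) from $a$ to $b$ in the category of $k$-simplices $\mathcal C_{\mathcal O_k}$: commutative diagrams with vertical and left-pointing arrows in $\mathcal C_{\mathcal W_{+},k}$ and all horizontal arrows of a column pointing in the same direction, modulo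 composing adjacent columns pointing in the same direction and deleting columns of identities. Composition is concatenation. *Tree hammocks.* $L^{TH}_{\mathcal W}\mathcal O$ is the operad in bisimplicial sets whose $(k,\ell)$-bisimplices of arity $n$ are the tree hammocks of height $\ell$ with $n$ labelled leaves, labelled by $k$-simplices. A tree hammock consists of $\ell+1$ parallel copies of a rooted tree glued from pieces $O_m\colon 1\to m$ ($m\ge 0$), labelled by elements of $\mathcal O_k(m)$, and $W_1\colon 1\leftarrow 1$, labelled by elements of $\mathcal W_k$. Corresponding nodes in consecutive copies are joined by vertical arrows labelled by elements of $\mathcal W_k$, which are identities at the root and at the labelled leaves, and all squares commute. Trees are taken up to reordering the inputs of the pieces $O_m$, acting on labels by $\Sigma_m$, and modulo tree reduction: composing columns of neighbouring pieces pointing in the same direction and deleting columns of identities of type $O_1$ or $W_1$. Operad composition is grafting, and the symmetric groups relabel the leaves. Every hammock from $a$ to $b$ in $\mathcal C_{\mathcal O_k}$ unfolds into a family of $a$ tree hammocks whose labelled leaves are together labelled bijectively by $1,\dots,b$: the atomic pieces that are $i$ steps away from the roots make up its $i$-th column. **Proposition.** Sending the class of a hammock to the tree hammock reduction of the family of tree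 hammocks into which it unfolds is well defined, and it gives a full, identity-on-objects functor of categories enriched in bisimplicial sets $$R\colon L^H_{\mathcal C_{\mathcal W_+}}\mathcal C_{\mathcal O}\longrightarrow \mathcal C_{L^{TH}_{\mathcal W}\mathcal O},$$ that is, $R\colon L^H_{\mathcal C_{\mathcal W_+}}\mathcal C_{\mathcal O}(a,b)_{k,\ell}\to\mathcal C_{L^{TH}_{\mathcal W}\mathcal O}(a,b)_{k,\ell}$ is surjective for all $a,b,k,\ell\ge 0$. -/

import Mathlib

open CategoryTheory Opposite

universe u

namespace TreeHammock

/-! ### Relabelling bijections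

`finSigmaFinEquiv : (Σ s, Fin (j s)) ≃ Fin (∑ s, j s)` is the lexicographic identification of
`j 0 + j 1 + ⋯` inputs with the disjoint union of consecutive blocks of sizes `j 0, j 1, …`. -/

/-- The bijection `(s, t) ↦ (σ s, τ s t)` on concatenated blocks. -/
def blockMap {k k' : ℕ} {j : Fin k → ℕ} {j' : Fin k' → ℕ} (σ : Fin k ≃ Fin k')
    (τ : ∀ s, Fin (j s) ≃ Fin (j' (σ s))) : Fin (∑ s, j s) ≃ Fin (∑ s, j' s) :=
  finSigmaFinEquiv.symm.trans
    ((Equiv.sigmaCongr (β₂ := fun s => Fin (j' s)) σ τ).trans finSigmaFinEquiv)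

/-- The block permutation `σ(j₁, …, jₖ)`. -/
def blockPerm {k k' : ℕ} (σ : Fin k ≃ Fin k') (j : Fin k' → ℕ) :
    Fin (∑ s, j (σ s)) ≃ Fin (∑ s, j s) :=
  blockMap σ fun _ => Equiv.refl _

/-- The sum of permutations `τ₁ ⊕ ⋯ ⊕ τₖ`. -/
def blockSum {k : ℕ} {j j' : Fin k → ℕ} (τ : ∀ s, Fin (j s) ≃ Fin (j' s)) :
    Fin (∑ s, j s) ≃ Fin (∑ s, j' s) :=
  blockMap (Equiv.refl _) τ

/-- Blocks of blocks: the (order preserving) identification of `∑ s, ∑ t, i (s, t)` with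
`∑ p, i p`, where `p = (s, t)` runs through `∑ s, j s` in lexicographic order. -/
def blockAssoc {k : ℕ} (j : Fin k → ℕ) (i : Fin (∑ s, j s) → ℕ) :
    Fin (∑ s, ∑ t, i (finSigmaFinEquiv ⟨s, t⟩)) ≃ Fin (∑ p, i p) :=
  finSigmaFinEquiv.symm.trans
    ((Equiv.sigmaCongrRight fun _ => finSigmaFinEquiv.symm).trans
      ((Equiv.sigmaAssoc fun s t => Fin (i (finSigmaFinEquiv ⟨s, t⟩))).symm.trans
        ((Equiv.sigmaCongrLeft (β := fun p => Fin (i p)) finSigmaFinEquiv).trans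
          finSigmaFinEquiv)))

/-- One block of size `n`. -/
def oneBlock (n : ℕ) : Fin n ≃ Fin (∑ _ : Fin 1, n) :=
  (Equiv.uniqueSigma fun _ : Fin 1 => Fin n).symm.trans finSigmaFinEquiv

/-- `n` blocks of size one. -/
def unitBlocks (n : ℕ) : Fin n ≃ Fin (∑ _ : Fin n, 1) :=
  (Equiv.sigmaUnique (Fin n) fun _ => Fin 1).symm.trans finSigmaFinEquiv

@[simp] theorem blockMap_apply {k k' : ℕ} {j : Fin k → ℕ} {j' : Fin k' → ℕ} (σ : Fin k ≃ Fin k')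
    (τ : ∀ s, Fin (j s) ≃ Fin (j' (σ s))) (s : Fin k) (t : Fin (j s)) :
    blockMap σ τ (finSigmaFinEquiv ⟨s, t⟩) = finSigmaFinEquiv ⟨σ s, τ s t⟩ := by
  simp [blockMap, Equiv.sigmaCongr]

@[simp] theorem blockPerm_apply {k k' : ℕ} (σ : Fin k ≃ Fin k') (j : Fin k' → ℕ) (s : Fin k)
    (t : Fin (j (σ s))) :
    blockPerm σ j (finSigmaFinEquiv ⟨s, t⟩) = finSigmaFinEquiv ⟨σ s, t⟩ :=
  blockMap_apply σ (fun _ => Equiv.refl _) s t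

@[simp] theorem blockSum_apply {k : ℕ} {j j' : Fin k → ℕ} (τ : ∀ s, Fin (j s) ≃ Fin (j' s))
    (s : Fin k) (t : Fin (j s)) :
    blockSum τ (finSigmaFinEquiv ⟨s, t⟩) = finSigmaFinEquiv ⟨s, τ s t⟩ :=
  blockMap_apply (Equiv.refl _) τ s t

@[simp] theorem blockAssoc_apply {k : ℕ} (j : Fin k → ℕ) (i : Fin (∑ s, j s) → ℕ)
    (s : Fin k) (t : Fin (j s)) (r : Fin (i (finSigmaFinEquiv ⟨s, t⟩))) :
    blockAssoc j i (finSigmaFinEquiv ⟨s, finSigmaFinEquiv ⟨t, r⟩⟩) =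
      finSigmaFinEquiv ⟨finSigmaFinEquiv ⟨s, t⟩, r⟩ := by
  simp [blockAssoc, Equiv.sigmaAssoc]

@[simp] theorem oneBlock_apply (n : ℕ) (t : Fin n) (s : Fin 1) :
    finSigmaFinEquiv (n := fun _ : Fin 1 => n) ⟨s, t⟩ = oneBlock n t := by
  obtain rfl : s = default := Subsingleton.elim _ _
  rfl

@[simp] theorem unitBlocks_apply (n : ℕ) (s : Fin n) (t : Fin 1) :
    finSigmaFinEquiv (n := fun _ : Fin n => 1) ⟨s, t⟩ = unitBlocks n s := by
  obtain rfl : t = default := Subsingleton.elim _ _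
  rfl

theorem equiv_sum_ext {k n : ℕ} {j : Fin k → ℕ} {e e' : Fin (∑ s, j s) ≃ Fin n}
    (h : ∀ s t, e (finSigmaFinEquiv ⟨s, t⟩) = e' (finSigmaFinEquiv ⟨s, t⟩)) : e = e' := by
  refine Equiv.ext fun p => ?_
  obtain ⟨⟨s, t⟩, rfl⟩ := finSigmaFinEquiv.surjective p
  exact h s t

theorem sigma_finCongr {α : Type*} {β : Type*} (k : α → ℕ) (e : (Σ a, Fin (k a)) → β) {a b : α}
    (h : a = b) (h' : k a = k b) (r : Fin (k a)) : e ⟨b, finCongr h' r⟩ = e ⟨a, r⟩ := by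
  subst h; rfl

/-! ### Operads -/

/-- A (symmetric) operad in sets. The right actions of the symmetric groups are recorded by
`relabel e x` for `e : Fin n ≃ Fin m` (so `n = m`): the input `i` of `x` becomes the input `e i`,
that is, `x · σ = relabel σ⁻¹ x`. -/
structure SymOperad where
  Op : ℕ → Type u
  relabel : ∀ {n m : ℕ}, (Fin n ≃ Fin m) → Op n → Op m
  one : Op 1
  γ : ∀ {k : ℕ} {j : Fin k → ℕ}, Op k → (∀ s, Op (j s)) → Op (∑ s, j s)
  relabel_refl : ∀ {n : ℕ} (x : Op n), relabel (Equiv.refl _) x = x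
  relabel_trans : ∀ {n m l : ℕ} (e : Fin n ≃ Fin m) (f : Fin m ≃ Fin l) (x : Op n),
    relabel f (relabel e x) = relabel (e.trans f) x
  γ_assoc : ∀ {k : ℕ} {j : Fin k → ℕ} {i : Fin (∑ s, j s) → ℕ} (x : Op k) (y : ∀ s, Op (j s))
    (z : ∀ p, Op (i p)),
    γ (γ x y) z =
      relabel (blockAssoc j i) (γ x fun s => γ (y s) fun t => z (finSigmaFinEquiv ⟨s, t⟩))
  one_γ : ∀ {n : ℕ} (x : Op n), γ one (fun _ : Fin 1 => x) = relabel (oneBlock n) x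
  γ_one : ∀ {n : ℕ} (x : Op n), γ x (fun _ => one) = relabel (unitBlocks n) x
  γ_relabel_left : ∀ {k k' : ℕ} {j : Fin k' → ℕ} (σ : Fin k ≃ Fin k') (x : Op k)
    (y : ∀ s, Op (j s)),
    γ (relabel σ x) y = relabel (blockPerm σ j) (γ x fun s => y (σ s))
  γ_relabel_right : ∀ {k : ℕ} {j j' : Fin k → ℕ} (τ : ∀ s, Fin (j s) ≃ Fin (j' s)) (x : Op k)
    (y : ∀ s, Op (j s)),
    γ x (fun s => relabel (τ s) (y s)) = relabel (blockSum τ) (γ x y)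

namespace SymOperad

/-- A morphism of operads. -/
@[ext] structure Hom (O P : SymOperad.{u}) where
  app : ∀ {n : ℕ}, O.Op n → P.Op n
  app_relabel : ∀ {n m : ℕ} (e : Fin n ≃ Fin m) (x : O.Op n),
    app (O.relabel e x) = P.relabel e (app x)
  app_one : app O.one = P.one
  app_γ : ∀ {k : ℕ} {j : Fin k → ℕ} (x : O.Op k) (y : ∀ s, O.Op (j s)),
    app (O.γ x y) = P.γ (app x) fun s => app (y s)

instance : Category SymOperad.{u} where
  Hom := Hom
  id O := ⟨fun x => x, fun _ _ => rfl, rfl, fun _ _ => rfl⟩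
  comp f g := ⟨fun x => g.app (f.app x), fun _ _ => by rw [f.app_relabel, g.app_relabel],
    by rw [f.app_one, g.app_one], fun _ _ => by rw [f.app_γ, g.app_γ]⟩

variable {O : SymOperad.{u}}

theorem γ_congr {k k' : ℕ} {j : Fin k → ℕ} {j' : Fin k' → ℕ} {σ : Fin k ≃ Fin k'}
    {τ : ∀ s, Fin (j s) ≃ Fin (j' (σ s))} {x : O.Op k} {x' : O.Op k'} {y : ∀ s, O.Op (j s)}
    {y' : ∀ s, O.Op (j' s)} (hx : x' = O.relabel σ x)
    (hy : ∀ s, y' (σ s) = O.relabel (τ s) (y s)) :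
    O.γ x' y' = O.relabel (blockMap σ τ) (O.γ x y) := by
  subst hx
  rw [γ_relabel_left]
  simp only [hy]
  rw [γ_relabel_right, relabel_trans]
  congr 1
  exact equiv_sum_ext fun s t => by simp

theorem op_finCongr {α : Type*} (k : α → ℕ) (y : ∀ a, O.Op (k a)) {a b : α} (h : a = b)
    (h' : k a = k b) : y b = O.relabel (finCongr h') (y a) := by
  subst h; exact (O.relabel_refl _).symm

/-- `γ (w; x)` for `w` unary. -/
def lact (O : SymOperad.{u}) {n : ℕ} (w : O.Op 1) (x : O.Op n) : O.Op n :=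
  O.relabel (oneBlock n).symm (O.γ w fun _ : Fin 1 => x)

/-- `γ (x; w₁, …, wₙ)` for `w₁, …, wₙ` unary. -/
def ract (O : SymOperad.{u}) {n : ℕ} (x : O.Op n) (w : Fin n → O.Op 1) : O.Op n :=
  O.relabel (unitBlocks n).symm (O.γ x w)

theorem γ_unary {n : ℕ} (w : O.Op 1) (x : Fin 1 → O.Op n) :
    O.γ (j := fun _ => n) w x = O.relabel (oneBlock n) (O.lact w (x 0)) := by
  rw [lact, relabel_trans, Equiv.symm_trans_self, relabel_refl]
  congr 1; funext s; rw [Subsingleton.elim s 0]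

theorem γ_unaries {n : ℕ} (x : O.Op n) (w : Fin n → O.Op 1) :
    O.γ x w = O.relabel (unitBlocks n) (O.ract x w) := by
  rw [ract, relabel_trans, Equiv.symm_trans_self, relabel_refl]

theorem relabel_symm_eq {n m : ℕ} {e : Fin n ≃ Fin m} {x : O.Op n} {y : O.Op m}
    (h : y = O.relabel e x) : O.relabel e.symm y = x := by
  rw [h, relabel_trans, Equiv.self_trans_symm, relabel_refl]

theorem relabel_congr {n m : ℕ} {e e' : Fin n ≃ Fin m} (h : e = e') (x : O.Op n) :
    O.relabel e x = O.relabel e' x := by rw [h]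

theorem relabel_inj {n m : ℕ} {e : Fin n ≃ Fin m} {x y : O.Op n}
    (h : O.relabel e x = O.relabel e y) : x = y := by
  have := congrArg (O.relabel e.symm) h
  simpa [relabel_trans, relabel_refl] using this

theorem ract_γ {k : ℕ} {j : Fin k → ℕ} (x : O.Op k) (y : ∀ s, O.Op (j s))
    (w : Fin (∑ s, j s) → O.Op 1) :
    O.ract (O.γ x y) w =
      O.γ x fun s => O.ract (y s) fun t => w (finSigmaFinEquiv ⟨s, t⟩) := by
  apply relabel_symm_eq
  have h := O.γ_relabel_right (fun s => unitBlocks (j s)) x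
    fun s => O.ract (y s) fun t => w (finSigmaFinEquiv ⟨s, t⟩)
  simp only [← γ_unaries] at h
  refine (O.γ_assoc (i := fun _ => 1) x y w).trans ((congrArg _ h).trans ?_)
  rw [relabel_trans]
  apply relabel_congr
  refine equiv_sum_ext fun s t => ?_
  refine (congrArg (blockAssoc j fun _ => 1) (blockSum_apply _ s t)).trans ?_
  rw [← unitBlocks_apply (j s) t 0, ← unitBlocks_apply _ _ 0]
  exact blockAssoc_apply j (fun _ => 1) s t 0

theorem γ_ract {k : ℕ} {j : Fin k → ℕ} (x : O.Op k) (w : Fin k → O.Op 1)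
    (y : ∀ s, O.Op (j s)) :
    O.γ (O.ract x w) y = O.γ x fun s => O.lact (w s) (y s) := by
  have h1 : O.γ (O.γ x w) (fun p => y ((unitBlocks k).symm p)) =
      O.relabel (blockAssoc (fun _ => 1) fun p => j ((unitBlocks k).symm p))
        (O.γ x fun s => O.γ (w s) fun t : Fin 1 =>
          y ((unitBlocks k).symm (finSigmaFinEquiv ⟨s, t⟩))) := O.γ_assoc _ _ _
  have e : ∀ (s : Fin k) (t : Fin 1),
      (unitBlocks k).symm (finSigmaFinEquiv (n := fun _ : Fin k => 1) ⟨s, t⟩) = s := by simp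
  rw [ract, γ_relabel_left, h1, relabel_trans]
  have h2 : ∀ s, (O.γ (w s) fun t : Fin 1 =>
      y ((unitBlocks k).symm (finSigmaFinEquiv (n := fun _ : Fin k => 1) ⟨s, t⟩))) =
      O.relabel ((oneBlock (j s)).trans (blockSum fun t => finCongr (congrArg j (e s t).symm)))
        (O.lact (w s) (y s)) := by
    intro s
    rw [← relabel_trans, ← γ_unary (w s) fun _ => y s, ← γ_relabel_right]
    congr 1
    funext t
    exact op_finCongr j y (e s t).symm _
  rw [funext h2, γ_relabel_right, relabel_trans]
  refine (relabel_congr ?_ _).trans (O.relabel_refl _)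
  refine equiv_sum_ext fun s t => ?_
  simp only [Equiv.trans_apply, blockSum_apply, Equiv.refl_apply]
  rw [← oneBlock_apply (j s) t 0, blockSum_apply]
  rw [blockAssoc_apply (fun _ => 1) (fun p => j ((unitBlocks k).symm p)) s 0, blockPerm_apply]
  exact sigma_finCongr j finSigmaFinEquiv (e s 0).symm _ t

theorem γ_lact {k : ℕ} {j : Fin k → ℕ} (w : O.Op 1) (x : O.Op k) (y : ∀ s, O.Op (j s)) :
    O.γ (O.lact w x) y = O.lact w (O.γ x y) := by
  have h1 : O.γ (O.γ w fun _ : Fin 1 => x) (fun p => y ((oneBlock k).symm p)) =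
      O.relabel (blockAssoc (fun _ : Fin 1 => k) fun p => j ((oneBlock k).symm p))
        (O.γ w fun s : Fin 1 => O.γ x fun t : Fin k =>
          y ((oneBlock k).symm (finSigmaFinEquiv ⟨s, t⟩))) := O.γ_assoc _ _ _
  have e : ∀ (s : Fin 1) (t : Fin k),
      (oneBlock k).symm (finSigmaFinEquiv (n := fun _ : Fin 1 => k) ⟨s, t⟩) = t := by simp
  rw [lact, γ_relabel_left, h1, relabel_trans]
  have h2 : ∀ s : Fin 1, (O.γ x fun t : Fin k =>
      y ((oneBlock k).symm (finSigmaFinEquiv (n := fun _ : Fin 1 => k) ⟨s, t⟩))) =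
      O.relabel (blockSum fun t => finCongr (congrArg j (e s t).symm)) (O.γ x y) := by
    intro s
    rw [← γ_relabel_right]
    congr 1
    funext t
    exact op_finCongr j y (e s t).symm _
  rw [funext h2, γ_relabel_right, relabel_trans, lact]
  apply relabel_congr
  refine equiv_sum_ext fun s p => ?_
  obtain ⟨⟨t, r⟩, rfl⟩ := finSigmaFinEquiv.surjective p
  simp only [Equiv.trans_apply, blockSum_apply]
  rw [blockAssoc_apply (fun _ : Fin 1 => k) (fun p => j ((oneBlock k).symm p)) s t,
    blockPerm_apply]
  refine (sigma_finCongr j finSigmaFinEquiv (e s t).symm _ r).trans ?_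
  exact ((Equiv.symm_apply_eq _).2 (oneBlock_apply _ _ _)).symm

theorem lact_one {n : ℕ} (x : O.Op n) : O.lact O.one x = x :=
  relabel_symm_eq (O.one_γ x)

theorem ract_one {n : ℕ} (x : O.Op n) : O.ract x (fun _ => O.one) = x :=
  relabel_symm_eq (O.γ_one x)

theorem lact_eq_ract (w x : O.Op 1) : O.lact w x = O.ract w fun _ => x :=
  relabel_congr (Subsingleton.elim _ _) _

theorem lact_lact {n : ℕ} (w w' : O.Op 1) (x : O.Op n) :
    O.lact (O.lact w w') x = O.lact w (O.lact w' x) := by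
  apply relabel_inj (e := oneBlock n)
  rw [← γ_unary _ fun _ => x, ← γ_unary _ fun _ => O.lact w' x, lact_eq_ract, γ_ract]

theorem ract_ract {n : ℕ} (x : O.Op n) (w w' : Fin n → O.Op 1) :
    O.ract (O.ract x w) w' = O.ract x fun s => O.lact (w s) (w' s) := by
  apply relabel_inj (e := unitBlocks n)
  rw [← γ_unaries, ← γ_unaries, γ_ract]

theorem lact_relabel {n m : ℕ} (e : Fin n ≃ Fin m) (w : O.Op 1) (x : O.Op n) :
    O.lact w (O.relabel e x) = O.relabel e (O.lact w x) := by
  rw [lact, lact, O.γ_relabel_right (fun _ : Fin 1 => e), relabel_trans, relabel_trans]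
  apply relabel_congr
  refine equiv_sum_ext fun s t => ?_
  rw [Equiv.trans_apply, Equiv.trans_apply, blockSum_apply, oneBlock_apply, oneBlock_apply,
    Equiv.symm_apply_apply, Equiv.symm_apply_apply]

theorem ract_lact {n : ℕ} (w : O.Op 1) (x : O.Op n) (w' : Fin n → O.Op 1) :
    O.ract (O.lact w x) w' = O.lact w (O.ract x w') := by
  rw [ract, γ_lact w x w', γ_unaries, lact_relabel, relabel_trans, Equiv.self_trans_symm,
    relabel_refl]

theorem ract_relabel {n m : ℕ} (e : Fin n ≃ Fin m) (x : O.Op n) (w : Fin m → O.Op 1) :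
    O.ract (O.relabel e x) w = O.relabel e (O.ract x fun s => w (e s)) := by
  rw [ract, ract, γ_relabel_left, relabel_trans, relabel_trans]
  apply relabel_congr
  refine equiv_sum_ext (j := fun _ => 1) fun s t => ?_
  simp only [Equiv.trans_apply]
  erw [blockPerm_apply e (fun _ => 1) s t]
  simp only [unitBlocks_apply, Equiv.symm_apply_apply]

/-- The unary operations form a monoid under composition: `x * y = γ (x; y)`. -/
instance (O : SymOperad.{u}) : Monoid (O.Op 1) where
  one := O.one
  mul := O.lact
  one_mul := lact_one
  mul_one x := (lact_eq_ract x O.one).trans (ract_one x)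
  mul_assoc := lact_lact

theorem Hom.app_lact {O P : SymOperad.{u}} (φ : O ⟶ P) {n : ℕ} (w : O.Op 1) (x : O.Op n) :
    φ.app (O.lact w x) = P.lact (φ.app w) (φ.app x) := by
  rw [lact, lact, φ.app_relabel, φ.app_γ]

theorem Hom.app_ract {O P : SymOperad.{u}} (φ : O ⟶ P) {n : ℕ} (x : O.Op n)
    (w : Fin n → O.Op 1) : φ.app (O.ract x w) = P.ract (φ.app x) fun s => φ.app (w s) := by
  rw [ract, ract, φ.app_relabel, φ.app_γ]

end SymOperad

/-! ### The category of operators of an operad -/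

namespace SymOperad

/-- Representatives of morphisms `a ⟶ b`: operations `op i` with `k i` inputs for `i = 1, …, a`,
and a labelling of all the inputs by `1, …, b`. Here `∑ k i = b`, and the labelling amounts to an
element of the symmetric group on `b` letters. -/
structure PreHom (O : SymOperad.{u}) (a b : ℕ) : Type u where
  k : Fin a → ℕ
  op : ∀ i, O.Op (k i)
  e : (Σ i, Fin (k i)) ≃ Fin b

namespace PreHom

variable {O : SymOperad.{u}}

/-- Representatives are identified along permutations of the inputs of each operation. -/
def Rel {a b : ℕ} (f g : O.PreHom a b) : Prop :=
  ∃ τ : ∀ i, Fin (f.k i) ≃ Fin (g.k i),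
    (∀ i, g.op i = O.relabel (τ i) (f.op i)) ∧ ∀ i s, g.e ⟨i, τ i s⟩ = f.e ⟨i, s⟩

instance setoid (O : SymOperad.{u}) (a b : ℕ) : Setoid (O.PreHom a b) where
  r := Rel
  iseqv :=
    { refl := fun f => ⟨fun _ => Equiv.refl _, fun _ => (O.relabel_refl _).symm, fun _ _ => rfl⟩
      symm := by
        rintro f g ⟨τ, h, h'⟩
        refine ⟨fun i => (τ i).symm, fun i => (relabel_symm_eq (h i)).symm, fun i s => ?_⟩
        rw [← h', Equiv.apply_symm_apply]
      trans := by
        rintro f g l ⟨τ, h, h'⟩ ⟨ρ, r, r'⟩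
        refine ⟨fun i => (τ i).trans (ρ i), fun i => ?_, fun i s => ?_⟩
        · rw [r, h, relabel_trans]
        · rw [Equiv.trans_apply, r', h'] }

/-- The identity. -/
def id (O : SymOperad.{u}) (a : ℕ) : O.PreHom a a where
  k _ := 1
  op _ := O.one
  e := Equiv.sigmaUnique _ _

/-- Composition: the operation of `g` labelled `f.e (i, s)` is plugged into the input `s` of the
`i`-th operation of `f`. -/
def comp {a b c : ℕ} (f : O.PreHom a b) (g : O.PreHom b c) : O.PreHom a c where
  k i := ∑ s, g.k (f.e ⟨i, s⟩)
  op i := O.γ (f.op i) fun s => g.op (f.e ⟨i, s⟩)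
  e := (Equiv.sigmaCongrRight fun _ => finSigmaFinEquiv.symm).trans
    ((Equiv.sigmaAssoc fun i s => Fin (g.k (f.e ⟨i, s⟩))).symm.trans
      ((Equiv.sigmaCongrLeft (β := fun t => Fin (g.k t)) f.e).trans g.e))

@[simp] theorem comp_e {a b c : ℕ} (f : O.PreHom a b) (g : O.PreHom b c) (i : Fin a)
    (s : Fin (f.k i)) (t : Fin (g.k (f.e ⟨i, s⟩))) :
    (f.comp g).e ⟨i, finSigmaFinEquiv ⟨s, t⟩⟩ = g.e ⟨f.e ⟨i, s⟩, t⟩ := by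
  change g.e (Equiv.sigmaCongrLeft f.e ((Equiv.sigmaAssoc fun i s =>
    Fin (g.k (f.e ⟨i, s⟩))).symm ⟨i, finSigmaFinEquiv.symm (finSigmaFinEquiv ⟨s, t⟩)⟩)) = _
  rw [Equiv.symm_apply_apply]
  rfl

theorem comp_rel {a b c : ℕ} {f f' : O.PreHom a b} {g g' : O.PreHom b c} (hf : f.Rel f')
    (hg : g.Rel g') : (f.comp g).Rel (f'.comp g') := by
  obtain ⟨τ, h, h'⟩ := hf
  obtain ⟨ρ, r, r'⟩ := hg
  let T (i : Fin a) (s : Fin (f.k i)) : Fin (g.k (f.e ⟨i, s⟩)) ≃ Fin (g'.k (f'.e ⟨i, τ i s⟩)) :=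
    (ρ (f.e ⟨i, s⟩)).trans (finCongr (congrArg g'.k (h' i s).symm))
  let B (i : Fin a) : Fin (∑ s, g.k (f.e ⟨i, s⟩)) ≃ Fin (∑ s, g'.k (f'.e ⟨i, s⟩)) :=
    blockMap (τ i) (T i)
  have hB : ∀ (i : Fin a) (s : Fin (f.k i)) (t : Fin (g.k (f.e ⟨i, s⟩))),
      B i (finSigmaFinEquiv ⟨s, t⟩) =
        finSigmaFinEquiv (n := fun s => g'.k (f'.e ⟨i, s⟩)) ⟨τ i s, T i s t⟩ :=
    fun i s t => blockMap_apply (j := fun s => g.k (f.e ⟨i, s⟩))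
      (j' := fun s => g'.k (f'.e ⟨i, s⟩)) (τ i) (T i) s t
  refine ⟨B, fun i => ?_, fun i p => ?_⟩
  · have key : ∀ s, g'.op (f'.e ⟨i, τ i s⟩) = O.relabel (T i s) (g.op (f.e ⟨i, s⟩)) := by
      intro s
      refine Eq.trans ?_ (O.relabel_trans (ρ (f.e ⟨i, s⟩))
        (finCongr (congrArg g'.k (h' i s).symm)) _)
      rw [← r]
      exact op_finCongr g'.k g'.op (h' i s).symm _
    exact γ_congr (y' := fun s => g'.op (f'.e ⟨i, s⟩)) (h i) key
  · obtain ⟨⟨s, t⟩, rfl⟩ := finSigmaFinEquiv.surjective p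
    refine (congrArg (fun q => (f'.comp g').e ⟨i, q⟩) (hB i s t)).trans ?_
    refine (comp_e f' g' i (τ i s) (T i s t)).trans ?_
    refine Eq.trans ?_ (comp_e f g i s t).symm
    refine Eq.trans ?_ (r' (f.e ⟨i, s⟩) t)
    exact sigma_finCongr g'.k g'.e (h' i s).symm (congrArg g'.k (h' i s).symm) _

theorem id_comp_rel {a b : ℕ} (f : O.PreHom a b) : ((PreHom.id O a).comp f).Rel f := by
  refine ⟨fun i => (oneBlock (f.k i)).symm, fun i => ?_, fun i p => ?_⟩
  · exact (relabel_symm_eq (O.one_γ (f.op i))).symm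
  · obtain ⟨⟨s, t⟩, rfl⟩ := finSigmaFinEquiv.surjective p
    refine Eq.trans ?_ (comp_e (PreHom.id O a) f i s t).symm
    exact congrArg (fun r => f.e ⟨i, r⟩) ((Equiv.symm_apply_eq _).2 (oneBlock_apply _ t s))

theorem comp_id_rel {a b : ℕ} (f : O.PreHom a b) : (f.comp (PreHom.id O b)).Rel f := by
  refine ⟨fun i => (unitBlocks (f.k i)).symm, fun i => ?_, fun i p => ?_⟩
  · exact (relabel_symm_eq (O.γ_one (f.op i))).symm
  · obtain ⟨⟨s, t⟩, rfl⟩ := finSigmaFinEquiv.surjective p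
    refine Eq.trans ?_ (comp_e f (PreHom.id O b) i s t).symm
    exact congrArg (fun r => f.e ⟨i, r⟩) ((Equiv.symm_apply_eq _).2 (unitBlocks_apply _ s t))

theorem assoc_rel {a b c d : ℕ} (f : O.PreHom a b) (g : O.PreHom b c) (h : O.PreHom c d) :
    (f.comp (g.comp h)).Rel ((f.comp g).comp h) := by
  have e : ∀ i s t, g.e ⟨f.e ⟨i, s⟩, t⟩ = (f.comp g).e ⟨i, finSigmaFinEquiv ⟨s, t⟩⟩ :=
    fun i s t => (PreHom.comp_e f g i s t).symm
  let T (i : Fin a) (s : Fin (f.k i)) (t : Fin (g.k (f.e ⟨i, s⟩))) :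
      Fin (h.k (g.e ⟨f.e ⟨i, s⟩, t⟩)) ≃ Fin (h.k ((f.comp g).e ⟨i, finSigmaFinEquiv ⟨s, t⟩⟩)) :=
    finCongr (congrArg h.k (e i s t))
  let A (i : Fin a) := blockAssoc (fun s => g.k (f.e ⟨i, s⟩)) fun p => h.k ((f.comp g).e ⟨i, p⟩)
  let B (i : Fin a) := blockSum fun s => blockSum fun t => T i s t
  refine ⟨fun i => (B i).trans (A i), fun i => ?_, fun i p => ?_⟩
  · refine (O.γ_assoc _ _ fun p => h.op ((f.comp g).e ⟨i, p⟩)).trans ?_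
    refine Eq.trans ?_ (O.relabel_trans (B i) (A i) _)
    refine congrArg (O.relabel (A i)) ?_
    refine γ_congr (σ := Equiv.refl _) (O.relabel_refl _).symm fun s => ?_
    refine γ_congr (σ := Equiv.refl _) (O.relabel_refl _).symm fun t => ?_
    exact op_finCongr h.k h.op (e i s t) _
  · obtain ⟨⟨s, p⟩, rfl⟩ := finSigmaFinEquiv.surjective p
    obtain ⟨⟨t, r⟩, rfl⟩ := finSigmaFinEquiv.surjective p
    have hB : B i (finSigmaFinEquiv ⟨s, finSigmaFinEquiv ⟨t, r⟩⟩) =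
        finSigmaFinEquiv ⟨s, finSigmaFinEquiv ⟨t, T i s t r⟩⟩ := by
      refine (blockSum_apply (fun s => blockSum fun t => T i s t) s _).trans ?_
      exact congrArg (fun q => finSigmaFinEquiv ⟨s, q⟩) (blockSum_apply (fun t => T i s t) t r)
    refine Eq.trans ?_ (comp_e f (g.comp h) i s _).symm
    refine Eq.trans ?_ (comp_e g h (f.e ⟨i, s⟩) t r).symm
    refine Eq.trans ?_ (sigma_finCongr h.k h.e (e i s t) (congrArg h.k (e i s t)) r)
    refine Eq.trans ?_ (comp_e (f.comp g) h i _ _)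
    refine congrArg (fun q => ((f.comp g).comp h).e ⟨i, q⟩) ?_
    refine (congrArg (A i) hB).trans ?_
    exact blockAssoc_apply _ (fun p => h.k ((f.comp g).e ⟨i, p⟩)) s t _

/-- The map induced by a morphism of operads. -/
def map {O P : SymOperad.{u}} (φ : O ⟶ P) {a b : ℕ} (f : O.PreHom a b) : P.PreHom a b :=
  ⟨f.k, fun i => φ.app (f.op i), f.e⟩

end PreHom

/-- Morphisms `a ⟶ b` of the category of operators:
`∐ (O(k₁) × ⋯ × O(kₐ)) ×_{Σ_{k₁} × ⋯ × Σ_{kₐ}} Σ_b`. -/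
def EnvHom (O : SymOperad.{u}) (a b : ℕ) : Type u := Quotient (PreHom.setoid O a b)

/-- The class of a representative. -/
def EnvHom.mk {O : SymOperad.{u}} {a b : ℕ} (f : O.PreHom a b) : O.EnvHom a b :=
  Quotient.mk _ f

theorem EnvHom.sound {O : SymOperad.{u}} {a b : ℕ} {f g : O.PreHom a b} (h : f.Rel g) :
    EnvHom.mk f = EnvHom.mk g :=
  Quotient.sound h

/-- The category `C_O` associated with an operad; its objects are the natural numbers. -/
def Env (_ : SymOperad.{u}) : Type := ℕ

/-- The object `n` of `C_O`. -/
abbrev Env.of (O : SymOperad.{u}) (n : ℕ) : O.Env := n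

instance (O : SymOperad.{u}) : Category.{u} O.Env where
  Hom a b := O.EnvHom a b
  id a := EnvHom.mk (PreHom.id O a)
  comp {a b c} f g := Quotient.map₂ PreHom.comp (fun _ _ h _ _ h' => PreHom.comp_rel h h') f g
  id_comp {a b} f := by
    induction f using Quotient.inductionOn
    exact Quotient.sound (PreHom.id_comp_rel _)
  comp_id {a b} f := by
    induction f using Quotient.inductionOn
    exact Quotient.sound (PreHom.comp_id_rel _)
  assoc {a b c d} f g h := by
    induction f using Quotient.inductionOn
    induction g using Quotient.inductionOn
    induction h using Quotient.inductionOn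
    exact (Quotient.sound (PreHom.assoc_rel _ _ _)).symm

/-- The identity on objects functor `C_O ⥤ C_P` induced by a morphism of operads. -/
def envMap {O P : SymOperad.{u}} (φ : O ⟶ P) : O.Env ⥤ P.Env where
  obj a := a
  map {a b} f := Quotient.map (PreHom.map φ) (by
    rintro f g ⟨τ, h, h'⟩
    exact ⟨τ, fun i => by simp only [PreHom.map, h, φ.app_relabel], h'⟩) f
  map_id a := by
    refine Quotient.sound ⟨fun _ => Equiv.refl _, fun i => ?_, fun _ _ => rfl⟩
    exact φ.app_one.symm.trans (P.relabel_refl _).symm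
  map_comp {a b c} f g := by
    induction f using Quotient.inductionOn with | _ f
    induction g using Quotient.inductionOn with | _ g
    refine Quotient.sound ⟨fun _ => Equiv.refl _, fun i => ?_, fun _ _ => rfl⟩
    exact (φ.app_γ _ _).symm.trans (P.relabel_refl _).symm

theorem envMap_id (O : SymOperad.{u}) : envMap (𝟙 O) = 𝟭 O.Env := by
  refine CategoryTheory.Functor.hext (fun _ => rfl) fun a b f => heq_of_eq ?_
  induction f using Quotient.inductionOn
  rfl

theorem envMap_comp {O P Q : SymOperad.{u}} (φ : O ⟶ P) (ψ : P ⟶ Q) :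
    envMap (φ ≫ ψ) = envMap φ ⋙ envMap ψ := by
  refine CategoryTheory.Functor.hext (fun _ => rfl) fun a b f => heq_of_eq ?_
  induction f using Quotient.inductionOn
  rfl

end SymOperad
end TreeHammock
/-! ### Tree hammocks -/

namespace TreeHammock

open SymOperad

/-- A node of a tree hammock with rows indexed by `I`: the vertical maps connecting the copies of
the node in the different rows. They are elements of `W`, given for all pairs of rows
`i ≤ j` (the maps between consecutive rows and their composites). -/
@[ext] structure Vert {O : SymOperad.{u}} (W : Submonoid (O.Op 1)) (I : Type) [Preorder I] :
    Type u where
  map : ∀ {i j : I}, i ≤ j → O.Op 1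
  mem : ∀ {i j : I} (h : i ≤ j), map h ∈ W
  map_refl : ∀ i : I, map (le_refl i) = 1
  map_trans : ∀ {i j k : I} (h : i ≤ j) (h' : j ≤ k), map (h.trans h') = map h * map h'

section Pieces

variable {O P : SymOperad.{u}} {W : Submonoid (O.Op 1)} {I : Type} [Preorder I]

/-- The node all of whose vertical maps are identities. -/
def Vert.const (W : Submonoid (O.Op 1)) (I : Type) [Preorder I] : Vert W I where
  map _ := 1
  mem _ := W.one_mem
  map_refl _ := rfl
  map_trans _ _ := (one_mul _).symm

/-- A column of atomic pieces `O_n : 1 → n`, labelled by operations of arity `n`, with root node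
`v` and leaf nodes `u 1, …, u n`. -/
@[ext] structure Fwd {n : ℕ} (v : Vert W I) (u : Fin n → Vert W I) : Type u where
  op : I → O.Op n
  comm : ∀ {i j : I} (h : i ≤ j),
    O.ract (op i) (fun s => (u s).map h) = O.lact (v.map h) (op j)

/-- A column of atomic pieces `W_1 : 1 ← 1`, labelled by elements of `W`, with root node `v` (the
target of the arrows) and leaf node `u` (their source). -/
@[ext] structure Bwd (v u : Vert W I) : Type u where
  op : I → O.Op 1
  mem : ∀ i, op i ∈ W
  comm : ∀ {i j : I} (h : i ≤ j), op i * v.map h = u.map h * op j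

namespace Fwd

/-- The column of identities. -/
def id (v : Vert W I) : Fwd v (fun _ : Fin 1 => v) where
  op _ := 1
  comm h := by
    rw [← lact_eq_ract]
    exact (one_mul (v.map h)).trans (mul_one (v.map h)).symm

/-- Permuting the leaf nodes. -/
def relabel {n m : ℕ} {v : Vert W I} {u : Fin m → Vert W I} (σ : Fin n ≃ Fin m)
    (x : Fwd v fun s => u (σ s)) : Fwd v u where
  op i := O.relabel σ (x.op i)
  comm h := by rw [ract_relabel, x.comm h, lact_relabel]

/-- Composition of a column with columns glued to all of its leaf nodes. -/
def comp {n : ℕ} {m : Fin n → ℕ} {v : Vert W I} {u : Fin n → Vert W I}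
    {z : (Σ s, Fin (m s)) → Vert W I} (x : Fwd v u) (y : ∀ s, Fwd (u s) fun t => z ⟨s, t⟩) :
    Fwd v (fun p => z (finSigmaFinEquiv.symm p)) where
  op i := O.γ (x.op i) fun s => (y s).op i
  comm {i j} h := by
    rw [ract_γ]
    simp only [Equiv.symm_apply_apply, (y _).comm h]
    rw [← γ_ract, x.comm h, γ_lact]

end Fwd

namespace Bwd

/-- The column of identities. -/
def id (v : Vert W I) : Bwd v v where
  op _ := 1
  mem _ := W.one_mem
  comm h := (one_mul (v.map h)).trans (mul_one (v.map h)).symm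

/-- Composition of adjacent columns. -/
def comp {v u z : Vert W I} (w : Bwd v u) (w' : Bwd u z) : Bwd v z where
  op i := w'.op i * w.op i
  mem i := W.mul_mem (w'.mem i) (w.mem i)
  comm h := by rw [mul_assoc, w.comm h, ← mul_assoc, w'.comm h, mul_assoc]

end Bwd

end Pieces

/-- Tree hammocks with root node `v`: trees glued from columns of atomic pieces, whose labelled
leaves carry labels in `L`. The vertical maps at the labelled leaves are identities. (Leaves
without label arise from the pieces `O_0`.) -/
inductive Tree {O : SymOperad.{u}} (W : Submonoid (O.Op 1)) (I : Type) [Preorder I] (L : Type) :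
    Vert W I → Type u
  | leaf {v : Vert W I} (hv : v = Vert.const W I) (l : L) : Tree W I L v
  | fwd {n : ℕ} {v : Vert W I} {u : Fin n → Vert W I} (x : Fwd v u)
      (c : ∀ s, Tree W I L (u s)) : Tree W I L v
  | bwd {v u : Vert W I} (w : Bwd v u) (c : Tree W I L u) : Tree W I L v

namespace Tree

section

variable {O P : SymOperad.{u}} {W : Submonoid (O.Op 1)} {I : Type} [Preorder I] {L L' L'' : Type}

/-- The number of leaves with label `l`. -/
def count [DecidableEq L] (l : L) : ∀ {v : Vert W I}, Tree W I L v → ℕ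
  | _, leaf _ l' => if l' = l then 1 else 0
  | _, fwd _ c => ∑ s, (c s).count l
  | _, bwd _ c => c.count l

/-- Grafting the tree `f l` onto each leaf labelled `l`. -/
def bind (f : L → Tree W I L' (Vert.const W I)) :
    ∀ {v : Vert W I}, Tree W I L v → Tree W I L' v
  | _, leaf hv l => hv ▸ f l
  | _, fwd x c => fwd x fun s => (c s).bind f
  | _, bwd w c => bwd w (c.bind f)

/-- Changing the labels of the leaves. -/
def relabel (f : L → L') : ∀ {v : Vert W I}, Tree W I L v → Tree W I L' v
  | _, leaf hv l => leaf hv (f l)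
  | _, fwd x c => fwd x fun s => (c s).relabel f
  | _, bwd w c => bwd w (c.relabel f)

/-- Tree reduction. Two tree hammocks are identified if they are related by composing columns of
neighbouring arrows pointing in the same direction and by deleting columns of identities. Moreover
trees are considered up to reordering the inputs of a column of pieces `O_n`, which acts on the
labels through the symmetric group action of the operad. -/
inductive Red : ∀ {v : Vert W I}, Tree W I L v → Tree W I L v → Prop
  | planar {n m : ℕ} {v : Vert W I} {u : Fin m → Vert W I} (σ : Fin n ≃ Fin m)
      (x : Fwd v fun s => u (σ s)) (c : ∀ s, Tree W I L (u s)) :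
      Red (fwd x fun s => c (σ s)) (fwd (x.relabel σ) c)
  | fwd_fwd {n : ℕ} {m : Fin n → ℕ} {v : Vert W I} {u : Fin n → Vert W I}
      {z : (Σ s, Fin (m s)) → Vert W I} (x : Fwd v u) (y : ∀ s, Fwd (u s) fun t => z ⟨s, t⟩)
      (c : ∀ p, Tree W I L (z p)) :
      Red (fwd x fun s => fwd (y s) fun t => c ⟨s, t⟩)
        (fwd (x.comp y) fun p => c (finSigmaFinEquiv.symm p))
  | fwd_id {v : Vert W I} (c : Tree W I L v) : Red (fwd (Fwd.id v) fun _ => c) c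
  | bwd_bwd {v u z : Vert W I} (w : Bwd v u) (w' : Bwd u z) (c : Tree W I L z) :
      Red (bwd w (bwd w' c)) (bwd (w.comp w') c)
  | bwd_id {v : Vert W I} (c : Tree W I L v) : Red (bwd (Bwd.id v) c) c
  | fwd_congr {n : ℕ} {v : Vert W I} {u : Fin n → Vert W I} (x : Fwd v u)
      {c c' : ∀ s, Tree W I L (u s)} : (∀ s, Red (c s) (c' s)) → Red (fwd x c) (fwd x c')
  | bwd_congr {v u : Vert W I} (w : Bwd v u) {c c' : Tree W I L u} :
      Red c c' → Red (bwd w c) (bwd w c')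
  | refl {v : Vert W I} (t : Tree W I L v) : Red t t
  | symm {v : Vert W I} {t t' : Tree W I L v} : Red t t' → Red t' t
  | trans {v : Vert W I} {t t' t'' : Tree W I L v} : Red t t' → Red t' t'' → Red t t''

theorem relabel_relabel (f : L → L') (g : L' → L'') {v : Vert W I} (t : Tree W I L v) :
    (t.relabel f).relabel g = t.relabel fun l => g (f l) := by
  induction t with
  | leaf hv l => rfl
  | fwd x c ih => simp only [relabel, ih]
  | bwd w c ih => simp only [relabel, ih]

theorem relabel_id {v : Vert W I} (t : Tree W I L v) : t.relabel (fun l => l) = t := by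
  induction t with
  | leaf hv l => rfl
  | fwd x c ih => simp only [relabel, ih]
  | bwd w c ih => simp only [relabel, ih]

theorem bind_relabel (f : L → L') (g : L' → Tree W I L'' (Vert.const W I)) {v : Vert W I}
    (t : Tree W I L v) : (t.relabel f).bind g = t.bind fun l => g (f l) := by
  induction t with
  | leaf hv l => rfl
  | fwd x c ih => simp only [relabel, bind, ih]
  | bwd w c ih => simp only [relabel, bind, ih]

theorem relabel_bind (f : L → Tree W I L' (Vert.const W I)) (g : L' → L'') {v : Vert W I}
    (t : Tree W I L v) : (t.bind f).relabel g = t.bind fun l => (f l).relabel g := by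
  induction t with
  | leaf hv l => subst hv; rfl
  | fwd x c ih => simp only [relabel, bind, ih]
  | bwd w c ih => simp only [relabel, bind, ih]

theorem bind_bind (f : L → Tree W I L' (Vert.const W I)) (g : L' → Tree W I L'' (Vert.const W I))
    {v : Vert W I} (t : Tree W I L v) : (t.bind f).bind g = t.bind fun l => (f l).bind g := by
  induction t with
  | leaf hv l => subst hv; rfl
  | fwd x c ih => simp only [bind, ih]
  | bwd w c ih => simp only [bind, ih]

theorem bind_leaf (f : L → L') {v : Vert W I} (t : Tree W I L v) :
    t.bind (fun l => leaf rfl (f l)) = t.relabel f := by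
  induction t with
  | leaf hv l => subst hv; rfl
  | fwd x c ih => simp only [bind, relabel, ih]
  | bwd w c ih => simp only [bind, relabel, ih]

theorem count_bind [Fintype L] [DecidableEq L] [DecidableEq L']
    (f : L → Tree W I L' (Vert.const W I)) (l' : L') {v : Vert W I} (t : Tree W I L v) :
    (t.bind f).count l' = ∑ l, t.count l * (f l).count l' := by
  induction t with
  | leaf hv l => subst hv; simp [bind, count]
  | fwd x c ih =>
    simp only [bind, count, ih, Finset.sum_mul]
    exact Finset.sum_comm
  | bwd w c ih => simp only [bind, count, ih]

theorem count_relabel [DecidableEq L] [DecidableEq L'] (e : L ≃ L') (l : L) {v : Vert W I}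
    (t : Tree W I L v) : (t.relabel e).count (e l) = t.count l := by
  induction t with
  | leaf hv l => simp [relabel, count]
  | fwd x c ih => simp only [relabel, count, ih]
  | bwd w c ih => simp only [relabel, count, ih]

theorem Red.bind_left (f : L → Tree W I L' (Vert.const W I)) {v : Vert W I}
    {t t' : Tree W I L v} (h : Red t t') : Red (t.bind f) (t'.bind f) := by
  induction h with
  | planar σ x c => exact planar σ x fun s => (c s).bind f
  | fwd_fwd x y c => exact fwd_fwd x y fun p => (c p).bind f
  | fwd_id c => exact fwd_id _
  | bwd_bwd w w' c => exact bwd_bwd w w' _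
  | bwd_id c => exact bwd_id _
  | fwd_congr x _ ih => exact fwd_congr x ih
  | bwd_congr w _ ih => exact bwd_congr w ih
  | refl t => exact refl _
  | symm _ ih => exact symm ih
  | trans _ _ ih ih' => exact trans ih ih'

theorem Red.relabel (f : L → L') {v : Vert W I} {t t' : Tree W I L v} (h : Red t t') :
    Red (t.relabel f) (t'.relabel f) := by
  rw [← bind_leaf, ← bind_leaf]
  exact h.bind_left _

theorem Red.bind_right {f f' : L → Tree W I L' (Vert.const W I)} (h : ∀ l, Red (f l) (f' l))
    {v : Vert W I} (t : Tree W I L v) : Red (t.bind f) (t.bind f') := by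
  induction t with
  | leaf hv l => subst hv; exact h l
  | fwd x c ih => exact fwd_congr x ih
  | bwd w c ih => exact bwd_congr w ih

/-- Tree hammocks with root and labelled leaves at constant nodes, whose labelled leaves are
labelled bijectively by `1, …, n`. -/
def Labelled (W : Submonoid (O.Op 1)) (I : Type) [Preorder I] (n : ℕ) : Type u :=
  { t : Tree W I (Fin n) (Vert.const W I) // ∀ l, t.count l = 1 }

instance setoid (W : Submonoid (O.Op 1)) (I : Type) [Preorder I] (n : ℕ) :
    Setoid (Labelled W I n) where
  r t t' := Red t.1 t'.1
  iseqv := ⟨fun _ => .refl _, .symm, .trans⟩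

/-- Relabelling the leaves along a bijection. -/
def Labelled.relabel {n m : ℕ} (e : Fin n ≃ Fin m) (t : Labelled W I n) : Labelled W I m :=
  ⟨t.1.relabel e, fun l => by
    obtain ⟨l, rfl⟩ := e.surjective l
    rw [count_relabel, t.2]⟩

/-- Grafting of trees: the root of `y s` is identified with the leaf of `t` labelled `s`. -/
def graft {k : ℕ} {j : Fin k → ℕ} {v : Vert W I} (t : Tree W I (Fin k) v)
    (y : ∀ s, Tree W I (Fin (j s)) (Vert.const W I)) : Tree W I (Fin (∑ s, j s)) v :=
  t.bind fun s => (y s).relabel fun l => finSigmaFinEquiv ⟨s, l⟩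

theorem count_relabel_block {k : ℕ} {j : Fin k → ℕ} {v : Vert W I} (s s' : Fin k)
    (l : Fin (j s)) (t : Tree W I (Fin (j s')) v) :
    (t.relabel fun l => (finSigmaFinEquiv ⟨s', l⟩ : Fin (∑ s, j s))).count
      (finSigmaFinEquiv ⟨s, l⟩) = if h : s' = s then t.count (h ▸ l) else 0 := by
  induction t with
  | leaf hv l' =>
    by_cases h : s' = s
    · subst h; simp [Tree.relabel, count]
    · simp [Tree.relabel, count, h]
  | fwd x c ih =>
    simp only [Tree.relabel, count, ih]
    by_cases h : s' = s <;> simp [h]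
  | bwd w c ih => simp only [Tree.relabel, count, ih]

/-- Grafting of bijectively labelled trees. -/
def Labelled.graft {k : ℕ} {j : Fin k → ℕ} (t : Labelled W I k) (y : ∀ s, Labelled W I (j s)) :
    Labelled W I (∑ s, j s) :=
  ⟨t.1.graft fun s => (y s).1, fun l => by
    obtain ⟨⟨s, l⟩, rfl⟩ := finSigmaFinEquiv.surjective l
    simp only [Tree.graft, count_bind, t.2, one_mul, count_relabel_block]
    rw [Finset.sum_eq_single s (fun s' _ h => by simp [h]) (by simp)]
    simp [(y s).2]⟩

end

end Tree

/-- Reduced tree hammocks with `n` labelled leaves and rows indexed by `I`: tree hammocks up to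
reduction. -/
def TreeLocOp {O : SymOperad.{u}} (W : Submonoid (O.Op 1)) (I : Type) [Preorder I] (n : ℕ) :
    Type u :=
  Quotient (Tree.setoid W I n)

/-- The class of a tree hammock. -/
def TreeLocOp.mk {O : SymOperad.{u}} {W : Submonoid (O.Op 1)} {I : Type} [Preorder I] {n : ℕ}
    (t : Tree.Labelled W I n) : TreeLocOp W I n :=
  Quotient.mk _ t

section

variable {O P : SymOperad.{u}} {W : Submonoid (O.Op 1)} {I : Type} [Preorder I]

/-- Composition induced by grafting. -/
noncomputable def TreeLocOp.γ {k : ℕ} {j : Fin k → ℕ} (x : TreeLocOp W I k)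
    (y : ∀ s, TreeLocOp W I (j s)) : TreeLocOp W I (∑ s, j s) :=
  Quotient.map (fun t : Tree.Labelled W I k => t.graft fun s => (y s).out)
    (fun _ _ h => Tree.Red.bind_left _ h) x

/-- Relabelling of the leaves. -/
def TreeLocOp.relabel {n m : ℕ} (e : Fin n ≃ Fin m) (x : TreeLocOp W I n) : TreeLocOp W I m :=
  Quotient.map (Tree.Labelled.relabel e) (fun _ _ h => Tree.Red.relabel _ h) x

theorem TreeLocOp.γ_mk {k : ℕ} {j : Fin k → ℕ} (t : Tree.Labelled W I k)
    (y : ∀ s, Tree.Labelled W I (j s)) :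
    TreeLocOp.γ (mk t) (fun s => mk (y s)) = mk (t.graft y) :=
  Quotient.sound <| Tree.Red.bind_right
    (fun s => Tree.Red.relabel _ (Quotient.mk_out (s := Tree.setoid W I (j s)) (y s))) t.1

theorem TreeLocOp.exists_rep {n : ℕ} (x : TreeLocOp W I n) : ∃ t, x = mk t :=
  ⟨x.out, (Quotient.out_eq x).symm⟩

theorem TreeLocOp.exists_reps {k : ℕ} {j : Fin k → ℕ} (x : ∀ s, TreeLocOp W I (j s)) :
    ∃ t : ∀ s, Tree.Labelled W I (j s), x = fun s => mk (t s) :=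
  ⟨fun s => (x s).out, funext fun s => (Quotient.out_eq (x s)).symm⟩

/-- The operad of tree hammocks with rows indexed by `I`. -/
noncomputable def treeLoc (W : Submonoid (O.Op 1)) (I : Type) [Preorder I] : SymOperad.{u} where
  Op n := TreeLocOp W I n
  relabel e x := TreeLocOp.relabel e x
  one := TreeLocOp.mk ⟨.leaf rfl 0, fun l => by simp [Tree.count, Subsingleton.elim l 0]⟩
  γ x y := TreeLocOp.γ x y
  relabel_refl x := by
    obtain ⟨t, rfl⟩ := x.exists_rep
    exact congrArg TreeLocOp.mk (Subtype.ext t.1.relabel_id)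
  relabel_trans e f x := by
    obtain ⟨t, rfl⟩ := x.exists_rep
    exact congrArg TreeLocOp.mk (Subtype.ext (t.1.relabel_relabel e f))
  γ_assoc {k j i} x y z := by
    obtain ⟨t, rfl⟩ := x.exists_rep
    obtain ⟨y, rfl⟩ := TreeLocOp.exists_reps y
    obtain ⟨z, rfl⟩ := TreeLocOp.exists_reps z
    simp only [TreeLocOp.γ_mk]
    refine congrArg TreeLocOp.mk (Subtype.ext ?_)
    simp only [Tree.Labelled.graft, Tree.Labelled.relabel, Tree.graft, Tree.bind_bind,
      Tree.relabel_bind, Tree.bind_relabel, Tree.relabel_relabel, blockAssoc_apply]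
  one_γ {n} x := by
    obtain ⟨t, rfl⟩ := x.exists_rep
    refine (TreeLocOp.γ_mk _ _).trans (congrArg TreeLocOp.mk (Subtype.ext ?_))
    rfl
  γ_one {n} x := by
    obtain ⟨t, rfl⟩ := x.exists_rep
    refine (TreeLocOp.γ_mk _ _).trans (congrArg TreeLocOp.mk (Subtype.ext ?_))
    exact Tree.bind_leaf _ _
  γ_relabel_left {k k' j} σ x y := by
    obtain ⟨t, rfl⟩ := x.exists_rep
    obtain ⟨y, rfl⟩ := TreeLocOp.exists_reps y
    refine (TreeLocOp.γ_mk _ _).trans ?_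
    refine Eq.trans ?_ (congrArg (TreeLocOp.relabel _) (TreeLocOp.γ_mk _ _).symm)
    refine congrArg TreeLocOp.mk (Subtype.ext ?_)
    simp only [Tree.Labelled.graft, Tree.Labelled.relabel, Tree.graft, Tree.relabel_bind,
      Tree.bind_relabel, Tree.relabel_relabel, blockPerm_apply]
  γ_relabel_right {k j j'} τ x y := by
    obtain ⟨t, rfl⟩ := x.exists_rep
    obtain ⟨y, rfl⟩ := TreeLocOp.exists_reps y
    refine (TreeLocOp.γ_mk _ fun s => (y s).relabel (τ s)).trans ?_
    refine Eq.trans ?_ (congrArg (TreeLocOp.relabel _) (TreeLocOp.γ_mk _ _).symm)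
    refine congrArg TreeLocOp.mk (Subtype.ext ?_)
    simp only [Tree.Labelled.graft, Tree.Labelled.relabel, Tree.graft, Tree.relabel_bind,
      Tree.relabel_relabel, blockSum_apply]

end

end TreeHammock
/-! ### The hammock localization of a category -/

namespace TreeHammock

open SymOperad

/-- A column of objects of a hammock with rows indexed by `I`, connected by vertical maps in
`W` (the maps between consecutive rows and their composites). -/
@[ext] structure Node {C : Type} [Category.{u} C] (W : MorphismProperty C) (I : Type)
    [Preorder I] : Type u where
  F : I ⥤ C
  mem : ∀ {i j : I} (h : i ⟶ j), W (F.map h)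

section

variable {C D : Type} [Category.{u} C] [Category.{u} D] {W : MorphismProperty C}
  {V : MorphismProperty D} {I J : Type} [Preorder I] [Preorder J]

/-- The action of a functor `Φ : C ⥤ D` sending `W` to `V`, and of a monotone map
between the sets of rows, on the columns of objects. -/
def Node.map (Φ : C ⥤ D) (hΦ : ∀ ⦃a b : C⦄ (f : a ⟶ b), W f → V (Φ.map f)) (α : J →o I)
    (X : Node W I) : Node V J :=
  ⟨α.monotone.functor ⋙ X.F ⋙ Φ, fun h => hΦ _ (X.mem (α.monotone.functor.map h))⟩

/-- The action on columns of arrows. -/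
def Node.mapHom (Φ : C ⥤ D) (hΦ : ∀ ⦃a b : C⦄ (f : a ⟶ b), W f → V (Φ.map f)) (α : J →o I)
    {X Y : Node W I} (f : X.F ⟶ Y.F) : (X.map Φ hΦ α).F ⟶ (Y.map Φ hΦ α).F where
  app i := Φ.map (f.app (α i))
  naturality i j h := by
    have := f.naturality (α.monotone.functor.map h)
    exact (Φ.map_comp _ _).symm.trans ((congrArg Φ.map this).trans (Φ.map_comp _ _))

theorem Node.mapHom_comp (Φ : C ⥤ D) (hΦ : ∀ ⦃a b : C⦄ (f : a ⟶ b), W f → V (Φ.map f))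
    (α : J →o I) {X Y Z : Node W I} (f : X.F ⟶ Y.F) (g : Y.F ⟶ Z.F) :
    Node.mapHom Φ hΦ α (X := X) (Y := Z) (f ≫ g) =
      Node.mapHom Φ hΦ α f ≫ Node.mapHom Φ hΦ α g := by
  ext i
  exact Φ.map_comp _ _

theorem Node.mapHom_id (Φ : C ⥤ D) (hΦ : ∀ ⦃a b : C⦄ (f : a ⟶ b), W f → V (Φ.map f))
    (α : J →o I) (X : Node W I) :
    Node.mapHom Φ hΦ α (X := X) (Y := X) (𝟙 X.F) = 𝟙 (X.map Φ hΦ α).F := by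
  ext i
  exact Φ.map_id _

/-- The column with all objects `a` and all vertical maps identities. -/
def Node.const (W : MorphismProperty C) [W.ContainsIdentities] (I : Type) [Preorder I] (a : C) :
    Node W I :=
  ⟨(CategoryTheory.Functor.const I).obj a, fun _ => W.id_mem a⟩

theorem Node.map_const [W.ContainsIdentities] [V.ContainsIdentities] (Φ : C ⥤ D) (hΦ : ∀ ⦃a b : C⦄ (f : a ⟶ b), W f → V (Φ.map f))
    (α : J →o I) (a : C) :
    (Node.const W I a).map Φ hΦ α = Node.const V J (Φ.obj a) := by
  refine Node.ext (CategoryTheory.Functor.hext (fun _ => rfl) fun _ _ _ => heq_of_eq ?_)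
  exact Φ.map_id a

/-- Hammocks, as sequences of columns of horizontal arrows. In each column all arrows point to the
right, or all arrows point to the left and lie in `W`; that a column is a natural transformation
means that the squares formed by its arrows and the adjacent vertical maps commute. -/
inductive Hammock (W : MorphismProperty C) (I : Type) [Preorder I] :
    Node W I → Node W I → Type u
  | nil (X : Node W I) : Hammock W I X X
  | right {X Y Z : Node W I} (f : X.F ⟶ Y.F) (h : Hammock W I Y Z) : Hammock W I X Z
  | left {X Y Z : Node W I} (f : Y.F ⟶ X.F) (hf : ∀ i, W (f.app i)) (h : Hammock W I Y Z) :
      Hammock W I X Z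

namespace Hammock

/-- Concatenation of hammocks. -/
def append : ∀ {X Y Z : Node W I}, Hammock W I X Y → Hammock W I Y Z → Hammock W I X Z
  | _, _, _, nil _, k => k
  | _, _, _, right f h, k => right f (h.append k)
  | _, _, _, left f hf h, k => left f hf (h.append k)

/-- The action of `Φ` and `α` on hammocks: `Φ` is applied to all arrows, and the rows are deleted
or repeated according to `α`. -/
def map (Φ : C ⥤ D) (hΦ : ∀ ⦃a b : C⦄ (f : a ⟶ b), W f → V (Φ.map f)) (α : J →o I) :
    ∀ {X Y : Node W I}, Hammock W I X Y → Hammock V J (X.map Φ hΦ α) (Y.map Φ hΦ α)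
  | _, _, nil _ => nil _
  | X, _, right (Y := Y) f h =>
    right (X := X.map Φ hΦ α) (Y := Y.map Φ hΦ α)
      (Node.mapHom Φ hΦ α f)
      (h.map Φ hΦ α)
  | X, _, left (Y := Y) f hf h =>
    left (X := X.map Φ hΦ α) (Y := Y.map Φ hΦ α)
      (Node.mapHom Φ hΦ α f)
      (fun i => hΦ _ (hf (α i))) (h.map Φ hΦ α)

/-- Transport along equalities of the end columns. -/
def cast {X X' Y Y' : Node W I} (hX : X = X') (hY : Y = Y') (h : Hammock W I X Y) :
    Hammock W I X' Y' :=
  hX ▸ hY ▸ h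

/-- Reduction of hammocks: composing adjacent columns of arrows pointing in the same direction and
deleting columns of identities. -/
inductive Red [W.IsMultiplicative] :
    ∀ {X Y : Node W I}, Hammock W I X Y → Hammock W I X Y → Prop
  | right_right {X Y Z T : Node W I} (f : X.F ⟶ Y.F) (g : Y.F ⟶ Z.F) (h : Hammock W I Z T) :
      Red (right f (right g h)) (right (f ≫ g) h)
  | left_left {X Y Z T : Node W I} (f : Y.F ⟶ X.F) (hf : ∀ i, W (f.app i)) (g : Z.F ⟶ Y.F)
      (hg : ∀ i, W (g.app i)) (h : Hammock W I Z T) :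
      Red (left f hf (left g hg h))
        (left (g ≫ f) (fun i => W.comp_mem _ _ (hg i) (hf i)) h)
  | right_id {X Y : Node W I} (h : Hammock W I X Y) : Red (right (𝟙 X.F) h) h
  | left_id {X Y : Node W I} (h : Hammock W I X Y) :
      Red (left (𝟙 X.F) (fun i => W.id_mem (X.F.obj i)) h) h
  | right_congr {X Y Z : Node W I} (f : X.F ⟶ Y.F) {h h' : Hammock W I Y Z} :
      Red h h' → Red (right f h) (right f h')
  | left_congr {X Y Z : Node W I} (f : Y.F ⟶ X.F) (hf : ∀ i, W (f.app i))
      {h h' : Hammock W I Y Z} : Red h h' → Red (left f hf h) (left f hf h')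
  | refl {X Y : Node W I} (h : Hammock W I X Y) : Red h h
  | symm {X Y : Node W I} {h h' : Hammock W I X Y} : Red h h' → Red h' h
  | trans {X Y : Node W I} {h h' h'' : Hammock W I X Y} : Red h h' → Red h' h'' → Red h h''

theorem append_assoc {X Y Z T : Node W I} (h : Hammock W I X Y) (k : Hammock W I Y Z)
    (l : Hammock W I Z T) : (h.append k).append l = h.append (k.append l) := by
  induction h with
  | nil X => rfl
  | right f h ih => simp only [append, ih]
  | left f hf h ih => simp only [append, ih]

theorem append_nil {X Y : Node W I} (h : Hammock W I X Y) : h.append (nil Y) = h := by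
  induction h with
  | nil X => rfl
  | right f h ih => simp only [append, ih]
  | left f hf h ih => simp only [append, ih]

theorem map_append (Φ : C ⥤ D) (hΦ : ∀ ⦃a b : C⦄ (f : a ⟶ b), W f → V (Φ.map f)) (α : J →o I)
    {X Y Z : Node W I} (h : Hammock W I X Y) (k : Hammock W I Y Z) :
    (h.append k).map Φ hΦ α = (h.map Φ hΦ α).append (k.map Φ hΦ α) := by
  induction h with
  | nil X => rfl
  | right f h ih => simp only [append, map, ih]
  | left f hf h ih => simp only [append, map, ih]

theorem cast_append {X X' Y Y' Z Z' : Node W I} (hX : X = X') (hY : Y = Y') (hZ : Z = Z')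
    (h : Hammock W I X Y) (k : Hammock W I Y Z) :
    (h.append k).cast hX hZ = (h.cast hX hY).append (k.cast hY hZ) := by
  subst hX hY hZ; rfl

theorem cast_nil {X X' : Node W I} (hX hX' : X = X') :
    (nil X).cast hX hX' = nil X' := by
  subst hX; rfl

theorem cast_cast {X X' X'' Y Y' Y'' : Node W I} (hX : X = X') (hY : Y = Y') (hX' : X' = X'')
    (hY' : Y' = Y'') (h : Hammock W I X Y) :
    (h.cast hX hY).cast hX' hY' = h.cast (hX.trans hX') (hY.trans hY') := by
  subst hX hY hX' hY'; rfl

theorem map_cast (Φ : C ⥤ D) (hΦ : ∀ ⦃a b : C⦄ (f : a ⟶ b), W f → V (Φ.map f)) (α : J →o I)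
    {X X' Y Y' : Node W I} (hX : X = X') (hY : Y = Y') (h : Hammock W I X Y) :
    (h.cast hX hY).map Φ hΦ α = (h.map Φ hΦ α).cast (by rw [hX]) (by rw [hY]) := by
  subst hX hY; rfl

theorem map_id (hΦ : ∀ ⦃a b : C⦄ (f : a ⟶ b), W f → W ((𝟭 C).map f)) {X Y : Node W I}
    (h : Hammock W I X Y) : h.map (𝟭 C) hΦ OrderHom.id = h := by
  induction h with
  | nil X => rfl
  | right f h ih => simp only [map, ih]; rfl
  | left f hf h ih => simp only [map, ih]; rfl

theorem map_map {E : Type} [Category.{u} E] {U : MorphismProperty E}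
    {K : Type} [Preorder K] (Φ : C ⥤ D) (hΦ : ∀ ⦃a b : C⦄ (f : a ⟶ b), W f → V (Φ.map f))
    (Ψ : D ⥤ E) (hΨ : ∀ ⦃a b : D⦄ (f : a ⟶ b), V f → U (Ψ.map f)) (α : J →o I) (β : K →o J)
    {X Y : Node W I} (h : Hammock W I X Y) :
    (h.map Φ hΦ α).map Ψ hΨ β =
      h.map (Φ ⋙ Ψ) (fun _ _ f hf => hΨ _ (hΦ f hf)) (α.comp β) := by
  induction h with
  | nil X => rfl
  | right f h ih => simp only [map, ih]; rfl
  | left f hf h ih => simp only [map, ih]; rfl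

theorem map_of_eq_id (Φ : C ⥤ C) (hΦ : ∀ ⦃a b : C⦄ (f : a ⟶ b), W f → W (Φ.map f))
    (h : Φ = 𝟭 C) {X Y : Node W I} (x : Hammock W I X Y) :
    x.map Φ hΦ OrderHom.id = x.cast (by subst h; rfl) (by subst h; rfl) := by
  subst h; exact map_id hΦ x

theorem map_of_eq_comp {E : Type} [Category.{u} E] {U : MorphismProperty E}
    {K : Type} [Preorder K] (Φ : C ⥤ D) (hΦ : ∀ ⦃a b : C⦄ (f : a ⟶ b), W f → V (Φ.map f))
    (Ψ : D ⥤ E) (hΨ : ∀ ⦃a b : D⦄ (f : a ⟶ b), V f → U (Ψ.map f)) (α : J →o I) (β : K →o J)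
    (χ : C ⥤ E) (hχ : ∀ ⦃a b : C⦄ (f : a ⟶ b), W f → U (χ.map f)) (h : χ = Φ ⋙ Ψ)
    {X Y : Node W I} (x : Hammock W I X Y) :
    x.map χ hχ (α.comp β) =
      ((x.map Φ hΦ α).map Ψ hΨ β).cast (by subst h; rfl) (by subst h; rfl) := by
  subst h; exact (map_map Φ hΦ Ψ hΨ α β x).symm

variable [W.IsMultiplicative] [V.IsMultiplicative]

theorem Red.append_left {X Y Z : Node W I} {h h' : Hammock W I X Y} (r : Red h h')
    (k : Hammock W I Y Z) : Red (h.append k) (h'.append k) := by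
  induction r with
  | right_right f g h => exact right_right f g _
  | left_left f hf g hg h => exact left_left f hf g hg _
  | right_id h => exact right_id _
  | left_id h => exact left_id _
  | right_congr f _ ih => exact right_congr f (ih k)
  | left_congr f hf _ ih => exact left_congr f hf (ih k)
  | refl h => exact refl _
  | symm _ ih => exact symm (ih k)
  | trans _ _ ih ih' => exact trans (ih k) (ih' k)

theorem Red.append_right {X Y Z : Node W I} (h : Hammock W I X Y) {k k' : Hammock W I Y Z}
    (r : Red k k') : Red (h.append k) (h.append k') := by
  induction h with
  | nil X => exact r
  | right f h ih => exact right_congr f (ih r)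
  | left f hf h ih => exact left_congr f hf (ih r)

instance setoid (W : MorphismProperty C) [W.IsMultiplicative] (I : Type) [Preorder I]
    (X Y : Node W I) : Setoid (Hammock W I X Y) where
  r := Red
  iseqv := ⟨.refl, .symm, .trans⟩

end Hammock

variable [W.IsMultiplicative] [V.IsMultiplicative]

/-- Reduced hammocks from `a` to `b` with rows indexed by `I`: hammocks up to reduction. -/
def HammockHom (W : MorphismProperty C) [W.IsMultiplicative] (I : Type) [Preorder I] (a b : C) :
    Type u :=
  Quotient (Hammock.setoid W I (Node.const W I a) (Node.const W I b))

namespace HammockHom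

/-- The class of a hammock. -/
def mk {a b : C} (h : Hammock W I (Node.const W I a) (Node.const W I b)) : HammockHom W I a b :=
  Quotient.mk _ h

/-- The identity. -/
def id (W : MorphismProperty C) [W.IsMultiplicative] (I : Type) [Preorder I] (a : C) :
    HammockHom W I a a :=
  mk (.nil _)

/-- Composition by concatenation of hammocks. -/
def comp {a b c : C} (x : HammockHom W I a b) (y : HammockHom W I b c) : HammockHom W I a c :=
  Quotient.map₂ Hammock.append
    (fun _ _ r _ _ r' => (r.append_left _).trans (Hammock.Red.append_right _ r')) x y

end HammockHom

namespace Hammock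

theorem Red.map (Φ : C ⥤ D) (hΦ : ∀ ⦃a b : C⦄ (f : a ⟶ b), W f → V (Φ.map f)) (α : J →o I)
    {X Y : Node W I} {h h' : Hammock W I X Y} (r : Red h h') :
    Red (h.map Φ hΦ α) (h'.map Φ hΦ α) := by
  induction r with
  | right_right f g h =>
    simp only [Hammock.map, Node.mapHom_comp]
    exact right_right _ _ _
  | left_left f hf g hg h =>
    simp only [Hammock.map, Node.mapHom_comp]
    exact left_left _ _ _ _ _
  | right_id h =>
    simp only [Hammock.map, Node.mapHom_id]
    exact right_id _
  | left_id h =>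
    simp only [Hammock.map, Node.mapHom_id]
    exact left_id _
  | right_congr f _ ih => exact right_congr _ ih
  | left_congr f hf _ ih => exact left_congr _ _ ih
  | refl h => exact refl _
  | symm _ ih => exact symm ih
  | trans _ _ ih ih' => exact trans ih ih'

theorem Red.cast {X X' Y Y' : Node W I} (hX : X = X') (hY : Y = Y') {h h' : Hammock W I X Y}
    (r : Red h h') : Red (h.cast hX hY) (h'.cast hX hY) := by
  subst hX hY; exact r

end Hammock

namespace HammockHom

/-- The action of `Φ` and `α` on reduced hammocks. -/
def map (Φ : C ⥤ D) (hΦ : ∀ ⦃a b : C⦄ (f : a ⟶ b), W f → V (Φ.map f)) (α : J →o I) {a b : C}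
    (x : HammockHom W I a b) : HammockHom V J (Φ.obj a) (Φ.obj b) :=
  Quotient.map
    (fun h => (Hammock.map Φ hΦ α h).cast (Node.map_const Φ hΦ α a) (Node.map_const Φ hΦ α b))
    (fun _ _ r => (r.map Φ hΦ α).cast _ _) x

theorem exists_rep {a b : C} (x : HammockHom W I a b) : ∃ h, x = mk h :=
  ⟨x.out, (Quotient.out_eq x).symm⟩

theorem id_comp {a b : C} (x : HammockHom W I a b) : comp (id W I a) x = x := by
  obtain ⟨h, rfl⟩ := x.exists_rep
  rfl

theorem comp_id {a b : C} (x : HammockHom W I a b) : comp x (id W I b) = x := by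
  obtain ⟨h, rfl⟩ := x.exists_rep
  exact congrArg mk h.append_nil

theorem assoc {a b c d : C} (x : HammockHom W I a b) (y : HammockHom W I b c)
    (z : HammockHom W I c d) : comp (comp x y) z = comp x (comp y z) := by
  obtain ⟨h, rfl⟩ := x.exists_rep
  obtain ⟨k, rfl⟩ := y.exists_rep
  obtain ⟨l, rfl⟩ := z.exists_rep
  exact congrArg mk (h.append_assoc k l)

theorem map_id (Φ : C ⥤ D) (hΦ : ∀ ⦃a b : C⦄ (f : a ⟶ b), W f → V (Φ.map f)) (α : J →o I)
    (a : C) : (id W I a).map Φ hΦ α = id V J (Φ.obj a) :=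
  congrArg mk (Hammock.cast_nil _ _)

theorem map_comp (Φ : C ⥤ D) (hΦ : ∀ ⦃a b : C⦄ (f : a ⟶ b), W f → V (Φ.map f)) (α : J →o I)
    {a b c : C} (x : HammockHom W I a b) (y : HammockHom W I b c) :
    (comp x y).map Φ hΦ α = comp (x.map Φ hΦ α) (y.map Φ hΦ α) := by
  obtain ⟨h, rfl⟩ := x.exists_rep
  obtain ⟨k, rfl⟩ := y.exists_rep
  refine congrArg mk ((congrArg (Hammock.cast _ _) (Hammock.map_append Φ hΦ α h k)).trans ?_)
  exact Hammock.cast_append _ _ _ _ _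

end HammockHom

end

end TreeHammock
/-! ### The subcategory generated by a monoid of unary operations -/

namespace TreeHammock

open SymOperad

section

variable {O P Q : SymOperad.{u}} {W : Submonoid (O.Op 1)} {V : Submonoid (P.Op 1)}

/-- The suboperad `W₊` of `O`: its operations of arity one are the elements of `W`, and it has no
operations of other arities (there is a bijection `Fin 1 ≃ Fin n` only for `n = 1`). -/
def plus (W : Submonoid (O.Op 1)) (n : ℕ) : Set (O.Op n) :=
  {x | ∃ w ∈ W, ∃ e : Fin 1 ≃ Fin n, x = O.relabel e w}

/-- The subcategory `C_{W₊}` of `C_O`: the morphisms represented by operations of `W₊`. -/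
def envSub (W : Submonoid (O.Op 1)) : MorphismProperty O.Env :=
  fun a b f => ∃ g : O.PreHom a b, EnvHom.mk g = f ∧ ∀ i, g.op i ∈ plus W (g.k i)

theorem plus_γ {n : ℕ} {j : Fin n → ℕ} {x : O.Op n} (hx : x ∈ plus W n) {y : ∀ s, O.Op (j s)}
    (hy : ∀ s, y s ∈ plus W (j s)) : O.γ x y ∈ plus W (∑ s, j s) := by
  obtain ⟨w, hw, e, rfl⟩ := hx
  choose w' hw' e' he' using hy
  obtain rfl : y = fun s => O.relabel (e' s) (w' s) := funext he'
  rw [γ_relabel_left, O.γ_relabel_right (fun s => e' (e s)), γ_unary]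
  simp only [relabel_trans]
  exact ⟨_, W.mul_mem hw (hw' (e 0)), _, rfl⟩

instance (W : Submonoid (O.Op 1)) : (envSub W).IsMultiplicative where
  id_mem a := ⟨PreHom.id O a, rfl, fun _ =>
    ⟨O.one, W.one_mem, Equiv.refl _, (O.relabel_refl _).symm⟩⟩
  comp_mem := by
    rintro a b c _ _ ⟨f, rfl, hf⟩ ⟨g, rfl, hg⟩
    exact ⟨f.comp g, rfl, fun i => plus_γ (hf i) fun s => hg _⟩

theorem envSub_map (φ : O ⟶ P) (h : ∀ w ∈ W, φ.app w ∈ V) ⦃a b : O.Env⦄ (f : a ⟶ b)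
    (hf : envSub W f) : envSub V ((envMap φ).map f) := by
  obtain ⟨g, rfl, hg⟩ := hf
  refine ⟨g.map φ, rfl, fun i => ?_⟩
  obtain ⟨w, hw, e, hwe⟩ := hg i
  exact ⟨φ.app w, h w hw, e, (congrArg φ.app hwe).trans (φ.app_relabel e w)⟩

end

/-! ### Functoriality of tree hammocks -/

section

variable {O P Q : SymOperad.{u}} {W : Submonoid (O.Op 1)} {V : Submonoid (P.Op 1)}
  {U : Submonoid (Q.Op 1)} {I J K : Type} [Preorder I] [Preorder J] [Preorder K] {L L' : Type}

/-- The action of an operad morphism `φ` sending `W` to `V`, and of a monotone map between the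
sets of rows, on nodes. -/
def Vert.push (φ : O ⟶ P) (h : ∀ w ∈ W, φ.app w ∈ V) (α : J →o I) (v : Vert W I) : Vert V J where
  map h' := φ.app (v.map (α.monotone h'))
  mem _ := h _ (v.mem _)
  map_refl i := (congrArg φ.app (v.map_refl (α i))).trans φ.app_one
  map_trans _ _ := (congrArg φ.app (v.map_trans _ _)).trans (φ.app_lact _ _)

theorem Vert.push_const (φ : O ⟶ P) (h : ∀ w ∈ W, φ.app w ∈ V) (α : J →o I) :
    (Vert.const W I).push φ h α = Vert.const V J := by
  ext i j hij
  exact φ.app_one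

/-- The action on columns of pieces `O_n`. -/
def Fwd.push (φ : O ⟶ P) (h : ∀ w ∈ W, φ.app w ∈ V) (α : J →o I) {n : ℕ} {v : Vert W I}
    {u : Fin n → Vert W I} (x : Fwd v u) : Fwd (v.push φ h α) (fun s => (u s).push φ h α) where
  op i := φ.app (x.op (α i))
  comm {i j} hij := by
    have := congrArg φ.app (x.comm (α.monotone hij))
    rwa [φ.app_ract, φ.app_lact] at this

/-- The action on columns of pieces `W_1`. -/
def Bwd.push (φ : O ⟶ P) (h : ∀ w ∈ W, φ.app w ∈ V) (α : J →o I) {v u : Vert W I}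
    (w : Bwd v u) : Bwd (v.push φ h α) (u.push φ h α) where
  op i := φ.app (w.op (α i))
  mem i := h _ (w.mem _)
  comm {i j} hij := by
    have := congrArg φ.app (w.comm (α.monotone hij))
    exact (φ.app_lact _ _).symm.trans (this.trans (φ.app_lact _ _))

namespace Tree

/-- The action on tree hammocks: `φ` is applied to all labels, and rows are deleted or repeated
according to `α`. -/
def push (φ : O ⟶ P) (h : ∀ w ∈ W, φ.app w ∈ V) (α : J →o I) :
    ∀ {v : Vert W I}, Tree W I L v → Tree V J L (v.push φ h α)
  | _, leaf hv l => leaf (by rw [hv, Vert.push_const]) l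
  | _, fwd x c => fwd (x.push φ h α) fun s => (c s).push φ h α
  | _, bwd w c => bwd (w.push φ h α) (c.push φ h α)

/-- Transport along an equality of root nodes. -/
def cast {v v' : Vert W I} (hv : v = v') (t : Tree W I L v) : Tree W I L v' := hv ▸ t

theorem Red.cast {v v' : Vert W I} (hv : v = v') {t t' : Tree W I L v} (r : Red t t') :
    Red (t.cast hv) (t'.cast hv) := by
  subst hv; exact r

theorem Red.push (φ : O ⟶ P) (h : ∀ w ∈ W, φ.app w ∈ V) (α : J →o I) {v : Vert W I}
    {t t' : Tree W I L v} (r : Red t t') : Red (t.push φ h α) (t'.push φ h α) := by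
  induction r with
  | @planar n m v u σ x c =>
    have : (x.relabel σ).push φ h α =
        (Fwd.relabel (u := fun s => (u s).push φ h α) σ (x.push φ h α)) := by
      ext i; exact φ.app_relabel _ _
    simp only [Tree.push, this]
    exact planar (u := fun s => (u s).push φ h α) σ (x.push φ h α) fun s => (c s).push φ h α
  | @fwd_fwd n m v u z x y c =>
    have : (x.comp y).push φ h α =
        (Fwd.comp (z := fun p => (z p).push φ h α) (x.push φ h α) fun s => (y s).push φ h α) := by
      ext i; exact φ.app_γ _ _
    simp only [Tree.push, this]
    exact fwd_fwd (z := fun p => (z p).push φ h α) (x.push φ h α) (fun s => (y s).push φ h α)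
      fun p => (c p).push φ h α
  | @fwd_id v c =>
    have : (Fwd.id v).push φ h α = Fwd.id (v.push φ h α) := by
      ext i; exact φ.app_one
    simp only [Tree.push, this]
    exact fwd_id _
  | bwd_bwd w w' c =>
    have : (w.comp w').push φ h α = (w.push φ h α).comp (w'.push φ h α) := by
      ext i; exact φ.app_lact _ _
    simp only [Tree.push, this]
    exact bwd_bwd _ _ _
  | @bwd_id v c =>
    have : (Bwd.id v).push φ h α = Bwd.id (v.push φ h α) := by
      ext i; exact φ.app_one
    simp only [Tree.push, this]
    exact bwd_id _
  | fwd_congr x _ ih => exact fwd_congr _ ih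
  | bwd_congr w _ ih => exact bwd_congr _ ih
  | refl t => exact refl _
  | symm _ ih => exact symm ih
  | trans _ _ ih ih' => exact trans ih ih'

theorem count_push [DecidableEq L] (φ : O ⟶ P) (h : ∀ w ∈ W, φ.app w ∈ V) (α : J →o I) (l : L)
    {v : Vert W I} (t : Tree W I L v) : (t.push φ h α).count l = t.count l := by
  induction t with
  | leaf hv l => rfl
  | fwd x c ih => simp only [push, count, ih]
  | bwd w c ih => simp only [push, count, ih]

theorem count_cast [DecidableEq L] {v v' : Vert W I} (hv : v = v') (l : L) (t : Tree W I L v) :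
    (t.cast hv).count l = t.count l := by
  subst hv; rfl

theorem cast_cast {v v' v'' : Vert W I} (hv : v = v') (hv' : v' = v'') (t : Tree W I L v) :
    (t.cast hv).cast hv' = t.cast (hv.trans hv') := by
  subst hv hv'; rfl

theorem push_cast (φ : O ⟶ P) (h : ∀ w ∈ W, φ.app w ∈ V) (α : J →o I) {v v' : Vert W I}
    (hv : v = v') (t : Tree W I L v) :
    (t.cast hv).push φ h α = (t.push φ h α).cast (by rw [hv]) := by
  subst hv; rfl

theorem relabel_cast (f : L → L') {v v' : Vert W I} (hv : v = v') (t : Tree W I L v) :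
    (t.cast hv).relabel f = (t.relabel f).cast hv := by
  subst hv; rfl

theorem bind_cast (f : L → Tree W I L' (Vert.const W I)) {v v' : Vert W I} (hv : v = v')
    (t : Tree W I L v) : (t.cast hv).bind f = (t.bind f).cast hv := by
  subst hv; rfl

theorem push_relabel (φ : O ⟶ P) (h : ∀ w ∈ W, φ.app w ∈ V) (α : J →o I) (f : L → L')
    {v : Vert W I} (t : Tree W I L v) :
    (t.relabel f).push φ h α = (t.push φ h α).relabel f := by
  induction t with
  | leaf hv l => rfl
  | fwd x c ih => simp only [push, relabel, ih]
  | bwd w c ih => simp only [push, relabel, ih]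

theorem push_bind (φ : O ⟶ P) (h : ∀ w ∈ W, φ.app w ∈ V) (α : J →o I)
    (f : L → Tree W I L' (Vert.const W I)) {v : Vert W I} (t : Tree W I L v) :
    (t.bind f).push φ h α =
      (t.push φ h α).bind fun l => ((f l).push φ h α).cast (Vert.push_const φ h α) := by
  induction t with
  | leaf hv l =>
    subst hv
    have : ∀ (v : Vert V J) (hv : v = Vert.const V J) (g : L → Tree V J L' v),
        g l = (Tree.leaf hv l : Tree V J L v).bind fun l => (g l).cast hv := by
      rintro v rfl g; rfl
    exact this _ (Vert.push_const φ h α) fun l => (f l).push φ h α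
  | fwd x c ih => simp only [push, bind, ih]
  | bwd w c ih => simp only [push, bind, ih]

theorem push_id (h : ∀ w ∈ W, Hom.app (𝟙 O) w ∈ W) {v : Vert W I} (t : Tree W I L v) :
    t.push (𝟙 O) h OrderHom.id = t := by
  induction t with
  | leaf hv l => rfl
  | fwd x c ih => simp only [push, ih]; rfl
  | bwd w c ih => simp only [push, ih]; rfl

theorem push_push (φ : O ⟶ P) (h : ∀ w ∈ W, φ.app w ∈ V) (α : J →o I) (ψ : P ⟶ Q)
    (h' : ∀ w ∈ V, ψ.app w ∈ U) (β : K →o J) {v : Vert W I} (t : Tree W I L v) :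
    (t.push φ h α).push ψ h' β =
      t.push (φ ≫ ψ) (fun w hw => h' _ (h w hw)) (α.comp β) := by
  induction t with
  | leaf hv l => rfl
  | fwd x c ih => simp only [push, ih]; rfl
  | bwd w c ih => simp only [push, ih]; rfl

/-- The action on bijectively labelled trees. -/
def Labelled.push (φ : O ⟶ P) (h : ∀ w ∈ W, φ.app w ∈ V) (α : J →o I) {n : ℕ}
    (t : Labelled W I n) : Labelled V J n :=
  ⟨(t.1.push φ h α).cast (Vert.push_const φ h α), fun l => by
    rw [count_cast, count_push, t.2]⟩

end Tree

/-- The operad morphism between operads of tree hammocks induced by `φ` and `α`. -/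
noncomputable def treeLocMap (φ : O ⟶ P) (h : ∀ w ∈ W, φ.app w ∈ V) (α : J →o I) :
    treeLoc W I ⟶ treeLoc V J where
  app {n} x := Quotient.map (Tree.Labelled.push φ h α)
    (fun _ _ r => (Tree.Red.push φ h α r).cast _) x
  app_relabel e x := by
    obtain ⟨t, rfl⟩ := TreeLocOp.exists_rep x
    refine congrArg TreeLocOp.mk (Subtype.ext ?_)
    simp only [Tree.Labelled.push, Tree.Labelled.relabel, Tree.push_relabel, Tree.relabel_cast]
  app_one := by
    refine congrArg TreeLocOp.mk (Subtype.ext ?_)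
    have : ∀ (v : Vert V J) (hv : v = Vert.const V J),
        (Tree.leaf hv 0 : Tree V J (Fin 1) v).cast hv = Tree.leaf rfl 0 := by
      rintro v rfl; rfl
    exact this _ _
  app_γ {k j} x y := by
    obtain ⟨t, rfl⟩ := TreeLocOp.exists_rep x
    obtain ⟨y, rfl⟩ := TreeLocOp.exists_reps y
    refine (congrArg _ (TreeLocOp.γ_mk t y)).trans ?_
    refine Eq.trans ?_ (TreeLocOp.γ_mk (t.push φ h α) fun s => (y s).push φ h α).symm
    refine congrArg TreeLocOp.mk (Subtype.ext ?_)
    simp only [Tree.Labelled.push, Tree.Labelled.graft, Tree.graft, Tree.push_bind,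
      Tree.bind_cast, Tree.push_relabel, Tree.relabel_cast]

theorem treeLocMap_id (φ : O ⟶ O) (h : ∀ w ∈ W, φ.app w ∈ W) (α : I →o I) (hφ : φ = 𝟙 O)
    (hα : α = OrderHom.id) : treeLocMap φ h α = 𝟙 (treeLoc W I) := by
  subst hφ hα
  refine Hom.ext ?_
  funext n x
  obtain ⟨t, rfl⟩ := TreeLocOp.exists_rep x
  exact congrArg TreeLocOp.mk (Subtype.ext (Tree.push_id h t.1))

theorem treeLocMap_comp (φ : O ⟶ P) (h : ∀ w ∈ W, φ.app w ∈ V) (α : J →o I) (ψ : P ⟶ Q)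
    (h' : ∀ w ∈ V, ψ.app w ∈ U) (β : K →o J) (χ : O ⟶ Q) (h'' : ∀ w ∈ W, χ.app w ∈ U)
    (δ : K →o I) (hχ : χ = φ ≫ ψ) (hδ : δ = α.comp β) :
    treeLocMap χ h'' δ = treeLocMap φ h α ≫ treeLocMap ψ h' β := by
  subst hχ hδ
  refine Hom.ext ?_
  funext n x
  obtain ⟨t, rfl⟩ := TreeLocOp.exists_rep x
  refine congrArg TreeLocOp.mk (Subtype.ext ?_)
  simp only [Tree.Labelled.push, Tree.push_cast, Tree.push_push]
  exact (Tree.cast_cast _ _ _).symm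

end

section

variable {O P Q : SymOperad.{u}} {W : Submonoid (O.Op 1)} {V : Submonoid (P.Op 1)}
  {U : Submonoid (Q.Op 1)} {I J K : Type} [Preorder I] [Preorder J] [Preorder K]

/-- Reduced hammocks in `C_O` with respect to `C_{W₊}`, with rows indexed by `I`. -/
abbrev EnvHammock (W : Submonoid (O.Op 1)) (I : Type) [Preorder I] (a b : ℕ) : Type u :=
  HammockHom (C := O.Env) (envSub W) I a b

/-- The map of reduced hammocks induced by `φ` and `α`. -/
def envHammockMap (φ : O ⟶ P) (h : ∀ w ∈ W, φ.app w ∈ V) (α : J →o I) {a b : ℕ}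
    (x : EnvHammock W I a b) : EnvHammock V J a b :=
  HammockHom.map (envMap φ) (envSub_map φ h) α x

theorem envHammockMap_id (φ : O ⟶ O) (h : ∀ w ∈ W, φ.app w ∈ W) (α : I →o I) (hφ : φ = 𝟙 O)
    (hα : α = OrderHom.id) {a b : ℕ} (x : EnvHammock W I a b) : envHammockMap φ h α x = x := by
  subst hφ hα
  obtain ⟨x, rfl⟩ := x.exists_rep
  refine congrArg HammockHom.mk ?_
  refine (congrArg (Hammock.cast _ _)
    (Hammock.map_of_eq_id _ (envSub_map _ h) (envMap_id O) x)).trans ?_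
  exact Hammock.cast_cast _ _ _ _ _

theorem envHammockMap_comp (φ : O ⟶ P) (h : ∀ w ∈ W, φ.app w ∈ V) (α : J →o I) (ψ : P ⟶ Q)
    (h' : ∀ w ∈ V, ψ.app w ∈ U) (β : K →o J) (χ : O ⟶ Q) (h'' : ∀ w ∈ W, χ.app w ∈ U)
    (δ : K →o I) (hχ : χ = φ ≫ ψ) (hδ : δ = α.comp β) {a b : ℕ} (x : EnvHammock W I a b) :
    envHammockMap χ h'' δ x = envHammockMap ψ h' β (envHammockMap φ h α x) := by
  subst hχ hδ
  obtain ⟨x, rfl⟩ := x.exists_rep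
  refine congrArg HammockHom.mk ?_
  refine (congrArg (Hammock.cast _ _) (Hammock.map_of_eq_comp _ (envSub_map _ h) _
    (envSub_map _ h') α β _ (envSub_map _ h'') (envMap_comp φ ψ) x)).trans ?_
  refine (Hammock.cast_cast _ _ _ _ _).trans ?_
  refine Eq.trans ?_ (congrArg (Hammock.cast _ _) (Hammock.map_cast (envMap ψ)
    (envSub_map ψ h') β _ _ _)).symm
  exact (Hammock.cast_cast _ _ _ _ _).symm

end

/-! ### Simplicial operads and bisimplicial categories -/

/-- A simplicial operad, that is, an operad in simplicial sets: all structure maps are compatible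
with the simplicial operators. -/
abbrev SimplicialOperad : Type (u + 1) := SimplicialObject SymOperad.{u}

/-- An operad in bisimplicial sets. -/
abbrev BisimplicialOperad : Type (u + 1) :=
  (SimplexCategoryᵒᵖ × SimplexCategoryᵒᵖ) ⥤ SymOperad.{u}

/-- A (simplicial) submonoid of the simplicial monoid of unary operations. -/
structure SimplicialSubmonoid (𝒪 : SimplicialOperad.{u}) where
  W : ∀ S : SimplexCategoryᵒᵖ, Submonoid ((𝒪.obj S).Op 1)
  map_mem : ∀ {S T : SimplexCategoryᵒᵖ} (f : S ⟶ T), ∀ w ∈ W S, (𝒪.map f).app w ∈ W T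

/-- A category enriched in bisimplicial sets whose set of objects is `ℕ`. -/
structure BisimplicialCat where
  Hom : ℕ → ℕ → (SimplexCategoryᵒᵖ × SimplexCategoryᵒᵖ ⥤ Type u)
  id : ∀ (a : ℕ) (S : SimplexCategoryᵒᵖ × SimplexCategoryᵒᵖ), (Hom a a).obj S
  comp : ∀ {a b c : ℕ} {S : SimplexCategoryᵒᵖ × SimplexCategoryᵒᵖ},
    (Hom a b).obj S → (Hom b c).obj S → (Hom a c).obj S
  map_id : ∀ (a : ℕ) {S T : SimplexCategoryᵒᵖ × SimplexCategoryᵒᵖ} (f : S ⟶ T),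
    (Hom a a).map f (id a S) = id a T
  map_comp : ∀ {a b c : ℕ} {S T : SimplexCategoryᵒᵖ × SimplexCategoryᵒᵖ} (f : S ⟶ T)
    (x : (Hom a b).obj S) (y : (Hom b c).obj S),
    (Hom a c).map f (comp x y) = comp ((Hom a b).map f x) ((Hom b c).map f y)
  id_comp : ∀ {a b : ℕ} {S : SimplexCategoryᵒᵖ × SimplexCategoryᵒᵖ} (x : (Hom a b).obj S),
    comp (id a S) x = x
  comp_id : ∀ {a b : ℕ} {S : SimplexCategoryᵒᵖ × SimplexCategoryᵒᵖ} (x : (Hom a b).obj S),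
    comp x (id b S) = x
  assoc : ∀ {a b c d : ℕ} {S : SimplexCategoryᵒᵖ × SimplexCategoryᵒᵖ} (x : (Hom a b).obj S)
    (y : (Hom b c).obj S) (z : (Hom c d).obj S), comp (comp x y) z = comp x (comp y z)

/-- A functor of categories enriched in bisimplicial sets which is the identity on objects. -/
structure BisimplicialFunctor (𝒞 𝒟 : BisimplicialCat.{u}) where
  app : ∀ a b : ℕ, 𝒞.Hom a b ⟶ 𝒟.Hom a b
  app_id : ∀ (a : ℕ) (S : SimplexCategoryᵒᵖ × SimplexCategoryᵒᵖ),
    (app a a).app S (𝒞.id a S) = 𝒟.id a S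
  app_comp : ∀ {a b c : ℕ} {S : SimplexCategoryᵒᵖ × SimplexCategoryᵒᵖ} (x : (𝒞.Hom a b).obj S)
    (y : (𝒞.Hom b c).obj S),
    (app a c).app S (𝒞.comp x y) = 𝒟.comp ((app a b).app S x) ((app b c).app S y)

/-- A functor is full if it is surjective on morphisms, that is, on all bisimplices of all
bisimplicial sets of morphisms. -/
def BisimplicialFunctor.Full {𝒞 𝒟 : BisimplicialCat.{u}} (R : BisimplicialFunctor 𝒞 𝒟) : Prop :=
  ∀ (a b : ℕ) (S : SimplexCategoryᵒᵖ × SimplexCategoryᵒᵖ),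
    Function.Surjective ((R.app a b).app S)

/-- The category `C_𝒬` enriched in bisimplicial sets of an operad `𝒬` in bisimplicial sets. -/
def bisimplicialEnv (𝒬 : BisimplicialOperad.{u}) : BisimplicialCat.{u} where
  Hom a b :=
    { obj := fun S => (𝒬.obj S).EnvHom a b
      map := fun {S T} f => TypeCat.ofHom fun x : (𝒬.obj S).EnvHom a b =>
        ((envMap (𝒬.map f)).map (X := a) (Y := b) x : (𝒬.obj T).EnvHom a b)
      map_id := fun S => by
        ext x
        induction x using Quotient.inductionOn with | _ x
        exact congrArg EnvHom.mk (congrArg (fun φ => x.map φ) (𝒬.map_id S))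
      map_comp := fun f g => by
        ext x
        induction x using Quotient.inductionOn with | _ x
        exact congrArg EnvHom.mk (congrArg (fun φ => x.map φ) (𝒬.map_comp f g)) }
  id a S := EnvHom.mk (PreHom.id (𝒬.obj S) a)
  comp {a b c S} x y := CategoryStruct.comp (obj := (𝒬.obj S).Env) (X := a) (Y := b) (Z := c) x y
  map_id a S T f := (envMap (𝒬.map f)).map_id a
  map_comp {a b c S T} f x y := (envMap (𝒬.map f)).map_comp (X := a) (Y := b) (Z := c) x y
  id_comp {a b S} x := Category.id_comp (obj := (𝒬.obj S).Env) (X := a) (Y := b) x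
  comp_id {a b S} x := Category.comp_id (obj := (𝒬.obj S).Env) (X := a) (Y := b) x
  assoc {a b c d S} x y z :=
    Category.assoc (obj := (𝒬.obj S).Env) (W := a) (X := b) (Y := c) (Z := d) x y z

/-- The set of rows `{0, …, ℓ}` of hammocks of height `ℓ`. -/
abbrev Rows (T : SimplexCategoryᵒᵖ) : Type := Fin (T.unop.len + 1)

/-- The map of rows corresponding to a simplicial operator. -/
abbrev rowMap {T T' : SimplexCategoryᵒᵖ} (g : T ⟶ T') : Rows T' →o Rows T := g.unop.toOrderHom

/-- The tree hammock localization of the simplicial operad `𝒪` with respect to `𝒲`. In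
bidegree `(k, ℓ)` it consists of the reduced tree hammocks of height `ℓ` labelled by
`k`-simplices. -/
noncomputable def treeHammockLocalization (𝒪 : SimplicialOperad.{u})
    (𝒲 : SimplicialSubmonoid 𝒪) : BisimplicialOperad.{u} where
  obj S := treeLoc (𝒲.W S.1) (Rows S.2)
  map f := treeLocMap (𝒪.map f.1) (𝒲.map_mem f.1) (rowMap f.2)
  map_id S := treeLocMap_id _ _ _ (𝒪.map_id S.1) rfl
  map_comp f g := treeLocMap_comp _ _ _ _ _ _ _ _ _ (𝒪.map_comp f.1 g.1) rfl

/-- The hammock localization of the simplicially enriched category `C_𝒪` with respect to the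
simplicially enriched subcategory `C_{𝒲₊}`. In bidegree `(k, ℓ)` its morphisms are the reduced
hammocks of height `ℓ` in the category `C_{𝒪_k}`. -/
def hammockLocalization (𝒪 : SimplicialOperad.{u}) (𝒲 : SimplicialSubmonoid 𝒪) :
    BisimplicialCat.{u} where
  Hom a b :=
    { obj := fun S => EnvHammock (𝒲.W S.1) (Rows S.2) a b
      map := fun f => TypeCat.ofHom
        (envHammockMap (𝒪.map f.1) (𝒲.map_mem f.1) (rowMap f.2))
      map_id := fun S => by
        ext x
        exact envHammockMap_id (𝒪.map (𝟙 S.1)) (𝒲.map_mem (𝟙 S.1)) (rowMap (𝟙 S.2)) (𝒪.map_id S.1) rfl x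
      map_comp := fun f g => by
        ext x
        exact envHammockMap_comp (𝒪.map f.1) (𝒲.map_mem f.1) (rowMap f.2) (𝒪.map g.1)
          (𝒲.map_mem g.1) (rowMap g.2) (𝒪.map (f.1 ≫ g.1)) (𝒲.map_mem (f.1 ≫ g.1))
          (rowMap (f.2 ≫ g.2)) (𝒪.map_comp f.1 g.1) rfl x }
  id a S := HammockHom.id (C := (𝒪.obj S.1).Env) _ _ a
  comp x y := HammockHom.comp x y
  map_id a S T f := HammockHom.map_id (envMap (𝒪.map f.1))
    (envSub_map (𝒪.map f.1) (𝒲.map_mem f.1)) (rowMap f.2) a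
  map_comp f x y := HammockHom.map_comp (envMap (𝒪.map f.1))
    (envSub_map (𝒪.map f.1) (𝒲.map_mem f.1)) (rowMap f.2) x y
  id_comp x := HammockHom.id_comp x
  comp_id x := HammockHom.comp_id x
  assoc x y z := HammockHom.assoc x y z

end TreeHammock
/-! ### Hammock reduction -/

namespace TreeHammock

open SymOperad

section

variable {O : SymOperad.{u}} {W : Submonoid (O.Op 1)} {I : Type} [Preorder I]

/-- The morphism of `C_O` given by unary operations `w 1, …, w c` and the permutation `p`. -/
def unary {c m : ℕ} (w : Fin c → O.Op 1) (p : Fin c ≃ Fin m) :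
    Env.of O c ⟶ Env.of O m :=
  EnvHom.mk ⟨fun _ => 1, w, (Equiv.sigmaUnique (Fin c) fun _ => Fin 1).trans p⟩

/-- The morphism of `C_O` given by a permutation. -/
def perm (O : SymOperad.{u}) {c m : ℕ} (p : Fin c ≃ Fin m) : Env.of O c ⟶ Env.of O m :=
  unary (fun _ => O.one) p

/-- A frame of a column of objects of a hammock in `C_O`. The vertical maps of such a column are
given by unary operations in `W` and permutations; hence the column consists of `c` nodes of tree
hammocks, `v 1, …, v c`, which appear in row `i` in the order given by the permutation `p i`. -/
structure Frame (X : Node (envSub W) I) (c : ℕ) where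
  v : Fin c → Vert W I
  p : ∀ i, Fin c ≃ Fin (X.F.obj i)
  comm : ∀ {i j : I} (h : i ≤ j),
    perm O (p i) ≫ X.F.map (homOfLE h) = unary (fun s => (v s).map h) (p j)

/-- The standard frame of a constant column. -/
def Frame.const (W : Submonoid (O.Op 1)) (I : Type) [Preorder I] (a : ℕ) :
    Frame (Node.const (envSub W) I (Env.of O a)) a where
  v _ := Vert.const W I
  p _ := Equiv.refl _
  comm _ := Category.comp_id _

/-- `Unfolds h φ T` states that the hammock `h` in `C_O`, ending at the object `b`, is obtained
from the family of trees `T` (one tree for each node of the first column): the `i`-th column of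
`h` is the union of the atomic pieces of `T` that are `i` steps away from the roots. All the
labelled leaves of `T` are reached after the same number of steps, and the branches ending in a
piece `O_0` may be shorter. -/
inductive Unfolds {b : ℕ} : ∀ {X : Node (envSub W) I} {c : ℕ} (φ : Frame X c),
    Hammock (envSub W) I X (Node.const (envSub W) I (Env.of O b)) →
      (∀ s, Tree W I (Fin b) (φ.v s)) → Prop
  | nil : Unfolds (Frame.const W I b) (.nil _) fun s => .leaf rfl s
  | right {X Y : Node (envSub W) I} {c d : ℕ} (φ : Frame X c) (ψ : Frame Y d) (f : X.F ⟶ Y.F)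
      (h : Hammock (envSub W) I Y (Node.const (envSub W) I (Env.of O b)))
      (T : ∀ t, Tree W I (Fin b) (ψ.v t)) (k : Fin c → ℕ) (e : (Σ s, Fin (k s)) ≃ Fin d)
      (x : ∀ s, Fwd (φ.v s) fun r : Fin (k s) => ψ.v (e ⟨s, r⟩)) :
      (∀ i, perm O (φ.p i) ≫ f.app i =
        EnvHom.mk ⟨k, fun s => (x s).op i, e.trans (ψ.p i)⟩) →
      Unfolds ψ h T →
      Unfolds φ (.right f h) fun s => .fwd (x s) fun r => T (e ⟨s, r⟩)
  | left {X Y : Node (envSub W) I} {c d : ℕ} (φ : Frame X c) (ψ : Frame Y d) (f : Y.F ⟶ X.F)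
      (hf : ∀ i, envSub W (f.app i))
      (h : Hammock (envSub W) I Y (Node.const (envSub W) I (Env.of O b)))
      (T : ∀ t, Tree W I (Fin b) (ψ.v t)) (e : Fin c ≃ Fin d)
      (w : ∀ s, Bwd (φ.v s) (ψ.v (e s))) :
      (∀ i, perm O (ψ.p i) ≫ f.app i =
        unary (fun t => (w (e.symm t)).op i) (e.symm.trans (φ.p i))) →
      Unfolds ψ h T →
      Unfolds φ (.left f hf h) fun s => .bwd (w s) (T (e s))

/-- Families of trees with leaves labelled by `1, …, b`, as morphisms `a ⟶ b` of the category of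
the tree hammock operad: representatives consisting of trees `t i` with `k i` leaves and a
labelling of all the leaves. -/
structure Forest (W : Submonoid (O.Op 1)) (I : Type) [Preorder I] (a b : ℕ) where
  k : Fin a → ℕ
  t : ∀ i, Tree.Labelled W I (k i)
  e : (Σ i, Fin (k i)) ≃ Fin b

/-- The trees of a forest with their leaves labelled by `1, …, b`. -/
def Forest.tree {a b : ℕ} (F : Forest W I a b) (i : Fin a) :
    Tree W I (Fin b) (Vert.const W I) :=
  (F.t i).1.relabel fun l => F.e ⟨i, l⟩

/-- The morphism of the category of the tree hammock operad obtained by reducing the trees. -/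
noncomputable def Forest.reduce {a b : ℕ} (F : Forest W I a b) : (treeLoc W I).EnvHom a b :=
  EnvHom.mk ⟨F.k, fun i => TreeLocOp.mk (F.t i), F.e⟩

end

/-- `R` is given by hammock reduction: every hammock in `C_𝒪` is obtained from a family of tree
hammocks, and `R` sends its class to the tree hammock reduction of any such family. -/
def IsHammockReduction {𝒪 : SimplicialOperad.{u}} {𝒲 : SimplicialSubmonoid 𝒪}
    (R : BisimplicialFunctor (hammockLocalization 𝒪 𝒲)
      (bisimplicialEnv (treeHammockLocalization 𝒪 𝒲))) : Prop :=
  ∀ (a b : ℕ) (S : SimplexCategoryᵒᵖ × SimplexCategoryᵒᵖ)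
    (h : Hammock (C := (𝒪.obj S.1).Env) (envSub (𝒲.W S.1)) (Rows S.2)
      (Node.const _ _ (Env.of _ a)) (Node.const _ _ (Env.of _ b))),
    (∃ F : Forest (𝒲.W S.1) (Rows S.2) a b, Unfolds (Frame.const _ _ a) h F.tree) ∧
    ∀ F : Forest (𝒲.W S.1) (Rows S.2) a b, Unfolds (Frame.const _ _ a) h F.tree →
      (R.app a b).app S (HammockHom.mk h) = F.reduce

end TreeHammock

/-! The vertical maps of a column of objects are permutations decorated by elements of `W`
(`envSub_iff`). Following these permutations out of the bottom row splits the column into single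
nodes, which is a `Frame`. As the rows have a least element, a frame exists (`exists_canonFrame`)
and is determined by its order in the bottom row (`Frame.ext_of_bot`), so any two frames of a column
differ only by a reordering. With frames fixed on both sides, a column of arrows splits into columns
of atomic pieces: the commuting squares force the arities and the incidence in every row to agree,
up to reordering inputs, with those in the bottom row (`exists_rightRep`, `exists_leftRep`). The
only freedom left is the order of the inputs of the pieces `O_n`, which is exactly `Red.planar`
(`RightRep.red`); for the pieces `W_1` there is none (`LeftRep.bwd_eq`).

Hence a hammock unfolds into trees that are unique up to reduction. Composing adjacent columns, or
deleting a column of identities, does the same simultaneously in all the trees (`unfold_red`), so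
the reduced trees depend only on the class of the hammock. `Forest.reduce_eq_of_red` turns this into
an equality of morphisms in the category of the tree hammock operad. Concatenation becomes grafting
(`Unfolds.append`), and simplicial operators act on hammocks and trees in the same way
(`Unfolds.push`), which gives the functor.

For fullness, identity pieces are inserted into a given family of trees until levels of pieces `O_n`
and `W_1` alternate in step and all labelled leaves lie equally far from the roots; branches ending
in `O_0` may stop early. Each level is then a column of a hammock, and the inserted identities
disappear under reduction (`exists_unfolds_of_count`). -/

namespace TreeHammock

open SymOperad

/-! ### Normal forms of composites in the category of operators -/

section EnvCalculus

variable {O : SymOperad.{u}}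

namespace SymOperad.EnvHom

/-- Composition of morphisms of `C_O`. -/
def comp {a b c : ℕ} (f : O.EnvHom a b) (g : O.EnvHom b c) : O.EnvHom a c :=
  CategoryStruct.comp (obj := O.Env) (X := a) (Y := b) (Z := c) f g

/-- The morphism given by unary operations and a permutation. -/
def unary {c m : ℕ} (w : Fin c → O.Op 1) (p : Fin c ≃ Fin m) : O.EnvHom c m :=
  TreeHammock.unary w p

/-- The morphism given by a permutation. -/
def perm (O : SymOperad.{u}) {c m : ℕ} (p : Fin c ≃ Fin m) : O.EnvHom c m :=
  unary (fun _ => O.one) p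

theorem mk_comp_mk {a b c : ℕ} (f : O.PreHom a b) (g : O.PreHom b c) :
    (mk f).comp (mk g) = mk (f.comp g) := rfl

theorem assoc {a b c d : ℕ} (f : O.EnvHom a b) (g : O.EnvHom b c) (h : O.EnvHom c d) :
    (f.comp g).comp h = f.comp (g.comp h) :=
  Category.assoc (obj := O.Env) (W := a) (X := b) (Y := c) (Z := d) f g h

theorem exact {a b : ℕ} {f g : O.PreHom a b} (h : mk f = mk g) : f.Rel g :=
  Quotient.exact h

theorem exists_rep {a b : ℕ} (f : O.EnvHom a b) : ∃ g, f = mk g :=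
  ⟨_, (Quotient.out_eq f).symm⟩

end SymOperad.EnvHom

/-- Reindexing the operations of a representative along a bijection. -/
def SymOperad.PreHom.reindex {a b c : ℕ} (p : Fin a ≃ Fin b) (f : O.PreHom b c) :
    O.PreHom a c where
  k s := f.k (p s)
  op s := f.op (p s)
  e := (Equiv.sigmaCongrLeft (β := fun t => Fin (f.k t)) p).trans f.e

theorem SymOperad.PreHom.ext_e {a b : ℕ} {k : Fin a → ℕ} {op : ∀ i, O.Op (k i)}
    {e e' : (Σ i, Fin (k i)) ≃ Fin b} (h : ∀ s r, e ⟨s, r⟩ = e' ⟨s, r⟩) :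
    (⟨k, op, e⟩ : O.PreHom a b) = ⟨k, op, e'⟩ :=
  congrArg (PreHom.mk k op) (Equiv.ext fun ⟨s, r⟩ => h s r)

namespace SymOperad.EnvHom

/-- The composite of representatives has sums over one block as arities. Removing them by `oneBlock`
yields a representative with the arities of `f` itself, so that two sides of a commuting square can
be compared without casts. -/
theorem unary_comp_mk {a b c : ℕ} (w : Fin a → O.Op 1) (p : Fin a ≃ Fin b) (f : O.PreHom b c) :
    (unary w p).comp (mk f) =
      mk ⟨(f.reindex p).k, fun s => O.lact (w s) (f.op (p s)), (f.reindex p).e⟩ := by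
  refine EnvHom.sound ⟨fun i => (oneBlock (f.k (p i))).symm, fun i => rfl, fun i q => ?_⟩
  obtain ⟨⟨s, t⟩, rfl⟩ := finSigmaFinEquiv.surjective q
  refine Eq.trans ?_ (PreHom.comp_e _ f i s t).symm
  exact congrArg (fun r => f.e ⟨p i, r⟩) ((Equiv.symm_apply_eq _).2 (oneBlock_apply _ t s))

theorem mk_comp_unary {a b c : ℕ} (f : O.PreHom a b) (w : Fin b → O.Op 1) (p : Fin b ≃ Fin c) :
    (mk f).comp (unary w p) =
      mk ⟨f.k, fun s => O.ract (f.op s) fun r => w (f.e ⟨s, r⟩), f.e.trans p⟩ := by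
  refine EnvHom.sound ⟨fun i => (unitBlocks (f.k i)).symm, fun i => rfl, fun i q => ?_⟩
  obtain ⟨⟨s, t⟩, rfl⟩ := finSigmaFinEquiv.surjective q
  refine Eq.trans ?_ (PreHom.comp_e f _ i s t).symm
  exact congrArg (fun r => p (f.e ⟨i, r⟩)) ((Equiv.symm_apply_eq _).2 (unitBlocks_apply _ s t))

theorem perm_comp_mk {a b c : ℕ} (p : Fin a ≃ Fin b) (f : O.PreHom b c) :
    (perm O p).comp (mk f) = mk (f.reindex p) := by
  refine (unary_comp_mk _ p f).trans (congrArg EnvHom.mk ?_)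
  exact congrArg (fun op => (⟨_, op, _⟩ : O.PreHom a c)) (funext fun s => lact_one _)

theorem mk_comp_perm {a b c : ℕ} (f : O.PreHom a b) (p : Fin b ≃ Fin c) :
    (mk f).comp (perm O p) = mk ⟨f.k, f.op, f.e.trans p⟩ := by
  refine (mk_comp_unary f _ p).trans (congrArg EnvHom.mk ?_)
  exact congrArg (fun op => (⟨_, op, _⟩ : O.PreHom a c)) (funext fun s => ract_one _)

theorem unary_comp_unary {a b c : ℕ} (w : Fin a → O.Op 1) (p : Fin a ≃ Fin b)
    (w' : Fin b → O.Op 1) (p' : Fin b ≃ Fin c) :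
    (unary w p).comp (unary w' p') = unary (fun s => w s * w' (p s)) (p.trans p') :=
  (unary_comp_mk w p ⟨fun _ => 1, w', (Equiv.sigmaUnique (Fin b) fun _ => Fin 1).trans p'⟩).trans
    (congrArg mk (PreHom.ext_e fun _ _ => rfl))

theorem perm_comp_unary {a b c : ℕ} (p : Fin a ≃ Fin b)
    (w' : Fin b → O.Op 1) (p' : Fin b ≃ Fin c) :
    (perm O p).comp (unary w' p') = unary (fun s => w' (p s)) (p.trans p') :=
  (perm_comp_mk p ⟨fun _ => 1, w', (Equiv.sigmaUnique (Fin b) fun _ => Fin 1).trans p'⟩).trans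
    (congrArg mk (PreHom.ext_e fun _ _ => rfl))

theorem unary_comp_perm {a b c : ℕ} (w : Fin a → O.Op 1) (p : Fin a ≃ Fin b) (p' : Fin b ≃ Fin c) :
    (unary w p).comp (perm O p') = unary w (p.trans p') :=
  mk_comp_perm _ p'

theorem unary_comp {a b c : ℕ} (w : Fin a → O.Op 1) (p : Fin a ≃ Fin b) (f : O.EnvHom b c) :
    (unary w p).comp f = (unary w (Equiv.refl _)).comp ((perm O p).comp f) := by
  rw [← assoc, unary_comp_perm, Equiv.refl_trans]

theorem perm_comp_perm {a b c : ℕ} (p : Fin a ≃ Fin b) (p' : Fin b ≃ Fin c) :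
    (perm O p).comp (perm O p') = perm O (p.trans p') :=
  unary_comp_perm _ p p'

theorem perm_refl_comp {a b : ℕ} (f : O.EnvHom a b) : (perm O (Equiv.refl _)).comp f = f :=
  Category.id_comp (obj := O.Env) (X := a) (Y := b) f

theorem perm_comp_perm_symm_comp {a b c : ℕ} (p : Fin a ≃ Fin b) (f : O.EnvHom a c) :
    (perm O p).comp ((perm O p.symm).comp f) = f := by
  rw [← assoc, perm_comp_perm, Equiv.self_trans_symm, perm_refl_comp]

theorem perm_symm_comp_perm_comp {a b c : ℕ} (p : Fin a ≃ Fin b) (f : O.EnvHom b c) :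
    (perm O p.symm).comp ((perm O p).comp f) = f := by
  rw [← assoc, perm_comp_perm, Equiv.symm_trans_self, perm_refl_comp]

theorem perm_comp_inj {a b c : ℕ} (p : Fin a ≃ Fin b) {f g : O.EnvHom b c}
    (h : (perm O p).comp f = (perm O p).comp g) : f = g := by
  rw [← perm_symm_comp_perm_comp p f, h, perm_symm_comp_perm_comp]

/-- The identification of representatives is free: a permutation of inputs compatible with the
bijective labelling `e` on both sides is the identity. So once the shape is fixed, equations between
morphisms become equations between operations. -/
theorem mk_inj {a b : ℕ} {k : Fin a → ℕ} {op op' : ∀ i, O.Op (k i)}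
    {e : (Σ i, Fin (k i)) ≃ Fin b} (h : mk ⟨k, op, e⟩ = mk ⟨k, op', e⟩) : op = op' := by
  obtain ⟨τ, h, h'⟩ := EnvHom.exact h
  funext i
  have : τ i = Equiv.refl _ := by
    ext1 s
    simpa using e.injective (h' i s)
  have h := h i
  simp only [this, relabel_refl] at h
  exact h.symm

/-- `Fin 1` has no nontrivial permutation, so unary representatives are unique. This is what allows
permutations and labels to be read off from vertical and left-pointing maps. -/
theorem unary_inj {a b : ℕ} {w w' : Fin a → O.Op 1} {p p' : Fin a ≃ Fin b}
    (h : unary w p = unary w' p') : w = w' ∧ p = p' := by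
  obtain ⟨τ, h, h'⟩ := EnvHom.exact h
  have hτ : ∀ i, τ i = Equiv.refl (Fin 1) := fun i => Subsingleton.elim _ _
  constructor
  · funext i
    have h := h i
    simp only [hτ, relabel_refl] at h
    exact h.symm
  · ext1 i
    exact (h' i 0).symm

end SymOperad.EnvHom

/-- Operations of `plus W` have arity one only up to a bijection `Fin 1 ≃ Fin n`; these bijections
are absorbed into the labelling. -/
theorem envSub_iff {W : Submonoid (O.Op 1)} {a b : ℕ} (f : Env.of O a ⟶ Env.of O b) :
    envSub W f ↔ ∃ w : Fin a → O.Op 1, ∃ p : Fin a ≃ Fin b,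
      (∀ s, w s ∈ W) ∧ f = EnvHom.unary w p := by
  constructor
  · rintro ⟨g, rfl, hg⟩
    choose w hw e he using hg
    refine ⟨w, (Equiv.sigmaUnique (Fin a) fun _ => Fin 1).symm.trans
      ((Equiv.sigmaCongrRight e).trans g.e), hw, (EnvHom.sound ⟨e, he, fun i s => ?_⟩).symm⟩
    obtain rfl : s = 0 := Subsingleton.elim _ _
    rfl
  · rintro ⟨w, p, hw, rfl⟩
    exact ⟨_, rfl, fun i => ⟨w i, hw i, Equiv.refl _, (O.relabel_refl _).symm⟩⟩

end EnvCalculus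

/-! ### Splitting columns of objects into nodes -/

section Frames

variable {O : SymOperad.{u}} {W : Submonoid (O.Op 1)} {I : Type} [Preorder I]

namespace Node

/-- The number of nodes in a row of a column of objects. -/
def size (X : Node (envSub W) I) (i : I) : ℕ := X.F.obj i

/-- The vertical maps of a column of objects. -/
def hom (X : Node (envSub W) I) {i j : I} (h : i ≤ j) : O.EnvHom (X.size i) (X.size j) :=
  X.F.map (homOfLE h)

/-- The arrows of a column of arrows. -/
def natHom {X Y : Node (envSub W) I} (f : X.F ⟶ Y.F) (i : I) : O.EnvHom (X.size i) (Y.size i) :=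
  f.app i

theorem hom_comp_natHom {X Y : Node (envSub W) I} (f : X.F ⟶ Y.F) {i j : I} (h : i ≤ j) :
    (X.hom h).comp (natHom f j) = (natHom f i).comp (Y.hom h) :=
  f.naturality _

theorem hom_refl (X : Node (envSub W) I) (i : I) :
    X.hom (le_refl i) = EnvHom.perm O (Equiv.refl _) :=
  X.F.map_id i

theorem hom_trans (X : Node (envSub W) I) {i j k : I} (h : i ≤ j) (h' : j ≤ k) :
    X.hom (h.trans h') = (X.hom h).comp (X.hom h') :=
  X.F.map_comp (homOfLE h) (homOfLE h')

theorem exists_unary (X : Node (envSub W) I) {i j : I} (h : i ≤ j) :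
    ∃ w : Fin (X.size i) → O.Op 1, ∃ p : Fin (X.size i) ≃ Fin (X.size j),
      (∀ s, w s ∈ W) ∧ X.hom h = EnvHom.unary w p :=
  (envSub_iff (a := X.size i) (b := X.size j) _).1 (X.mem (homOfLE h))

end Node

namespace Frame

variable {X : Node (envSub W) I} {c d : ℕ}

/-- The order of the nodes in a row. -/
def ord (φ : Frame X c) (i : I) : Fin c ≃ Fin (X.size i) := φ.p i

theorem perm_comp_hom (φ : Frame X c) {i j : I} (h : i ≤ j) :
    (EnvHom.perm O (φ.ord i)).comp (X.hom h) =
      EnvHom.unary (fun s => (φ.v s).map h) (φ.ord j) :=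
  φ.comm h

/-- Frames in terms of morphisms between natural numbers. -/
def ofOrd (v : Fin c → Vert W I) (p : ∀ i, Fin c ≃ Fin (X.size i))
    (h : ∀ {i j : I} (h : i ≤ j), (EnvHom.perm O (p i)).comp (X.hom h) =
      EnvHom.unary (fun s => (v s).map h) (p j)) : Frame X c :=
  ⟨v, p, h⟩

/-- Reordering the nodes of a frame. -/
def reindex (φ : Frame X d) (σ : Fin c ≃ Fin d) : Frame X c :=
  ofOrd (fun s => φ.v (σ s)) (fun i => σ.trans (φ.ord i)) fun {i j} h => by
    rw [← EnvHom.perm_comp_perm, EnvHom.assoc, φ.perm_comp_hom h, EnvHom.perm_comp_unary]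

/-- The vertical map from `⊥` to `i` carries the order in the bottom row to the order in row `i`,
and the nodes are then the decorations of the vertical maps; uniqueness of unary representatives
applies both times. -/
theorem ext_of_bot [OrderBot I] {φ φ' : Frame X c} (h : φ.ord ⊥ = φ'.ord ⊥) : φ = φ' := by
  have hp : ∀ i, φ.ord i = φ'.ord i := fun i =>
    (EnvHom.unary_inj ((φ.perm_comp_hom (bot_le : ⊥ ≤ i)).symm.trans ((congrArg (fun p =>
      (EnvHom.perm O p).comp (X.hom (bot_le : ⊥ ≤ i))) h).trans (φ'.perm_comp_hom _)))).2
  obtain ⟨v, p, hc⟩ := φ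
  obtain ⟨v', p', hc'⟩ := φ'
  obtain rfl : p = p' := funext hp
  have : v = v' := by
    funext s
    ext i j hij
    exact congrFun (EnvHom.unary_inj ((hc hij).symm.trans (hc' hij))).1 s
  subst this
  rfl

end Frame

/-- Each node is followed from its place in the bottom row: it sits at `p ⊥ i s` in row `i`, and its
vertical map is the decoration of the vertical map of `X` found there. -/
theorem exists_canonFrame [OrderBot I] (X : Node (envSub W) I) :
    ∃ φ : Frame X (X.size ⊥), φ.ord ⊥ = Equiv.refl _ := by
  choose w p hw hp using fun (i j : I) (h : i ≤ j) => X.exists_unary h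
  -- The decorations and permutations were chosen separately for each pair of rows. Functoriality of
  -- `X`, read through `EnvHom.unary_inj`, makes these choices compatible with identities and
  -- composites.
  have hid : ∀ i : I, EnvHom.unary (w i i le_rfl) (p i i le_rfl) =
      EnvHom.unary (fun _ => O.one) (Equiv.refl (Fin (X.size i))) := fun i =>
    (hp i i le_rfl).symm.trans (X.hom_refl i)
  have hcomp : ∀ (i j k : I) (h : i ≤ j) (h' : j ≤ k), EnvHom.unary (w i k (h.trans h'))
      (p i k (h.trans h')) = EnvHom.unary (fun s => w i j h s * w j k h' (p i j h s))
        ((p i j h).trans (p j k h')) := fun i j k h h' => by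
    rw [← EnvHom.unary_comp_unary, ← hp, ← hp, ← hp]
    exact X.hom_trans h h'
  refine ⟨Frame.ofOrd (fun s => ⟨fun {i j} h => w i j h (p ⊥ i bot_le s), fun h => hw _ _ _ _,
    fun i => ?_, fun {i j k} h h' => ?_⟩) (fun i => p ⊥ i bot_le) fun {i j} h => ?_,
    (EnvHom.unary_inj (hid ⊥)).2⟩
  · exact congrFun (EnvHom.unary_inj (hid i)).1 _
  · refine (congrFun (EnvHom.unary_inj (hcomp i j k h h')).1 _).trans ?_
    exact congrArg (fun q : Fin (X.size ⊥) ≃ Fin (X.size j) => w i j h (p ⊥ i bot_le s) *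
      w j k h' (q s)) (EnvHom.unary_inj (hcomp ⊥ i j bot_le h)).2.symm
  · rw [hp i j h, EnvHom.perm_comp_unary, (EnvHom.unary_inj (hcomp ⊥ i j bot_le h)).2]

/-- The frame whose nodes are ordered as in the first row. -/
noncomputable def canonFrame [OrderBot I] (X : Node (envSub W) I) : Frame X (X.size ⊥) :=
  (exists_canonFrame X).choose

theorem canonFrame_ord_bot [OrderBot I] (X : Node (envSub W) I) :
    (canonFrame X).ord ⊥ = Equiv.refl _ :=
  (exists_canonFrame X).choose_spec

theorem Frame.eq_reindex [OrderBot I] {X : Node (envSub W) I} {c : ℕ} (φ : Frame X c) :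
    φ = (canonFrame X).reindex (φ.ord ⊥) :=
  Frame.ext_of_bot ((congrArg (Equiv.trans (φ.ord ⊥)) (canonFrame_ord_bot X)).symm.trans rfl)

theorem canonFrame_const [OrderBot I] (b : ℕ) :
    canonFrame (Node.const (envSub W) I (Env.of O b)) = Frame.const W I b :=
  Frame.ext_of_bot (canonFrame_ord_bot _)

/-! ### Splitting columns of arrows into atomic pieces -/

section Reps

variable {X Y Z : Node (envSub W) I} {a b c d : ℕ}

/-- A column of arrows pointing to the right, as a family of columns of pieces `O_n`. -/
structure RightRep (φ : Frame X c) (ψ : Frame Y d) (f : X.F ⟶ Y.F) where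
  k : Fin c → ℕ
  e : (Σ s, Fin (k s)) ≃ Fin d
  x : ∀ s, Fwd (φ.v s) fun r : Fin (k s) => ψ.v (e ⟨s, r⟩)
  app : ∀ i, (EnvHom.perm O (φ.ord i)).comp (Node.natHom f i) =
    EnvHom.mk ⟨k, fun s => (x s).op i, e.trans (ψ.ord i)⟩

/-- A column of arrows pointing to the left, as a family of columns of pieces `W_1`. -/
structure LeftRep (φ : Frame X c) (ψ : Frame Y d) (f : Y.F ⟶ X.F) where
  e : Fin c ≃ Fin d
  w : ∀ s, Bwd (φ.v s) (ψ.v (e s))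
  app : ∀ i, (EnvHom.perm O (ψ.ord i)).comp (Node.natHom f i) =
    EnvHom.unary (fun t => (w (e.symm t)).op i) (e.symm.trans (φ.ord i))

/-- This computes one way around a naturality square in frames, and `Frame.mk_comp_hom` the other.
They produce the `lact` and the `ract` side of `Fwd.comm`. -/
theorem Frame.perm_comp_hom_comp (φ : Frame X c) {m : ℕ} {i j : I} (h : i ≤ j)
    {f : O.EnvHom (X.size j) m} {g : O.PreHom c m}
    (hg : (EnvHom.perm O (φ.ord j)).comp f = EnvHom.mk g) :
    (EnvHom.perm O (φ.ord i)).comp ((X.hom h).comp f) =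
      EnvHom.mk ⟨g.k, fun s => O.lact ((φ.v s).map h) (g.op s), g.e⟩ := by
  rw [← EnvHom.assoc, φ.perm_comp_hom h, EnvHom.unary_comp, hg, EnvHom.unary_comp_mk]
  exact congrArg EnvHom.mk (PreHom.ext_e fun _ _ => rfl)

theorem Frame.mk_comp_hom (ψ : Frame Y d) {k : Fin c → ℕ} {op : ∀ s, O.Op (k s)}
    {e : (Σ s, Fin (k s)) ≃ Fin d} {i j : I} (h : i ≤ j) :
    (EnvHom.mk ⟨k, op, e.trans (ψ.ord i)⟩).comp (Y.hom h) =
      EnvHom.mk ⟨k, fun s => O.ract (op s) fun r => (ψ.v (e ⟨s, r⟩)).map h,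
        e.trans (ψ.ord j)⟩ := by
  have : EnvHom.mk ⟨k, op, e.trans (ψ.ord i)⟩ =
    (EnvHom.mk ⟨k, op, e⟩).comp (EnvHom.perm O (ψ.ord i)) :=
    (EnvHom.mk_comp_perm ⟨k, op, e⟩ (ψ.ord i)).symm
  rw [this, EnvHom.assoc, ψ.perm_comp_hom h, EnvHom.mk_comp_unary]

/-- A `RightRep` demands one shape `(k, e)` for all rows, while representatives in different rows
are unrelated a priori. The shape of the bottom row is imposed on the others by the naturality
squares from `⊥`. -/
theorem exists_rightRep [OrderBot I] (φ : Frame X c) (ψ : Frame Y d) (f : X.F ⟶ Y.F) :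
    Nonempty (RightRep φ ψ f) := by
  choose g hg using fun i =>
    ((EnvHom.perm O (φ.ord i)).comp (Node.natHom f i)).exists_rep
  let e : (Σ s, Fin ((g ⊥).k s)) ≃ Fin d := (g ⊥).e.trans (ψ.ord ⊥).symm
  have he : (⟨(g ⊥).k, (g ⊥).op, e.trans (ψ.ord ⊥)⟩ : O.PreHom c (Y.size ⊥)) = g ⊥ :=
    PreHom.ext_e fun s r => (ψ.ord ⊥).apply_symm_apply _
  have hop : ∀ i, ∃ op : ∀ s, O.Op ((g ⊥).k s),
      (EnvHom.perm O (φ.ord i)).comp (Node.natHom f i) =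
        EnvHom.mk ⟨(g ⊥).k, op, e.trans (ψ.ord i)⟩ := by
    intro i
    have h := φ.perm_comp_hom_comp (bot_le : ⊥ ≤ i) (hg i)
    rw [Node.hom_comp_natHom, ← EnvHom.assoc, hg ⊥, ← he, ψ.mk_comp_hom] at h
    -- Only the labels matter here: `τ` matches the inputs in row `i` with those in the bottom row,
    -- and the operations in row `i` are relabelled along it.
    obtain ⟨τ, -, h'⟩ := EnvHom.exact h.symm
    exact ⟨fun s => O.relabel (τ s) ((g i).op s),
      (hg i).trans (EnvHom.sound ⟨τ, fun _ => rfl, h'⟩)⟩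
  choose op hop using hop
  refine ⟨⟨_, e, fun s => ⟨fun i => op i s, fun {i j} h => ?_⟩, hop⟩⟩
  -- With a common shape in all rows, `EnvHom.mk_inj` turns naturality into `Fwd.comm`.
  have h' := φ.perm_comp_hom_comp h (hop j)
  rw [Node.hom_comp_natHom, ← EnvHom.assoc, hop i, ψ.mk_comp_hom] at h'
  exact congrFun (EnvHom.mk_inj h') s

/-- Converse of `exists_rightRep`, needed for fullness. The component in each row is found by
cancelling the invertible `perm`, and naturality is `Fwd.comm` after the same cancellation. -/
theorem exists_hom_rightRep (φ : Frame X c) (ψ : Frame Y d) (k : Fin c → ℕ)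
    (e : (Σ s, Fin (k s)) ≃ Fin d) (x : ∀ s, Fwd (φ.v s) fun r : Fin (k s) => ψ.v (e ⟨s, r⟩)) :
    ∃ f : X.F ⟶ Y.F, ∀ i, (EnvHom.perm O (φ.ord i)).comp (Node.natHom f i) =
      EnvHom.mk ⟨k, fun s => (x s).op i, e.trans (ψ.ord i)⟩ := by
  obtain ⟨F, hF⟩ : ∃ F : ∀ i, O.EnvHom (X.size i) (Y.size i),
      ∀ i, (EnvHom.perm O (φ.ord i)).comp (F i) =
        EnvHom.mk ⟨k, fun s => (x s).op i, e.trans (ψ.ord i)⟩ :=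
    ⟨fun i => _, fun i => EnvHom.perm_comp_perm_symm_comp _ _⟩
  have hnat : ∀ {i j : I} (h : i ≤ j), (X.hom h).comp (F j) = (F i).comp (Y.hom h) := by
    intro i j h
    apply EnvHom.perm_comp_inj (φ.ord i)
    rw [φ.perm_comp_hom_comp h (hF j), ← EnvHom.assoc, hF, ψ.mk_comp_hom]
    simp only [(x _).comm]
  exact ⟨⟨F, fun i j h => hnat (leOfHom h)⟩, hF⟩

/-- Left-pointing arrows lie in `W`, so each row is given by unary operations and a permutation.
Comparing the two sides of a naturality square shows that this permutation, measured in the frames,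
is the same in all rows and that the operations satisfy `Bwd.comm`. -/
theorem exists_leftRep [OrderBot I] (φ : Frame X c) (ψ : Frame Y d) (f : Y.F ⟶ X.F)
    (hf : ∀ i, envSub W (f.app i)) : Nonempty (LeftRep φ ψ f) := by
  have hg : ∀ i, ∃ w : Fin d → O.Op 1, ∃ q : Fin d ≃ Fin c, (∀ s, w s ∈ W) ∧
      (EnvHom.perm O (ψ.ord i)).comp (Node.natHom f i) =
        EnvHom.unary w (q.trans (φ.ord i)) := fun i => by
    obtain ⟨w, p, hw, h⟩ := (envSub_iff (a := Y.size i) (b := X.size i) _).1 (hf i)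
    refine ⟨fun s => w (ψ.ord i s), ((ψ.ord i).trans p).trans (φ.ord i).symm, fun s => hw _, ?_⟩
    rw [show Node.natHom f i = _ from h, EnvHom.perm_comp_unary, Equiv.trans_assoc _ _ (φ.ord i),
      Equiv.symm_trans_self, Equiv.trans_refl]
  choose w q hw hg using hg
  have hnat : ∀ {i j : I} (h : i ≤ j),
      EnvHom.unary (fun s => w i s * (φ.v (q i s)).map h) ((q i).trans (φ.ord j)) =
      EnvHom.unary (fun s => (ψ.v s).map h * w j s) ((q j).trans (φ.ord j)) := fun {i j} h => by
    rw [← EnvHom.unary_comp_unary (w i) (q i) (fun t => (φ.v t).map h), ← φ.perm_comp_hom h, ← EnvHom.assoc,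
      EnvHom.unary_comp_perm, ← hg, EnvHom.assoc, ← Node.hom_comp_natHom, ← EnvHom.assoc,
      ψ.perm_comp_hom h, EnvHom.unary_comp, hg, EnvHom.unary_comp_unary]
    rfl
  have hq : ∀ i, q i = q ⊥ := fun i => by
    have := (EnvHom.unary_inj (hnat (bot_le : ⊥ ≤ i))).2
    ext1 s
    exact ((φ.ord i).injective (DFunLike.congr_fun this s)).symm
  refine ⟨⟨(q ⊥).symm, fun s => ⟨fun i => w i ((q ⊥).symm s), fun i => hw i _,
    fun {i j} h => ?_⟩, fun i => ?_⟩⟩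
  · have := congrFun (EnvHom.unary_inj (hnat h)).1 ((q ⊥).symm s)
    rw [hq i, Equiv.apply_symm_apply] at this
    exact this
  · rw [hg i, hq i]
    simp

theorem exists_hom_leftRep (φ : Frame X c) (ψ : Frame Y d) (e : Fin c ≃ Fin d)
    (w : ∀ s, Bwd (φ.v s) (ψ.v (e s))) :
    ∃ f : Y.F ⟶ X.F, (∀ i, envSub W (f.app i)) ∧
      ∀ i, (EnvHom.perm O (ψ.ord i)).comp (Node.natHom f i) =
        EnvHom.unary (fun t => (w (e.symm t)).op i) (e.symm.trans (φ.ord i)) := by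
  obtain ⟨F, hF⟩ : ∃ F : ∀ i, O.EnvHom (Y.size i) (X.size i),
      ∀ i, (EnvHom.perm O (ψ.ord i)).comp (F i) =
        EnvHom.unary (fun t => (w (e.symm t)).op i) (e.symm.trans (φ.ord i)) :=
    ⟨fun i => _, fun i => EnvHom.perm_comp_perm_symm_comp _ _⟩
  have hnat : ∀ {i j : I} (h : i ≤ j), (Y.hom h).comp (F j) = (F i).comp (X.hom h) := by
    intro i j h
    apply EnvHom.perm_comp_inj (ψ.ord i)
    rw [← EnvHom.assoc, ψ.perm_comp_hom, ← EnvHom.assoc, hF,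
      ← EnvHom.unary_comp_perm _ e.symm, EnvHom.assoc, φ.perm_comp_hom, EnvHom.unary_comp, hF,
      EnvHom.unary_comp_unary, EnvHom.unary_comp_unary]
    refine congrArg (fun w => EnvHom.unary w _) (funext fun t => ?_)
    have := (w (e.symm t)).comm h
    simp only [Equiv.apply_symm_apply] at this
    exact this.symm
  refine ⟨⟨F, fun i j h => hnat (leOfHom h)⟩, fun i => ?_, hF⟩
  exact (envSub_iff (a := Y.size i) (b := X.size i) _).2
    ⟨_, _, fun s => (w _).mem i, ((EnvHom.perm_symm_comp_perm_comp (ψ.ord i) (F i)).symm.trans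
      (congrArg _ (hF i))).trans (EnvHom.perm_comp_unary _ _ _)⟩

end Reps

end Frames

/-! ### Uniqueness of unfolding up to tree reduction -/

section Unfolding

variable {O : SymOperad.{u}} {W : Submonoid (O.Op 1)} {I : Type} [Preorder I] {L : Type}

namespace Tree

/-- A form of `Red.planar` in which the children are drawn from one family `T` through index maps
`E` and `E'`. Children in different orders can then be compared without transporting trees along
equalities of nodes. -/
theorem red_fwd_of_relabel {D : Type} {n m : ℕ} {v : Vert W I} {u : D → Vert W I}
    (T : ∀ t, Tree W I L (u t)) {E : Fin n → D} {E' : Fin m → D} (τ : Fin n ≃ Fin m)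
    (hE : ∀ q, E' (τ q) = E q) (x : Fwd v fun q => u (E q)) (x' : Fwd v fun q => u (E' q))
    (h : ∀ i, x'.op i = O.relabel τ (x.op i)) :
    Red (fwd x fun q => T (E q)) (fwd x' fun q => T (E' q)) := by
  obtain rfl : E = fun q => E' (τ q) := funext fun q => (hE q).symm
  obtain rfl : x' = Fwd.relabel (u := fun q => u (E' q)) τ x := Fwd.ext (funext h)
  exact Red.planar (u := fun q => u (E' q)) τ x fun q => T (E' q)

theorem bwd_eq_of_op_eq {D : Type} {v : Vert W I} {u : D → Vert W I}
    (T : ∀ t, Tree W I L (u t)) {E E' : D} (hE : E' = E) (w : Bwd v (u E)) (w' : Bwd v (u E'))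
    (h : ∀ i, w'.op i = w.op i) : bwd w (T E) = bwd w' (T E') := by
  subst hE
  obtain rfl : w' = w := Bwd.ext (funext h)
  rfl

theorem cast_leaf {v v' : Vert W I} (h : v = v') (hv : v = Vert.const W I) (l : L) :
    (leaf hv l : Tree W I L v).cast h = leaf (h.symm.trans hv) l := by
  subst h; rfl

end Tree

open TreeHammock.Tree

variable {X Y Z : Node (envSub W) I} {c c' d d' m : ℕ}

/-- Two splittings of one column, in frames differing by reorderings, represent the same morphism in
each row. They therefore differ by permutations of the inputs of the pieces. -/
theorem RightRep.red [OrderBot I] {φ : Frame X c} {ψ : Frame Y d} {f : X.F ⟶ Y.F}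
    {σ : Fin c' ≃ Fin c} {ρ : Fin d' ≃ Fin d} (r : RightRep (φ.reindex σ) (ψ.reindex ρ) f)
    (r' : RightRep φ ψ f) (T : ∀ t, Tree W I L (ψ.v t)) (s : Fin c') :
    Red (fwd (r.x s) fun q => T (ρ (r.e ⟨s, q⟩)))
      (fwd (r'.x (σ s)) fun q => T (r'.e ⟨σ s, q⟩)) := by
  have h : ∀ i, EnvHom.mk ⟨r.k, fun s => (r.x s).op i, r.e.trans ((ψ.reindex ρ).ord i)⟩ =
      EnvHom.mk (PreHom.reindex σ ⟨r'.k, fun s => (r'.x s).op i, r'.e.trans (ψ.ord i)⟩) := by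
    intro i
    rw [← r.app, ← EnvHom.perm_comp_mk, ← r'.app, ← EnvHom.assoc, EnvHom.perm_comp_perm]
    rfl
  choose τ hτ hτ' using fun i => EnvHom.exact (h i)
  have he : ∀ i q, r'.e ⟨σ s, τ i s q⟩ = ρ (r.e ⟨s, q⟩) := fun i q =>
    (ψ.ord i).injective (hτ' i s q)
  refine red_fwd_of_relabel T (E := fun q => ρ (r.e ⟨s, q⟩)) (τ ⊥ s) (he ⊥) _ _ fun i => ?_
  refine (hτ i s).trans (relabel_congr (Equiv.ext fun q => ?_) _)
  -- The permutation is obtained row by row, but `Red.planar` needs a single one. Each `τ i` is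
  -- pinned down by the labellings, which do not depend on the row.
  exact eq_of_heq (Sigma.mk.inj_iff.1 (r'.e.injective ((he i q).trans (he ⊥ q).symm))).2

/-- Equality instead of reduction, since a piece `W_1` has a single input and leaves nothing to
reorder. -/
theorem LeftRep.bwd_eq [OrderBot I] {φ : Frame X c} {ψ : Frame Y d} {f : Y.F ⟶ X.F}
    {σ : Fin c' ≃ Fin c} {ρ : Fin d' ≃ Fin d} (r : LeftRep (φ.reindex σ) (ψ.reindex ρ) f)
    (r' : LeftRep φ ψ f) (T : ∀ t, Tree W I L (ψ.v t)) (s : Fin c') :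
    bwd (r.w s) (T (ρ (r.e s))) = bwd (r'.w (σ s)) (T (r'.e (σ s))) := by
  have h : ∀ i, EnvHom.unary (fun t => (r.w (r.e.symm t)).op i)
      (r.e.symm.trans ((φ.reindex σ).ord i)) =
      EnvHom.unary (fun t => (r'.w (r'.e.symm (ρ t))).op i)
        (ρ.trans (r'.e.symm.trans (φ.ord i))) := by
    intro i
    rw [← r.app, ← EnvHom.perm_comp_unary ρ (fun t => (r'.w (r'.e.symm t)).op i), ← r'.app,
      ← EnvHom.assoc, EnvHom.perm_comp_perm]
    rfl
  have he : σ s = r'.e.symm (ρ (r.e s)) := by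
    have := (φ.ord ⊥).injective (DFunLike.congr_fun (EnvHom.unary_inj (h ⊥)).2 (r.e s))
    simpa using this
  refine bwd_eq_of_op_eq T (by rw [he, Equiv.apply_symm_apply]) _ _ fun i => ?_
  have := congrFun (EnvHom.unary_inj (h i)).1 (r.e s)
  rw [← he] at this
  exact this.symm.trans (congrArg (fun t => (r.w t).op i) (r.e.symm_apply_apply s))

/-- Composition of columns of arrows pointing to the right. -/
def RightRep.comp {φ : Frame X c} {ψ : Frame Y d} {χ : Frame Z m} {f : X.F ⟶ Y.F}
    {g : Y.F ⟶ Z.F} (r : RightRep φ ψ f) (r' : RightRep ψ χ g) : RightRep φ χ (f ≫ g) where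
  k s := ∑ q, r'.k (r.e ⟨s, q⟩)
  e := (Equiv.sigmaCongrRight fun _ => finSigmaFinEquiv.symm).trans
    ((Equiv.sigmaAssoc fun i s => Fin (r'.k (r.e ⟨i, s⟩))).symm.trans
      ((Equiv.sigmaCongrLeft (β := fun t => Fin (r'.k t)) r.e).trans r'.e))
  x s := (r.x s).comp (z := fun p : Σ q, Fin (r'.k (r.e ⟨s, q⟩)) =>
    χ.v (r'.e ⟨r.e ⟨s, p.1⟩, p.2⟩)) fun q => r'.x (r.e ⟨s, q⟩)
  app i := by
    have h : EnvHom.mk ⟨r.k, fun s => (r.x s).op i, r.e.trans (ψ.ord i)⟩ =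
        (EnvHom.mk ⟨r.k, fun s => (r.x s).op i, r.e⟩).comp (EnvHom.perm O (ψ.ord i)) :=
      (EnvHom.mk_comp_perm ⟨r.k, fun s => (r.x s).op i, r.e⟩ (ψ.ord i)).symm
    have h' : Node.natHom (f ≫ g) i = (Node.natHom f i).comp (Node.natHom g i) := rfl
    rw [h', ← EnvHom.assoc, r.app, h, EnvHom.assoc, r'.app, EnvHom.mk_comp_mk]
    exact congrArg EnvHom.mk (PreHom.ext_e fun _ _ => rfl)

/-- The column of identities pointing to the right. -/
def RightRep.id (φ : Frame X c) : RightRep φ φ (𝟙 X.F) where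
  k _ := 1
  e := Equiv.sigmaUnique _ _
  x s := Fwd.id (φ.v s)
  app i := (EnvHom.mk_comp_mk _ (PreHom.id O _)).trans
    (EnvHom.sound (PreHom.comp_id_rel ⟨fun _ => 1, fun _ => O.one,
      (Equiv.sigmaUnique (Fin c) fun _ => Fin 1).trans (φ.ord i)⟩))

/-- Composition of columns of arrows pointing to the left. -/
def LeftRep.comp {φ : Frame X c} {ψ : Frame Y d} {χ : Frame Z m} {f : Y.F ⟶ X.F}
    {g : Z.F ⟶ Y.F} (r : LeftRep φ ψ f) (r' : LeftRep ψ χ g) : LeftRep φ χ (g ≫ f) where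
  e := r.e.trans r'.e
  w s := (r.w s).comp (r'.w (r.e s))
  app i := by
    have h' : Node.natHom (g ≫ f) i = (Node.natHom g i).comp (Node.natHom f i) := rfl
    rw [h', ← EnvHom.assoc, r'.app, ← EnvHom.unary_comp_perm, EnvHom.assoc, r.app,
      EnvHom.unary_comp_unary]
    refine congrArg₂ EnvHom.unary (funext fun t => ?_) rfl
    exact congrArg (· * (r.w (r.e.symm (r'.e.symm t))).op i)
      (congrArg (fun t => (r'.w t).op i) (r.e.apply_symm_apply (r'.e.symm t)).symm)

/-- The column of identities pointing to the left. -/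
def LeftRep.id (φ : Frame X c) : LeftRep φ φ (𝟙 X.F) where
  e := Equiv.refl _
  w s := Bwd.id (φ.v s)
  app i := (EnvHom.mk_comp_mk _ (PreHom.id O _)).trans
    (EnvHom.sound (PreHom.comp_id_rel ⟨fun _ => 1, fun _ => O.one,
      (Equiv.sigmaUnique (Fin c) fun _ => Fin 1).trans (φ.ord i)⟩))

variable [OrderBot I]

/-- The trees into which a hammock unfolds, in terms of the canonical frames of its columns. -/
noncomputable def unfold : ∀ {X Z : Node (envSub W) I}, Hammock (envSub W) I X Z →
    (∀ s, (canonFrame Z).v s = Vert.const W I) →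
    ∀ s, Tree W I (Fin (Z.size ⊥)) ((canonFrame X).v s)
  | _, _, .nil _, hZ, s => .leaf (hZ s) s
  | X, _, .right (Y := Y) f h, hZ, s =>
    let r := (exists_rightRep (canonFrame X) (canonFrame Y) f).some
    .fwd (r.x s) fun q => unfold h hZ (r.e ⟨s, q⟩)
  | X, _, .left (Y := Y) f hf h, hZ, s =>
    let r := (exists_leftRep (canonFrame X) (canonFrame Y) f hf).some
    .bwd (r.w s) (unfold h hZ (r.e s))

/-- Frees `unfold` from its choices: any splitting of the first column, in any reordered frames, may
replace the chosen one. -/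
theorem unfold_right (f : X.F ⟶ Y.F) (h : Hammock (envSub W) I Y Z)
    (hZ : ∀ s, (canonFrame Z).v s = Vert.const W I)
    {σ : Fin c ≃ Fin (X.size ⊥)} {ρ : Fin d ≃ Fin (Y.size ⊥)}
    (r : RightRep ((canonFrame X).reindex σ) ((canonFrame Y).reindex ρ) f) (s : Fin c) :
    Red (fwd (r.x s) fun q => unfold h hZ (ρ (r.e ⟨s, q⟩))) (unfold (.right f h) hZ (σ s)) :=
  r.red _ _ s

theorem unfold_left (f : Y.F ⟶ X.F) (hf : ∀ i, envSub W (f.app i))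
    (h : Hammock (envSub W) I Y Z) (hZ : ∀ s, (canonFrame Z).v s = Vert.const W I)
    {σ : Fin c ≃ Fin (X.size ⊥)} {ρ : Fin d ≃ Fin (Y.size ⊥)}
    (r : LeftRep ((canonFrame X).reindex σ) ((canonFrame Y).reindex ρ) f) (s : Fin c) :
    Red (bwd (r.w s) (unfold h hZ (ρ (r.e s)))) (unfold (.left f hf h) hZ (σ s)) :=
  Eq.subst (motive := Red _) (r.bwd_eq _ _ s) (Red.refl _)

/-- Composites of splittings split composite columns, and identity pieces split identity columns. So
each generating reduction of hammocks becomes the corresponding tree reduction, followed or preceded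
by a change of splitting. -/
theorem unfold_red {h h' : Hammock (envSub W) I X Z} (r : Hammock.Red h h')
    (hZ : ∀ s, (canonFrame Z).v s = Vert.const W I) (s : Fin (X.size ⊥)) :
    Red (unfold h hZ s) (unfold h' hZ s) := by
  induction r with
  | @right_right X Y Y' Z f g h =>
    let r := (exists_rightRep (canonFrame X) (canonFrame Y) f).some
    let r' := (exists_rightRep (canonFrame Y) (canonFrame Y') g).some
    exact (Red.fwd_fwd (z := fun p : Σ q, Fin (r'.k (r.e ⟨s, q⟩)) =>
      (canonFrame Y').v (r'.e ⟨r.e ⟨s, p.1⟩, p.2⟩)) (r.x s) (fun q => r'.x (r.e ⟨s, q⟩))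
      fun p => unfold h hZ (r'.e ⟨r.e ⟨s, p.1⟩, p.2⟩)).trans
      (unfold_right (σ := Equiv.refl _) (ρ := Equiv.refl _) _ _ hZ (r.comp r') s)
  | @left_left X Y Y' Z f hf g hg h =>
    let r := (exists_leftRep (canonFrame X) (canonFrame Y) f hf).some
    let r' := (exists_leftRep (canonFrame Y) (canonFrame Y') g hg).some
    exact (Red.bwd_bwd (r.w s) (r'.w (r.e s)) (unfold h hZ (r'.e (r.e s)))).trans
      (unfold_left (σ := Equiv.refl _) (ρ := Equiv.refl _) _ _ _ hZ (r.comp r') s)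
  | @right_id X Z h =>
    exact (unfold_right (σ := Equiv.refl _) (ρ := Equiv.refl _) _ h hZ
      (RightRep.id (canonFrame X)) s).symm.trans (Red.fwd_id (unfold h hZ s))
  | @left_id X Z h =>
    exact (unfold_left (σ := Equiv.refl _) (ρ := Equiv.refl _) _ _ h hZ
      (LeftRep.id (canonFrame X)) s).symm.trans (Red.bwd_id (unfold h hZ s))
  | right_congr f _ ih => exact Red.fwd_congr _ fun q => ih hZ _
  | left_congr f hf _ ih => exact Red.bwd_congr _ (ih hZ _)
  | refl h => exact .refl _
  | symm _ ih => exact (ih hZ s).symm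
  | trans _ _ ih ih' => exact (ih hZ s).trans (ih' hZ s)

theorem canonFrame_const_v (b : ℕ) (s : Fin b) :
    (canonFrame (Node.const (envSub W) I (Env.of O b))).v s = Vert.const W I :=
  congrArg (fun φ : Frame (Node.const (envSub W) I (Env.of O b)) b => φ.v s) (canonFrame_const b)

/-- `Unfolds` allows arbitrary frames in the intermediate columns; each is a reordering of the
canonical one, so `unfold_right` and `unfold_left` apply column by column. The frame enters through
the equation `hφ`, so that the indices in the induction remain variables. -/
theorem Unfolds.red_unfold {b : ℕ} {φ : Frame X c}
    {h : Hammock (envSub W) I X (Node.const (envSub W) I (Env.of O b))}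
    {T : ∀ s, Tree W I (Fin b) (φ.v s)} (H : Unfolds φ h T) (σ : Fin c ≃ Fin (X.size ⊥))
    (hφ : φ = (canonFrame X).reindex σ) (hv : ∀ s, φ.v s = (canonFrame X).v (σ s)) (s : Fin c) :
    Red ((T s).cast (hv s)) (unfold h (canonFrame_const_v b) (σ s)) := by
  induction H with
  | nil =>
    -- The empty unfolding uses the standard frame of a constant column, which agrees with the
    -- canonical frame in the bottom row; hence no reordering takes place.
    have : σ s = s := by
      have h := congrArg (fun φ : Frame _ _ => φ.ord ⊥ s) hφ
      refine Eq.trans ?_ h.symm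
      exact (DFunLike.congr_fun (canonFrame_ord_bot
        (Node.const (envSub W) I (Env.of O b))) (σ s)).symm
    refine Eq.subst (motive := fun t => Red t _) (cast_leaf (hv s) rfl s).symm ?_
    exact Eq.subst (motive := fun l => Red (leaf _ l) _) this (Red.refl _)
  | @right X Y c d φ ψ f h T k e x hf _ ih =>
    subst hφ
    obtain ⟨ρ, rfl⟩ : ∃ ρ, ψ = (canonFrame Y).reindex ρ := ⟨_, ψ.eq_reindex⟩
    exact (Red.fwd_congr (x s) fun q => ih ρ rfl (fun _ => rfl) _).trans
      (unfold_right f h _ ⟨k, e, x, hf⟩ s)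
  | @left X Y c d φ ψ f hf h T e w hw _ ih =>
    subst hφ
    obtain ⟨ρ, rfl⟩ : ∃ ρ, ψ = (canonFrame Y).reindex ρ := ⟨_, ψ.eq_reindex⟩
    exact (Red.bwd_congr (w s) (ih ρ rfl (fun _ => rfl) _)).trans
      (unfold_left f hf h _ ⟨e, w, hw⟩ s)

theorem Unfolds.red_of_red {b : ℕ} {φ : Frame X c}
    {h h' : Hammock (envSub W) I X (Node.const (envSub W) I (Env.of O b))}
    {T T' : ∀ s, Tree W I (Fin b) (φ.v s)} (H : Unfolds φ h T) (H' : Unfolds φ h' T')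
    (r : Hammock.Red h h') (s : Fin c) : Red (T s) (T' s) := by
  obtain ⟨σ, rfl⟩ : ∃ σ, φ = (canonFrame X).reindex σ := ⟨_, φ.eq_reindex⟩
  exact ((H.red_unfold σ rfl (fun _ => rfl) s).trans (unfold_red r _ _)).trans
    (H'.red_unfold σ rfl (fun _ => rfl) s).symm

end Unfolding

/-! ### From labelled trees to morphisms; hammock reduction -/

section Forests

variable {O : SymOperad.{u}} {W : Submonoid (O.Op 1)} {I : Type} [Preorder I] {L L' : Type}

namespace Tree

/-- All labels of leaves satisfy `P`. -/
def All (P : L → Prop) : ∀ {v : Vert W I}, Tree W I L v → Prop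
  | _, leaf _ l => P l
  | _, fwd _ c => ∀ s, (c s).All P
  | _, bwd _ c => c.All P

/-- Changing the labels of the leaves by a partially defined function. -/
def pmap {P : L → Prop} (g : ∀ l, P l → L') :
    ∀ {v : Vert W I} (t : Tree W I L v), t.All P → Tree W I L' v
  | _, leaf hv l, h => leaf hv (g l h)
  | _, fwd x c, h => fwd x fun s => (c s).pmap g (h s)
  | _, bwd w c, h => bwd w (c.pmap g h)

/-- Tree reduction rearranges, composes and deletes pieces, but never changes which labels occur at
the leaves. -/
theorem Red.all_iff {P : L → Prop} {v : Vert W I} {t t' : Tree W I L v} (r : Red t t') :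
    t.All P ↔ t'.All P := by
  induction r with
  | planar σ x c => exact σ.forall_congr_right (q := fun s => (c s).All P)
  | fwd_fwd x y c =>
    exact Sigma.forall.symm.trans
      (finSigmaFinEquiv.symm.forall_congr_right (q := fun p => (c p).All P)).symm
  | fwd_id c => exact ⟨fun h => h 0, fun h _ => h⟩
  | bwd_bwd w w' c => exact Iff.rfl
  | bwd_id c => exact Iff.rfl
  | fwd_congr x _ ih => exact forall_congr' ih
  | bwd_congr w _ ih => exact ih
  | refl t => exact Iff.rfl
  | symm _ ih => exact ih.symm
  | trans _ _ ih ih' => exact ih.trans ih'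

/-- A chain of reductions passes through intermediate trees; `Red.all_iff` guarantees that the
partial relabelling is defined on them too. -/
theorem Red.pmap {P : L → Prop} (g : ∀ l, P l → L') {v : Vert W I} {t t' : Tree W I L v}
    (r : Red t t') (h : t.All P) (h' : t'.All P) : Red (t.pmap g h) (t'.pmap g h') := by
  induction r with
  | planar σ x c => exact planar σ x fun s => (c s).pmap g (h' s)
  | fwd_fwd x y c =>
    have hc : ∀ p, (c p).All P := fun p => (h : ∀ s q, (c ⟨s, q⟩).All P) p.1 p.2
    exact fwd_fwd x y fun p => (c p).pmap g (hc p)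
  | fwd_id c => exact fwd_id (c.pmap g h')
  | bwd_bwd w w' c => exact bwd_bwd w w' _
  | bwd_id c => exact bwd_id _
  | fwd_congr x _ ih => exact fwd_congr x fun s => ih s _ _
  | bwd_congr w _ ih => exact bwd_congr w (ih _ _)
  | refl t => exact refl _
  | symm _ ih => exact symm (ih _ _)
  | trans r _ ih ih' => exact trans (ih h (r.all_iff.1 h)) (ih' _ h')

theorem all_relabel {P : L' → Prop} (f : L → L') {v : Vert W I} (t : Tree W I L v) :
    (t.relabel f).All P ↔ t.All fun l => P (f l) := by
  induction t with
  | leaf hv l => exact Iff.rfl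
  | fwd x c ih => exact forall_congr' ih
  | bwd w c ih => exact ih

theorem all_of_forall {P : L → Prop} (h : ∀ l, P l) {v : Vert W I} (t : Tree W I L v) :
    t.All P := by
  induction t with
  | leaf hv l => exact h l
  | fwd x c ih => exact ih
  | bwd w c ih => exact ih

theorem All.of_count [DecidableEq L] {P : L → Prop} {v : Vert W I} {t : Tree W I L v}
    (h : t.All P) {l : L} (hl : t.count l ≠ 0) : P l := by
  induction t with
  | leaf hv l' =>
    obtain rfl : l' = l := by simpa [count] using hl
    exact h
  | fwd x c ih =>
    obtain ⟨s, -, hs⟩ := Finset.exists_ne_zero_of_sum_ne_zero hl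
    exact ih s (h s) hs
  | bwd w c ih => exact ih h hl

theorem all_of_count [DecidableEq L] {P : L → Prop} {v : Vert W I} {t : Tree W I L v}
    (h : ∀ l, t.count l ≠ 0 → P l) : t.All P := by
  induction t with
  | leaf hv l => exact h l (by simp [count])
  | fwd x c ih =>
    refine fun s => ih s fun l hl => h l fun h0 => hl ?_
    exact Finset.sum_eq_zero_iff.1 h0 s (Finset.mem_univ s)
  | bwd w c ih => exact ih h

theorem pmap_relabel {L'' : Type} {P : L' → Prop} (g : ∀ l, P l → L'') (f : L → L')
    (f' : L → L'') (hf : ∀ l h, g (f l) h = f' l) {v : Vert W I} (t : Tree W I L v)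
    (h : (t.relabel f).All P) : (t.relabel f).pmap g h = t.relabel f' := by
  induction t with
  | leaf hv l => exact congrArg (leaf hv) (hf l h)
  | fwd x c ih => exact congrArg (fwd x) (funext fun s => ih s (h s))
  | bwd w c ih => exact congrArg (bwd w) (ih h)

theorem relabel_pmap {P : L → Prop} (g : ∀ l, P l → L') (f : L' → L)
    (hf : ∀ l h, f (g l h) = l) {v : Vert W I} (t : Tree W I L v) (h : t.All P) :
    (t.pmap g h).relabel f = t := by
  induction t with
  | leaf hv l => exact congrArg (leaf hv) (hf l h)
  | fwd x c ih => exact congrArg (fwd x) (funext fun s => ih s (h s))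
  | bwd w c ih => exact congrArg (bwd w) (ih h)

theorem count_relabel_of_injective [DecidableEq L] [DecidableEq L'] {f : L → L'}
    (hf : f.Injective) (l : L) {v : Vert W I} (t : Tree W I L v) :
    (t.relabel f).count (f l) = t.count l := by
  induction t with
  | leaf hv l => simp [relabel, count, hf.eq_iff]
  | fwd x c ih => simp only [relabel, count, ih]
  | bwd w c ih => simp only [relabel, count, ih]

end Tree

open TreeHammock.Tree

variable {a b c : ℕ}

theorem Forest.exists_label {F F' : Forest W I a b} {i : Fin a}
    (h : Red (F.tree i) (F'.tree i)) (l : Fin (F'.k i)) : ∃ l', F.e ⟨i, l'⟩ = F'.e ⟨i, l⟩ := by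
  have h1 : (F.tree i).All fun m => ∃ l', F.e ⟨i, l'⟩ = m :=
    (all_relabel _ _).2 (all_of_forall (fun l => ⟨l, rfl⟩) _)
  exact ((all_relabel _ _).1 (h.all_iff.1 h1)).of_count (l := l) (by rw [(F'.t i).2 l]; simp)

/-- Reductions are known for trees labelled in `Fin b`, whereas the operad uses trees labelled in
`Fin (k i)`, possibly numbered differently in `F` and `F'`. Corresponding trees carry the same
labels, and matching leaves by label gives the permutations that identify the representatives. -/
theorem Forest.reduce_eq_of_red {F F' : Forest W I a b}
    (h : ∀ i, Red (F.tree i) (F'.tree i)) : F.reduce = F'.reduce := by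
  choose g hg using fun i => Forest.exists_label (h i)
  choose g' hg' using fun i => Forest.exists_label (h i).symm
  let τ (i : Fin a) : Fin (F.k i) ≃ Fin (F'.k i) :=
    { toFun := g' i
      invFun := g i
      left_inv := fun l => by simpa using F.e.injective ((hg i (g' i l)).trans (hg' i l))
      right_inv := fun l => by simpa using F'.e.injective ((hg' i (g i l)).trans (hg i l)) }
  refine EnvHom.sound ⟨τ, fun i => ?_, hg'⟩
  refine Quotient.sound (s := Tree.setoid W I _) ?_
  have hF' : (F'.tree i).All fun m => ∃ l', F'.e ⟨i, l'⟩ = m :=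
    (all_relabel _ _).2 (all_of_forall (fun l => ⟨l, rfl⟩) _)
  -- Relabelling by the partial inverse of `F'.e ⟨i, ·⟩` recovers `F'.t i` from one side, and turns
  -- the other side into `F.t i` relabelled by `τ i`.
  have r := (h i).symm.pmap (fun _ h => h.choose) hF' ((h i).all_iff.2 hF')
  have hinj : ∀ l (h : ∃ l', F'.e ⟨i, l'⟩ = F'.e ⟨i, l⟩), h.choose = l := fun l h => by simp
  have e1 := pmap_relabel (fun _ (h : ∃ l', F'.e ⟨i, l'⟩ = _) => h.choose)
    (fun l => F'.e ⟨i, l⟩) (fun l => l) hinj (F'.t i).1 hF'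
  have e2 := pmap_relabel (fun _ (h : ∃ l', F'.e ⟨i, l'⟩ = _) => h.choose)
    (fun l => F.e ⟨i, l⟩) (τ i) (fun l h => eq_of_heq (Sigma.mk.inj_iff.1
      (F'.e.injective (h.choose_spec.trans (hg' i l).symm))).2) (F.t i).1
    ((h i).all_iff.2 hF')
  rw [relabel_id] at e1
  exact Eq.subst (motive := fun t => Red t _) e1 (Eq.subst (motive := Red _) e2 r)

/-- Each label occurs once in the whole family, so the labels are partitioned according to the trees
containing them. Numbering each part by `ε i` produces bijectively labelled trees. -/
theorem exists_forest (T : Fin a → Tree W I (Fin b) (Vert.const W I))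
    (hT : ∀ l, ∑ i, (T i).count l = 1) : ∃ F : Forest W I a b, F.tree = T := by
  have hle : ∀ i l, (T i).count l ≤ 1 := fun i l => (hT l).symm ▸
    Finset.single_le_sum (f := fun i => (T i).count l) (fun _ _ => Nat.zero_le _)
      (Finset.mem_univ i)
  let ε (i : Fin a) := Fintype.equivFin {l // (T i).count l ≠ 0}
  let f (i : Fin a) (q : Fin (Fintype.card {l // (T i).count l ≠ 0})) : Fin b := ((ε i).symm q).1
  have hf : ∀ i, (f i).Injective := fun i =>
    Subtype.val_injective.comp (ε i).symm.injective
  let t (i : Fin a) := (T i).pmap (fun l h => ε i ⟨l, h⟩) (all_of_count fun l h => h)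
  have ht : ∀ i, (t i).relabel (f i) = T i := fun i =>
    relabel_pmap _ _ (fun l h => by simp [f]) _ _
  have hq : ∀ i q, (t i).count q = 1 := fun i q => by
    rw [← count_relabel_of_injective (hf i), ht]
    have : (T i).count (f i q) ≠ 0 := ((ε i).symm q).2
    have := hle i (f i q)
    omega
  refine ⟨⟨fun i => Fintype.card {l // (T i).count l ≠ 0}, fun i => ⟨t i, hq i⟩, Equiv.ofBijective (fun p => f p.1 p.2)
    ⟨fun p p' h => ?_, fun l => ?_⟩⟩, funext ht⟩
  · obtain ⟨i, q⟩ := p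
    obtain ⟨i', q'⟩ := p'
    have hi : i = i' := by
      by_contra hne
      have h1 : (T i).count (f i q) ≠ 0 := ((ε i).symm q).2
      have h2 : (T i').count (f i q) ≠ 0 := by
        rw [show f i q = f i' q' from h]
        exact ((ε i').symm q').2
      -- A label shared by two different trees would contribute at least two to a sum equal to one.
      have h3 := Finset.sum_le_sum_of_subset (f := fun m => (T m).count (f i q))
        (Finset.subset_univ {i, i'})
      rw [Finset.sum_pair hne, hT] at h3
      omega
    subst hi
    exact congrArg (Sigma.mk i) (hf i h)
  · obtain ⟨i, -, hi⟩ := Finset.exists_ne_zero_of_sum_ne_zero ((hT l).trans_ne one_ne_zero)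
    exact ⟨⟨i, ε i ⟨l, hi⟩⟩, by simp [f]⟩

/-- The incidence `e` of each column is a bijection, so passing one column back only regroups the
subtrees; the count starts at the last column with each label once. -/
theorem Unfolds.count {X : Node (envSub W) I} {φ : Frame X c}
    {h : Hammock (envSub W) I X (Node.const (envSub W) I (Env.of O b))}
    {T : ∀ s, Tree W I (Fin b) (φ.v s)} (H : Unfolds φ h T) (l : Fin b) :
    ∑ s, (T s).count l = 1 := by
  induction H with
  | nil => simp [Tree.count]
  | right φ ψ f h T k e x hf _ ih =>
    simp only [Tree.count]
    rw [← Fintype.sum_sigma' fun s q => (T (e ⟨s, q⟩)).count l, ← ih]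
    exact e.sum_comp fun t => (T t).count l
  | left φ ψ f hf h T e w hw _ ih =>
    simp only [Tree.count]
    rw [← ih]
    exact e.sum_comp fun t => (T t).count l

variable [OrderBot I]

theorem Unfolds.exists_right {X Y : Node (envSub W) I} {d : ℕ} (φ : Frame X c) {ψ : Frame Y d}
    (f : X.F ⟶ Y.F) {h : Hammock (envSub W) I Y (Node.const (envSub W) I (Env.of O b))}
    {T : ∀ s, Tree W I (Fin b) (ψ.v s)} (H : Unfolds ψ h T) : ∃ T', Unfolds φ (.right f h) T' :=
  let ⟨r⟩ := exists_rightRep φ ψ f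
  ⟨_, .right φ ψ f h T r.k r.e r.x r.app H⟩

theorem Unfolds.exists_left {X Y : Node (envSub W) I} {d : ℕ} (φ : Frame X c) {ψ : Frame Y d}
    (f : Y.F ⟶ X.F) (hf : ∀ i, envSub W (f.app i))
    {h : Hammock (envSub W) I Y (Node.const (envSub W) I (Env.of O b))}
    {T : ∀ s, Tree W I (Fin b) (ψ.v s)} (H : Unfolds ψ h T) : ∃ T', Unfolds φ (.left f hf h) T' :=
  let ⟨r⟩ := exists_leftRep φ ψ f hf
  ⟨_, .left φ ψ f hf h T r.e r.w r.app H⟩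

theorem Hammock.exists_frame_unfolds {X Z : Node (envSub W) I} (h : Hammock (envSub W) I X Z)
    (hZ : Z = Node.const (envSub W) I (Env.of O b)) :
    ∃ (c : ℕ) (φ : Frame X c) (T : _), Unfolds φ (h.cast rfl hZ) T := by
  induction h with
  | nil X =>
    subst hZ
    exact ⟨b, _, _, .nil⟩
  | right f h ih =>
    obtain ⟨c, ψ, T, H⟩ := ih hZ
    subst hZ
    exact ⟨_, canonFrame _, H.exists_right _ f⟩
  | left f hf h ih =>
    obtain ⟨c, ψ, T, H⟩ := ih hZ
    subst hZ
    exact ⟨_, canonFrame _, H.exists_left _ f hf⟩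

/-- Frames are prescribed at both ends. The two prescriptions meet only in the empty hammock, where
they coincide; otherwise the frame of the first column can be chosen freely when splitting the first
column of arrows. -/
theorem Hammock.exists_unfolds {X Z : Node (envSub W) I} (h : Hammock (envSub W) I X Z)
    (hX : X = Node.const (envSub W) I (Env.of O a))
    (hZ : Z = Node.const (envSub W) I (Env.of O b)) :
    ∃ T, Unfolds (Frame.const W I a) (h.cast hX hZ) T := by
  cases h with
  | nil X =>
    subst hX
    obtain rfl : a = b := congrArg (fun X : Node (envSub W) I => X.size ⊥) hZ
    exact ⟨_, .nil⟩
  | right f h =>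
    obtain ⟨c, ψ, T, H⟩ := h.exists_frame_unfolds hZ
    subst hX hZ
    exact H.exists_right _ f
  | left f hf h =>
    obtain ⟨c, ψ, T, H⟩ := h.exists_frame_unfolds hZ
    subst hX hZ
    exact H.exists_left _ f hf

theorem Hammock.exists_forest
    (h : Hammock (envSub W) I (Node.const (envSub W) I (Env.of O a))
      (Node.const (envSub W) I (Env.of O b))) :
    ∃ F : Forest W I a b, Unfolds (Frame.const W I a) h F.tree := by
  obtain ⟨T, H⟩ := h.exists_unfolds rfl rfl
  obtain ⟨F, rfl⟩ := TreeHammock.exists_forest T H.count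
  exact ⟨F, H⟩

/-- Hammock reduction. -/
noncomputable def hammockReduction (W : Submonoid (O.Op 1)) (I : Type) [Preorder I] [OrderBot I]
    (a b : ℕ) (x : EnvHammock W I a b) : (treeLoc W I).EnvHom a b :=
  Quotient.lift (s := Hammock.setoid (envSub W) I _ _)
    (fun h => (Hammock.exists_forest (a := a) (b := b) h).choose.reduce)
    (fun h h' r => Forest.reduce_eq_of_red fun i =>
      (Hammock.exists_forest (a := a) (b := b) h).choose_spec.red_of_red
        (Hammock.exists_forest (a := a) (b := b) h').choose_spec r i) x

theorem hammockReduction_mk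
    {h : Hammock (envSub W) I (Node.const (envSub W) I (Env.of O a))
      (Node.const (envSub W) I (Env.of O b))} {F : Forest W I a b}
    (H : Unfolds (Frame.const W I a) h F.tree) :
    hammockReduction W I a b (HammockHom.mk h) = F.reduce :=
  Forest.reduce_eq_of_red fun i =>
    (Hammock.exists_forest (a := a) (b := b) h).choose_spec.red_of_red H (.refl h) i

end Forests

/-! ### Concatenation and grafting -/

section Composition

variable {O : SymOperad.{u}} {W : Submonoid (O.Op 1)} {I : Type} [Preorder I] {a b c : ℕ}

/-- All labelled leaves of `T` sit in the last column of `h`, which carries the standard frame.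
Hence leaf `s` is exactly where the tree `T' s` of the second hammock begins. -/
theorem Unfolds.append {X : Node (envSub W) I} {φ : Frame X a}
    {h : Hammock (envSub W) I X (Node.const (envSub W) I (Env.of O b))}
    {T : ∀ s, Tree W I (Fin b) (φ.v s)} (H : Unfolds φ h T)
    {k : Hammock (envSub W) I (Node.const (envSub W) I (Env.of O b))
      (Node.const (envSub W) I (Env.of O c))}
    {T' : Fin b → Tree W I (Fin c) (Vert.const W I)} (H' : Unfolds (Frame.const W I b) k T') :
    Unfolds φ (h.append k) fun s => (T s).bind T' := by
  induction H with
  | nil => exact H'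
  | right φ ψ f h T k e x hf _ ih => exact .right φ ψ f _ _ k e x hf ih
  | left φ ψ f hf h T e w hw _ ih => exact .left φ ψ f hf _ _ e w hw ih

namespace Forest

/-- The representative of the morphism given by a forest. -/
noncomputable def preHom (F : Forest W I a b) : (treeLoc W I).PreHom a b :=
  ⟨F.k, fun i => TreeLocOp.mk (F.t i), F.e⟩

/-- The forest of trees consisting of a single leaf. -/
def id (W : Submonoid (O.Op 1)) (I : Type) [Preorder I] (a : ℕ) : Forest W I a a where
  k _ := 1
  t _ := ⟨.leaf rfl 0, fun l => by simp [Tree.count, Subsingleton.elim l 0]⟩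
  e := Equiv.sigmaUnique _ _

/-- Grafting of forests. -/
noncomputable def comp (F : Forest W I a b) (G : Forest W I b c) : Forest W I a c where
  k i := ∑ s, G.k (F.e ⟨i, s⟩)
  t i := (F.t i).graft fun s => G.t (F.e ⟨i, s⟩)
  e := (F.preHom.comp G.preHom).e

theorem tree_comp (F : Forest W I a b) (G : Forest W I b c) :
    (F.comp G).tree = fun i => (F.tree i).bind G.tree := by
  funext i
  simp only [tree, comp, Tree.Labelled.graft, Tree.graft, Tree.relabel_bind, Tree.bind_relabel,
    Tree.relabel_relabel]
  refine congrArg (fun f => (F.t i).1.bind f) (funext fun s => ?_)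
  exact congrArg (fun f => Tree.relabel f _)
    (funext fun l => PreHom.comp_e F.preHom G.preHom i s l)

theorem reduce_comp (F : Forest W I a b) (G : Forest W I b c) :
    (F.comp G).reduce = F.reduce.comp G.reduce :=
  congrArg (fun op => EnvHom.mk (PreHom.mk (O := treeLoc W I) (F.comp G).k op (F.comp G).e))
    (funext fun i => (TreeLocOp.γ_mk (F.t i) fun s => G.t (F.e ⟨i, s⟩)).symm)

end Forest

theorem hammockReduction_id [OrderBot I] (a : ℕ) :
    hammockReduction W I a a (HammockHom.id (C := O.Env) (envSub W) I a) =
      EnvHom.mk (PreHom.id (treeLoc W I) a) :=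
  hammockReduction_mk (F := Forest.id W I a) .nil

theorem hammockReduction_comp [OrderBot I] (x : EnvHammock W I a b) (y : EnvHammock W I b c) :
    hammockReduction W I a c (HammockHom.comp x y) =
      (hammockReduction W I a b x).comp (hammockReduction W I b c y) := by
  obtain ⟨h, rfl⟩ := x.exists_rep
  obtain ⟨k, rfl⟩ := y.exists_rep
  obtain ⟨F, H⟩ := Hammock.exists_forest (a := a) (b := b) h
  obtain ⟨G, H'⟩ := Hammock.exists_forest (a := b) (b := c) k
  have hFG : Unfolds (Frame.const W I a) (h.append k) (F.comp G).tree := by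
    rw [F.tree_comp G]
    exact H.append H'
  rw [hammockReduction_mk H, hammockReduction_mk H', ← Forest.reduce_comp]
  exact hammockReduction_mk hFG

end Composition

/-! ### Compatibility with simplicial operators -/

section Naturality

variable {O P : SymOperad.{u}} {W : Submonoid (O.Op 1)} {V : Submonoid (P.Op 1)}
  {I J : Type} [Preorder I] [Preorder J] {a b c d : ℕ}

/-- The map on morphisms induced by a morphism of operads. -/
def SymOperad.EnvHom.push (φ : O ⟶ P) (f : O.EnvHom a b) : P.EnvHom a b :=
  (envMap φ).map (X := a) (Y := b) f

theorem SymOperad.EnvHom.push_comp (φ : O ⟶ P) (f : O.EnvHom a b) (g : O.EnvHom b c) :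
    (f.comp g).push φ = (f.push φ).comp (g.push φ) :=
  (envMap φ).map_comp (X := a) (Y := b) (Z := c) f g

theorem SymOperad.EnvHom.push_perm (φ : O ⟶ P) (p : Fin a ≃ Fin b) :
    (EnvHom.perm O p).push φ = EnvHom.perm P p :=
  congrArg (fun w => EnvHom.unary w p) (funext fun _ => φ.app_one)

/-- The action on frames. -/
def Frame.push (φ : O ⟶ P) (h : ∀ w ∈ W, φ.app w ∈ V) (α : J →o I) {X : Node (envSub W) I}
    (θ : Frame X c) : Frame (X.map (envMap φ) (envSub_map φ h) α) c :=
  Frame.ofOrd (fun s => (θ.v s).push φ h α) (fun i => θ.ord (α i)) fun {i j} hij => by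
    have := congrArg (EnvHom.push φ) (θ.perm_comp_hom (α.monotone hij))
    rw [EnvHom.push_comp, EnvHom.push_perm] at this
    exact this

/-- Transport of frames along an equality. -/
def Frame.cast {X Y : Node (envSub W) I} (h : X = Y) (φ : Frame X c) : Frame Y c := h ▸ φ

theorem Frame.cast_ord {X Y : Node (envSub W) I} (h : X = Y) (φ : Frame X c) (i : I) :
    (φ.cast h).ord i = (φ.ord i).trans (finCongr (congrArg (fun X => Node.size X i) h)) := by
  subst h; rfl

theorem Frame.push_const [OrderBot J] (φ : O ⟶ P) (h : ∀ w ∈ W, φ.app w ∈ V) (α : J →o I)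
    (a : ℕ) : ((Frame.const W I a).push φ h α).cast (Node.map_const _ _ α _) =
      Frame.const V J a :=
  Frame.ext_of_bot (Frame.cast_ord _ _ _)

/-- A variant of `Unfolds` for hammocks with an arbitrary end column. -/
inductive UnfoldsTo {b : ℕ} {Z : Node (envSub W) I} (ζ : Frame Z b)
    (hζ : ∀ s, ζ.v s = Vert.const W I) : ∀ {X : Node (envSub W) I} {c : ℕ} (φ : Frame X c),
      Hammock (envSub W) I X Z → (∀ s, Tree W I (Fin b) (φ.v s)) → Prop
  | nil : UnfoldsTo ζ hζ ζ (.nil Z) fun s => .leaf (hζ s) s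
  | right {X Y : Node (envSub W) I} {c d : ℕ} (φ : Frame X c) (ψ : Frame Y d) (f : X.F ⟶ Y.F)
      (r : RightRep φ ψ f) (h : Hammock (envSub W) I Y Z) (T : ∀ t, Tree W I (Fin b) (ψ.v t)) :
      UnfoldsTo ζ hζ ψ h T →
      UnfoldsTo ζ hζ φ (.right f h) fun s => .fwd (r.x s) fun q => T (r.e ⟨s, q⟩)
  | left {X Y : Node (envSub W) I} {c d : ℕ} (φ : Frame X c) (ψ : Frame Y d) (f : Y.F ⟶ X.F)
      (hf : ∀ i, envSub W (f.app i)) (r : LeftRep φ ψ f) (h : Hammock (envSub W) I Y Z)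
      (T : ∀ t, Tree W I (Fin b) (ψ.v t)) :
      UnfoldsTo ζ hζ ψ h T → UnfoldsTo ζ hζ φ (.left f hf h) fun s => .bwd (r.w s) (T (r.e s))

theorem UnfoldsTo.unfolds {X : Node (envSub W) I} {φ : Frame X c}
    {h : Hammock (envSub W) I X (Node.const (envSub W) I (Env.of O b))}
    {T : ∀ s, Tree W I (Fin b) (φ.v s)}
    (H : UnfoldsTo (Frame.const W I b) (fun _ => rfl) φ h T) : Unfolds φ h T := by
  induction H with
  | nil => exact .nil
  | right φ ψ f r h T _ ih => exact .right φ ψ f h T r.k r.e r.x r.app ih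
  | left φ ψ f hf r h T _ ih => exact .left φ ψ f hf h T r.e r.w r.app ih

/-- Moves hammock, frames and trees along equalities all at once, so that no transport has to be
carried through the induction in `Unfolds.push`. -/
theorem UnfoldsTo.cast {X X' Z Z' : Node (envSub W) I} {ζ : Frame Z b} {ζ' : Frame Z' b}
    {φ : Frame X c} {φ' : Frame X' c} {hζ : ∀ s, ζ.v s = Vert.const W I}
    {h : Hammock (envSub W) I X Z} {T : ∀ s, Tree W I (Fin b) (φ.v s)}
    (H : UnfoldsTo ζ hζ φ h T) (hX : X = X') (hZ : Z = Z') (hφ : φ.cast hX = φ')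
    (hζζ' : ζ.cast hZ = ζ') (hζ' : ∀ s, ζ'.v s = Vert.const W I) (hv : ∀ s, φ.v s = φ'.v s) :
    UnfoldsTo ζ' hζ' φ' (h.cast hX hZ) fun s => (T s).cast (hv s) := by
  subst hX hZ hφ hζζ'
  exact H

/-- Applying `φ` and selecting rows by `α` acts piece by piece, so a splitting is carried to a
splitting. The image hammock ends in the image of a constant column, which is only provably a
constant column; this is why the conclusion is in terms of `UnfoldsTo`. -/
theorem Unfolds.push (φ : O ⟶ P) (h : ∀ w ∈ W, φ.app w ∈ V) (α : J →o I)
    {X : Node (envSub W) I} {θ : Frame X c}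
    {k : Hammock (envSub W) I X (Node.const (envSub W) I (Env.of O b))}
    {T : ∀ s, Tree W I (Fin b) (θ.v s)} (H : Unfolds θ k T) :
    UnfoldsTo ((Frame.const W I b).push φ h α) (fun _ => Vert.push_const φ h α) (θ.push φ h α)
      (k.map (envMap φ) (envSub_map φ h) α) fun s => (T s).push φ h α := by
  induction H with
  | nil => exact .nil
  | @right X Y c d θ ψ f k T n e x hf _ ih =>
    refine UnfoldsTo.right (θ.push φ h α) (ψ.push φ h α) _
      ⟨n, e, fun s => (x s).push φ h α, fun i => ?_⟩ _ _ ih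
    have := congrArg (EnvHom.push φ) (hf (α i))
    refine Eq.trans ?_ this
    refine Eq.trans ?_ (EnvHom.push_comp φ (EnvHom.perm O (θ.ord (α i)))
      (Node.natHom f (α i))).symm
    rw [EnvHom.push_perm]
    rfl
  | @left X Y c d θ ψ f hf k T e w hw _ ih =>
    refine UnfoldsTo.left (θ.push φ h α) (ψ.push φ h α) _ _
      ⟨e, fun s => (w s).push φ h α, fun i => ?_⟩ _ _ ih
    have := congrArg (EnvHom.push φ) (hw (α i))
    refine Eq.trans ?_ this
    refine Eq.trans ?_ (EnvHom.push_comp φ (EnvHom.perm O (ψ.ord (α i)))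
      (Node.natHom f (α i))).symm
    rw [EnvHom.push_perm]
    rfl

/-- The action on forests. -/
def Forest.push (φ : O ⟶ P) (h : ∀ w ∈ W, φ.app w ∈ V) (α : J →o I) (F : Forest W I a b) :
    Forest V J a b :=
  ⟨F.k, fun i => (F.t i).push φ h α, F.e⟩

theorem Forest.tree_push (φ : O ⟶ P) (h : ∀ w ∈ W, φ.app w ∈ V) (α : J →o I)
    (F : Forest W I a b) : (F.push φ h α).tree = fun i =>
      ((F.tree i).push φ h α).cast (Vert.push_const φ h α) := by
  funext i
  simp only [tree, push, Tree.Labelled.push, Tree.push_relabel, Tree.relabel_cast]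
  rfl

theorem hammockReduction_map [OrderBot I] [OrderBot J] (φ : O ⟶ P) (h : ∀ w ∈ W, φ.app w ∈ V)
    (α : J →o I) (x : EnvHammock W I a b) :
    hammockReduction V J a b (envHammockMap φ h α x) =
      (hammockReduction W I a b x).push (treeLocMap φ h α) := by
  obtain ⟨k, rfl⟩ := x.exists_rep
  obtain ⟨F, H⟩ := Hammock.exists_forest (a := a) (b := b) k
  rw [hammockReduction_mk H]
  refine hammockReduction_mk (F := F.push φ h α) ?_
  rw [F.tree_push]
  exact ((H.push φ h α).cast (Node.map_const _ _ α _) (Node.map_const _ _ α _)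
    (Frame.push_const φ h α a) (Frame.push_const φ h α b) (fun _ => rfl)
    (fun _ => Vert.push_const φ h α)).unfolds

end Naturality

/-! ### Fullness: padding trees by identity pieces -/

section Fullness

variable {O : SymOperad.{u}} {W : Submonoid (O.Op 1)} {I : Type} [Preorder I] {L : Type}

namespace Tree

/-- The maximal number of pieces between the root and a leaf. -/
def depth : ∀ {v : Vert W I}, Tree W I L v → ℕ
  | _, leaf _ _ => 0
  | _, fwd _ c => (Finset.univ.sup fun s => (c s).depth) + 1
  | _, bwd _ c => c.depth + 1

/-- The trees of depth at most `N` after removal of a piece `W_1` at the root. -/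
def DepthLEAfterBwd (N : ℕ) : ∀ {v : Vert W I}, Tree W I L v → Prop
  | _, leaf _ _ => True
  | _, fwd x c => (fwd x c).depth ≤ N
  | _, bwd _ c => c.depth ≤ N

theorem depthLEAfterBwd_of_depth_le {N : ℕ} {v : Vert W I} {t : Tree W I L v}
    (h : t.depth ≤ N) : t.DepthLEAfterBwd N := by
  cases t with
  | leaf hv l => trivial
  | fwd x c => exact h
  | bwd w c => exact (Nat.le_succ _).trans h

/-- Makes the tree start with a piece `O_n`, inserting an identity if necessary. Above a piece `W_1`
this does not lower the depth of what follows; the progress shows only after that `W_1` is removed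
by `exists_bwd_red`, and `DepthLEAfterBwd` records this. -/
theorem exists_fwd_red [DecidableEq L] {N : ℕ} {v : Vert W I} (t : Tree W I L v)
    (h : t.depth ≤ N + 1) :
    ∃ (n : ℕ) (u : Fin n → Vert W I) (x : Fwd v u) (c : ∀ s, Tree W I L (u s)),
      Red (fwd x c) t ∧ (∀ l, ∑ s, (c s).count l = t.count l) ∧
        ∀ s, (c s).DepthLEAfterBwd N := by
  cases t with
  | leaf hv l =>
    exact ⟨1, _, Fwd.id v, fun _ => leaf hv l, .fwd_id _, fun l => by simp, fun _ => trivial⟩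
  | fwd x c =>
    refine ⟨_, _, x, c, .refl _, fun l => rfl, fun s => depthLEAfterBwd_of_depth_le ?_⟩
    exact (Finset.le_sup (f := fun s => (c s).depth) (Finset.mem_univ s)).trans
      (Nat.le_of_succ_le_succ h)
  | bwd w c =>
    exact ⟨1, _, Fwd.id v, fun _ => bwd w c, .fwd_id _, fun l => by simp,
      fun _ => Nat.le_of_succ_le_succ h⟩

theorem exists_bwd_red [DecidableEq L] {N : ℕ} {v : Vert W I} (t : Tree W I L v)
    (h : t.DepthLEAfterBwd N) :
    ∃ (u : Vert W I) (w : Bwd v u) (c : Tree W I L u),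
      Red (bwd w c) t ∧ (∀ l, c.count l = t.count l) ∧ c.depth ≤ N := by
  cases t with
  | leaf hv l => exact ⟨_, Bwd.id v, leaf hv l, .bwd_id _, fun _ => rfl, Nat.zero_le _⟩
  | fwd x c => exact ⟨_, Bwd.id v, fwd x c, .bwd_id _, fun _ => rfl, h⟩
  | bwd w c => exact ⟨_, w, c, .refl _, fun _ => rfl, h⟩

theorem eq_leaf_of_depth_eq_zero {v : Vert W I} (t : Tree W I L v) (h : t.depth = 0) :
    ∃ hv l, t = leaf hv l := by
  cases t with
  | leaf hv l => exact ⟨hv, l, rfl⟩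
  | fwd x c => exact (Nat.succ_ne_zero _ h).elim
  | bwd w c => exact (Nat.succ_ne_zero _ h).elim

theorem exists_fwd_leaf_red {v : Vert W I} (hv : v = Vert.const W I) (l : L) :
    ∃ x : Fwd v fun _ : Fin 1 => Vert.const W I,
      Red (fwd x fun _ => leaf rfl l) (leaf hv l) := by
  subst hv
  exact ⟨Fwd.id _, .fwd_id _⟩

end Tree

open TreeHammock.Tree

variable {a b c d : ℕ}

/-- The column of objects with given nodes in the standard order. -/
def Node.ofVerts (v : Fin c → Vert W I) : Node (envSub W) I where
  F :=
    { obj := fun _ => c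
      map := fun h => EnvHom.unary (fun s => (v s).map (leOfHom h)) (Equiv.refl (Fin c))
      map_id := fun i => congrArg (fun w => EnvHom.unary w (Equiv.refl (Fin c)))
        (funext fun s => (v s).map_refl i)
      map_comp := fun h h' => (congrArg (fun w => EnvHom.unary w (Equiv.refl (Fin c)))
        (funext fun s => (v s).map_trans (leOfHom h) (leOfHom h'))).trans
        (EnvHom.unary_comp_unary (fun s => (v s).map (leOfHom h)) (Equiv.refl (Fin c))
          (fun s => (v s).map (leOfHom h')) (Equiv.refl (Fin c))).symm }
  mem h := (envSub_iff (a := c) (b := c) _).2 ⟨_, _, fun s => (v s).mem (leOfHom h), rfl⟩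

/-- The standard frame of a column of objects with given nodes. -/
def Frame.ofVerts (v : Fin c → Vert W I) : Frame (Node.ofVerts v) c :=
  Frame.ofOrd v (fun _ => Equiv.refl _) fun h =>
    EnvHom.perm_refl_comp (EnvHom.unary (fun s => (v s).map h) (Equiv.refl (Fin c)))

/-- Even if all trees are leaves, `X` need not be the constant column with its standard frame, and
the labels may come in another order. A last column of identity pieces, with incidence `σ`, leads to
the standard constant column. -/
theorem exists_unfolds_of_leaf {X : Node (envSub W) I} (θ : Frame X c)
    (hv : ∀ s, θ.v s = Vert.const W I) (σ : Fin c ≃ Fin b) :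
    ∃ (h : Hammock (envSub W) I X (Node.const (envSub W) I (Env.of O b)))
      (T : ∀ s, Tree W I (Fin b) (θ.v s)), Unfolds θ h T ∧
      ∀ s, Red (T s) (leaf (hv s) (σ s)) := by
  choose x hx using fun s => exists_fwd_leaf_red (hv s) (σ s)
  obtain ⟨f, hf⟩ := exists_hom_rightRep θ (Frame.const W I b) (fun _ => 1)
    ((Equiv.sigmaUnique (Fin c) fun _ => Fin 1).trans σ) x
  exact ⟨_, _, .right θ (Frame.const W I b) f _ _ _ _ x hf .nil, hx⟩

/-- The roots of all the children form the next column of objects, in lexicographic order. The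
hypothesis `H` realizes the family of children from there on, for trees satisfying `P`. Pieces `O_0`
have no children and drop out here. -/
theorem exists_unfolds_of_fwd {X : Node (envSub W) I} (θ : Frame X c) {k : Fin c → ℕ}
    {u : ∀ s, Fin (k s) → Vert W I} (x : ∀ s, Fwd (θ.v s) (u s))
    (T : ∀ s r, Tree W I (Fin b) (u s r)) (P : ∀ {v : Vert W I}, Tree W I (Fin b) v → Prop)
    (hP : ∀ s r, P (T s r)) (hT : ∀ l, ∑ s, ∑ r, (T s r).count l = 1)
    (H : ∀ {d : ℕ} {Y : Node (envSub W) I} (ψ : Frame Y d) (T : ∀ s, Tree W I (Fin b) (ψ.v s)),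
      (∀ s, P (T s)) → (∀ l, ∑ s, (T s).count l = 1) →
      ∃ (h : Hammock (envSub W) I Y (Node.const (envSub W) I (Env.of O b)))
        (T' : ∀ s, Tree W I (Fin b) (ψ.v s)), Unfolds ψ h T' ∧ ∀ s, Red (T' s) (T s)) :
    ∃ (h : Hammock (envSub W) I X (Node.const (envSub W) I (Env.of O b)))
      (T' : ∀ s, Tree W I (Fin b) (θ.v s)), Unfolds θ h T' ∧
      ∀ s, Red (T' s) (fwd (x s) (T s)) := by
  let e := finSigmaFinEquiv (n := k)
  -- Nodes and trees are rewritten as families over the single index set `Fin (∑ s, k s)`, so that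
  -- afterwards the pieces `x` have the type required of a column ending in `Frame.ofVerts v`,
  -- without casts.
  obtain ⟨v, rfl⟩ : ∃ v : Fin (∑ s, k s) → Vert W I, u = fun s r => v (e ⟨s, r⟩) :=
    ⟨fun p => u (e.symm p).1 (e.symm p).2, funext fun s => funext fun r =>
      congrArg (fun q : Σ s, Fin (k s) => u q.1 q.2) (e.symm_apply_apply ⟨s, r⟩).symm⟩
  obtain ⟨T, rfl⟩ : ∃ T' : ∀ p, Tree W I (Fin b) (v p), T = fun s r => T' (e ⟨s, r⟩) :=
    ⟨Equiv.piCongrLeft (fun p => Tree W I (Fin b) (v p)) e fun q => T q.1 q.2,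
      funext fun s => funext fun r => (Equiv.piCongrLeft_apply_apply
        (fun p => Tree W I (Fin b) (v p)) e (fun q => T q.1 q.2) ⟨s, r⟩).symm⟩
  have hP' : ∀ p, P (T p) := fun p => by
    obtain ⟨⟨s, r⟩, rfl⟩ := e.surjective p
    exact hP s r
  have hT' : ∀ l, ∑ p, (T p).count l = 1 := fun l =>
    ((e.sum_comp fun p => (T p).count l).symm.trans (Fintype.sum_sigma _)).trans (hT l)
  obtain ⟨h, T', hU, hR⟩ := H (Frame.ofVerts v) T hP' hT'
  obtain ⟨f, hf⟩ := exists_hom_rightRep θ (Frame.ofVerts v) k e x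
  exact ⟨_, _, .right θ _ f h T' k e x hf hU, fun s => .fwd_congr (x s) fun r => hR _⟩

theorem exists_unfolds_of_bwd {X : Node (envSub W) I} (θ : Frame X c)
    {u : Fin c → Vert W I} (w : ∀ s, Bwd (θ.v s) (u s))
    {h : Hammock (envSub W) I (Node.ofVerts u) (Node.const (envSub W) I (Env.of O b))}
    {T : ∀ s, Tree W I (Fin b) (u s)} (H : Unfolds (Frame.ofVerts u) h T) :
    ∃ h, Unfolds θ h fun s => .bwd (w s) (T s) := by
  obtain ⟨f, hf, hf'⟩ := exists_hom_leftRep θ (Frame.ofVerts u) (Equiv.refl _) w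
  exact ⟨_, .left θ (Frame.ofVerts u) f hf h T (Equiv.refl _) w hf' H⟩

/-- Induction on a common bound for the depths: a column of pieces `O_n` followed by a column of
pieces `W_1`, padded with identities, lowers the bound by one. The column and its frame vary in the
induction, as the remaining trees are rooted at later columns. -/
theorem exists_unfolds_of_count (N : ℕ) : ∀ {c : ℕ} {X : Node (envSub W) I} (θ : Frame X c)
    (T : ∀ s, Tree W I (Fin b) (θ.v s)), (∀ s, (T s).depth ≤ N) →
    (∀ l, ∑ s, (T s).count l = 1) →
    ∃ (h : Hammock (envSub W) I X (Node.const (envSub W) I (Env.of O b)))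
      (T' : ∀ s, Tree W I (Fin b) (θ.v s)), Unfolds θ h T' ∧ ∀ s, Red (T' s) (T s) := by
  induction N with
  | zero =>
    intro c X θ T hN hT
    choose hv g hg using fun s => (T s).eq_leaf_of_depth_eq_zero (Nat.le_zero.1 (hN s))
    -- At depth zero only labelled leaves remain, and counting each label once says that their
    -- labelling `g` is a bijection.
    have hT : ∀ l, (Finset.univ.filter fun s => g s = l).card = 1 := fun l => by
      rw [← hT l, Finset.card_filter]
      exact Finset.sum_congr rfl fun s _ => by rw [hg s]; rfl
    have hbij : g.Bijective := by
      refine (Function.bijective_iff_existsUnique g).2 fun l => ?_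
      obtain ⟨s, hs⟩ := Finset.card_eq_one.1 (hT l)
      refine ⟨s, ?_, fun s' hs' => ?_⟩
      · simpa using (Finset.ext_iff.1 hs s).2 (by simp)
      · simpa using (Finset.ext_iff.1 hs s').1 (by simpa using hs')
    obtain ⟨h, T', hU, hR⟩ := exists_unfolds_of_leaf θ hv (Equiv.ofBijective g hbij)
    exact ⟨h, T', hU, fun s => hg s ▸ hR s⟩
  | succ N ih =>
    intro c X θ T hN hT
    choose k u x t hx hc hd using fun s => exists_fwd_red (T s) (hN s)
    obtain ⟨h, T', hU, hR⟩ := exists_unfolds_of_fwd θ x t (fun t => t.DepthLEAfterBwd N) hd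
      (fun l => by simp only [hc, hT]) (by
        intro d Y ψ T hN hT
        choose u w t hw hc hd using fun s => exists_bwd_red (T s) (hN s)
        obtain ⟨h, T', hU, hR⟩ := ih (Frame.ofVerts u) t hd fun l =>
          (Finset.sum_congr rfl fun s _ => hc s l).trans (hT l)
        obtain ⟨h', hU'⟩ := exists_unfolds_of_bwd ψ w hU
        exact ⟨h', _, hU', fun s => (Red.bwd_congr (w s) (hR s)).trans (hw s)⟩)
    exact ⟨h, T', hU, fun s => (hR s).trans (hx s)⟩

theorem Forest.sum_count (F : Forest W I a b) (l : Fin b) : ∑ i, (F.tree i).count l = 1 := by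
  obtain ⟨⟨i, q⟩, rfl⟩ := F.e.surjective l
  have hne : ∀ i', i' ≠ i → (F.tree i').count (F.e ⟨i, q⟩) = 0 := fun i' hi => by
    by_contra h
    have hall : (F.tree i').All fun m => ∃ q', F.e ⟨i', q'⟩ = m :=
      (all_relabel _ _).2 (all_of_forall (fun l => ⟨l, rfl⟩) _)
    obtain ⟨q', h'⟩ := hall.of_count h
    exact hi (congrArg Sigma.fst (F.e.injective h'))
  rw [Finset.sum_eq_single i (fun i' _ => hne i') (by simp)]
  refine (count_relabel_of_injective (f := fun l => F.e ⟨i, l⟩) (fun l l' h => ?_) q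
    (F.t i).1).trans ((F.t i).2 q)
  simpa using F.e.injective h

/-- The hammock built from the forest unfolds into padded trees only. These reduce to the given
trees, which suffices by `Forest.reduce_eq_of_red`. -/
theorem hammockReduction_surjective [OrderBot I] :
    Function.Surjective (hammockReduction W I a b) := by
  intro y
  obtain ⟨⟨k, op, e⟩, rfl⟩ := y.exists_rep
  obtain ⟨t, rfl⟩ := TreeLocOp.exists_reps op
  let F : Forest W I a b := ⟨k, t, e⟩
  obtain ⟨h, T', hU, hR⟩ := exists_unfolds_of_count
    (Finset.univ.sup fun i => (F.tree i).depth) (Frame.const W I a) F.tree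
    (fun i => Finset.le_sup (f := fun i => (F.tree i).depth) (Finset.mem_univ i)) F.sum_count
  obtain ⟨F', rfl⟩ := exists_forest T' hU.count
  exact ⟨HammockHom.mk h, (hammockReduction_mk hU).trans (Forest.reduce_eq_of_red hR)⟩

end Fullness

/-- The functor given by hammock reduction. -/
noncomputable def hammockReductionFunctor (𝒪 : SimplicialOperad.{u})
    (𝒲 : SimplicialSubmonoid 𝒪) : BisimplicialFunctor (hammockLocalization 𝒪 𝒲)
      (bisimplicialEnv (treeHammockLocalization 𝒪 𝒲)) where
  app a b :=
    { app := fun S => TypeCat.ofHom (hammockReduction (𝒲.W S.1) (Rows S.2) a b)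
      naturality := fun S T f => by
        ext x
        exact hammockReduction_map (𝒪.map f.1) (𝒲.map_mem f.1) (rowMap f.2) x }
  app_id a _ := hammockReduction_id a
  app_comp x y := hammockReduction_comp x y

end TreeHammock

theorem mainTheorem5 (𝒪 : TreeHammock.SimplicialOperad.{u})
    (𝒲 : TreeHammock.SimplicialSubmonoid 𝒪) :
    ∃ R : TreeHammock.BisimplicialFunctor (TreeHammock.hammockLocalization 𝒪 𝒲)
        (TreeHammock.bisimplicialEnv (TreeHammock.treeHammockLocalization 𝒪 𝒲)),
      TreeHammock.IsHammockReduction R ∧ R.Full :=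
  ⟨TreeHammock.hammockReductionFunctor 𝒪 𝒲,
    fun _ _ _ h => ⟨TreeHammock.Hammock.exists_forest h,
      fun _ H => TreeHammock.hammockReduction_mk H⟩,
    fun _ _ _ => TreeHammock.hammockReduction_surjective⟩
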